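/- Let $n\ge 3$ and $p>0$, and give $\mathbb{R}^n$ the density $r^p=|x|^p$: the weighted volume of a measurable set is the integral of $|x|^p$ over it, and its weighted perimeter is the integral of $|x|^p$ over its topological boundary with respect to $(n-1)$-dimensional Hausdorff measure. Let $E\subset\mathbb{R}^n$ be an open isoperimetric region (of finite weighted volume, and of least weighted perimeter among all measurable sets of the same weighted volume) that is spherically symmetric about the positive $e_1$-axis, i.e. $E$ meets each sphere centered at the origin in a (possibly empty or full) spherical cap around the positive $e_1$-axis. Let $A\subset\mathbb{R}^2$ be the planar section whose rotation about the $e_1$-axis is $E$, and assume, after scaling, that the rightmost point of $\partial A$ is $(1,0)$. Let $\gamma=(\gamma_1,\gamma_2):[-\beta,\beta]\to\mathbb{R}^2$, $\beta>0$, be the generating curve: the closed Jordan curve, symmetric about the $e_1$-axis, obtained by following $\partial A$ from $\gamma(0)=(1,0)$ in both directions until it meets the $e_1$-axis again at $\gamma(\beta)=\gamma(-\beta)$, parameterized counterclockwise by arclength, with $\gamma_2>0$ on $(0,\beta)$; as usual, $\partial A$ is assumed to be regular along $\gamma$ except possibly at $\gamma(\pm\beta)$, i.e. $\gamma$ is smooth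 on $(-\beta,\beta)$ and $\partial A$ coincides with the trace of $\gamma$ near each $\gamma(s)$, $|s|<\beta$. For $s\ne0$ with $\gamma'(s)$ not vertical let $(F(s),0)$ be the center of the circle that is centered on the $e_1$-axis and tangent to $\gamma$ at $\gamma(s)$, and let $F(0)=\lim_{s\to0}F(s)$. Suppose that $F(0)<1/2$ (the left case). Let $K$ be the set of all $s\in(0,\beta)$ such that $\gamma_1'(t)<0<\gamma_2'(t)$ for all $t\in(0,s)$. Then $K$ has a least upper bound $\delta$, one has $\delta\in[0,\beta)$ and $\gamma'(\delta)=(-1,0)$, and $\delta$ is the only $s\in[0,\beta)$ with $\gamma'(s)=(-1,0)$. -/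

import Mathlib

open Set Filter Topology MeasureTheory
open scoped ContDiff

noncomputable section

namespace RadialDensity

/-- The Euclidean plane, in which generating curves live. -/
abbrev Plane : Type := EuclideanSpace ℝ (Fin 2)

/-- The weighted volume of `E ⊆ ℝⁿ` for the density `r ^ p`. -/
def weightedVolume {n : ℕ} (p : ℝ) (E : Set (EuclideanSpace ℝ (Fin n))) : ENNReal :=
  ∫⁻ x in E, ENNReal.ofReal (‖x‖ ^ p)

/-- The weighted perimeter of `E ⊆ ℝⁿ` for the density `r ^ p`: the integral of the density over
the topological boundary with respect to `(n - 1)`-dimensional Hausdorff measure (in Mathlib's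
normalization that agrees with Lebesgue measure on Euclidean spaces). -/
def weightedPerimeter {n : ℕ} (p : ℝ) (E : Set (EuclideanSpace ℝ (Fin n))) : ENNReal :=
  ∫⁻ x in frontier E, ENNReal.ofReal (‖x‖ ^ p) ∂(μHE[n - 1])

/-- `E` is an isoperimetric region for the density `r ^ p`: it is measurable, has finite weighted
volume, and minimizes weighted perimeter among all regions of the same weighted volume. -/
structure IsIsoperimetric {n : ℕ} (p : ℝ) (E : Set (EuclideanSpace ℝ (Fin n))) : Prop where
  measurableSet : MeasurableSet E
  volume_ne_top : weightedVolume p E ≠ ⊤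
  perimeter_le : ∀ E' : Set (EuclideanSpace ℝ (Fin n)), MeasurableSet E' →
    weightedVolume p E' = weightedVolume p E → weightedPerimeter p E ≤ weightedPerimeter p E'

/-- `E` is spherically symmetric about the positive `e₁`-axis: it meets every sphere centered at
the origin in an (open or closed, possibly empty or full) spherical cap around the positive
`e₁`-axis. -/
def IsSphericallySymmetric {n : ℕ} [NeZero n] (E : Set (EuclideanSpace ℝ (Fin n))) : Prop :=
  ∀ r : ℝ, 0 < r → ∃ t : ℝ,
    E ∩ Metric.sphere 0 r = {x | x ∈ Metric.sphere 0 r ∧ t < x 0} ∨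
    E ∩ Metric.sphere 0 r = {x | x ∈ Metric.sphere 0 r ∧ t ≤ x 0}

/-- The planar set `A` that generates `E` by rotation about the `e₁`-axis: the section of `E` by
the plane spanned by `e₁` and `e₂`. -/
def generatingSet {n : ℕ} [NeZero n] (E : Set (EuclideanSpace ℝ (Fin n))) : Set Plane :=
  {q | EuclideanSpace.single (0 : Fin n) (q 0) + EuclideanSpace.single (1 : Fin n) (q 1) ∈ E}

/-- `γ : [-β, β] → ℝ²` is the generating curve of the planar set `A`, normalized so as to start at
the point `(1, 0)`, the rightmost point of `∂A`: following `∂A` from `(1, 0)` in both directions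
until the `e₁`-axis is met again, it is a closed Jordan curve, parameterized counterclockwise by
arclength, symmetric about the `e₁`-axis, and smooth except possibly at the endpoint
`γ(β) = γ(-β)`. Values of `γ` outside `[-β, β]` are irrelevant. -/
structure IsGeneratingCurve (A : Set Plane) (β : ℝ) (γ : ℝ → Plane) : Prop where
  pos : 0 < β
  continuousOn : ContinuousOn γ (Icc (-β) β)
  contDiffOn : ContDiffOn ℝ ∞ γ (Ioo (-β) β)
  /-- arclength parameterization -/
  norm_deriv : ∀ s ∈ Ioo (-β) β, ‖deriv γ s‖ = 1
  injOn : InjOn γ (Ico (-β) β)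
  mem_frontier : ∀ s ∈ Icc (-β) β, γ s ∈ frontier A
  /-- Together with smoothness, unit speed and injectivity: near each `γ(s)` with `|s| < β`, the
  boundary `∂A` is a smooth embedded curve, and `γ` follows it. -/
  follows_frontier : ∀ s ∈ Ioo (-β) β, ∀ᶠ q in 𝓝 (γ s), q ∈ frontier A → q ∈ γ '' Ioo (-β) β
  start : γ 0 = !₂[1, 0]
  rightmost : ∀ q ∈ frontier A, q 0 ≤ 1
  symm_fst : ∀ s ∈ Icc (-β) β, γ (-s) 0 = γ s 0
  symm_snd : ∀ s ∈ Icc (-β) β, γ (-s) 1 = -γ s 1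
  /-- counterclockwise, and not meeting the axis again before `γ(β)` -/
  above_axis : ∀ s ∈ Ioo 0 β, 0 < γ s 1
  end_on_axis : γ β 1 = 0

/-- The abscissa `F(s)` of the center of the canonical circle at `s`, for `s ≠ 0` such that the
tangent `γ'(s)` is not vertical (see `isCanonicalCenter_iff`). -/
def canonicalAbscissa (γ : ℝ → Plane) (s : ℝ) : ℝ :=
  inner ℝ (γ s) (deriv γ s) / deriv γ s 0

/-- When `γ'(s)` is not vertical, `(F(s), 0)` is the only point of the `e₁`-axis such that the
circle around it through `γ(s)` is tangent to `γ` there. -/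
theorem isCanonicalCenter_iff (γ : ℝ → Plane) (s a : ℝ) (h : deriv γ s 0 ≠ 0) :
    inner ℝ (γ s - !₂[a, 0]) (deriv γ s) = 0 ↔ a = canonicalAbscissa γ s := by
  have h1 : inner ℝ (!₂[a, 0] : Plane) (deriv γ s) = a * deriv γ s 0 := by
    simp [PiLp.inner_apply, Fin.sum_univ_two, mul_comm]
  rw [canonicalAbscissa, inner_sub_left, h1, eq_div_iff h]
  constructor <;> intro h2 <;> linarith

/-- `F(0) = F₀`: the canonical circle `C₀` is the limit of the circles `C_s` as `s → 0`, so `F(0)`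
is the limit of `F(s)`. -/
def HasInitialAbscissa (γ : ℝ → Plane) (F₀ : ℝ) : Prop :=
  Tendsto (canonicalAbscissa γ) (𝓝[≠] 0) (𝓝 F₀)

/-- The upper curve `K ⊆ (0, β)`: those `s` such that `γ'` is strictly in the second quadrant
on `(0, s)`. -/
def upperCurve (β : ℝ) (γ : ℝ → Plane) : Set ℝ :=
  {s | s ∈ Ioo 0 β ∧ ∀ t ∈ Ioo 0 s, deriv γ t 0 < 0 ∧ 0 < deriv γ t 1}

end RadialDensity

end

/-!
Why the theorem is true. Write the generating curve as `γ = (x, y)` with unit velocity `(c, σ)`.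
The plan is to show that the upper half of `γ` solves an ordinary differential equation, the
constancy of a generalized mean curvature, and that in the left case the only solution that returns
to the axis is an arc of a circle centered on the axis. On such an arc `σ` is strictly decreasing
and `c < 0`, so `γ'` is strictly in the second quadrant up to the only zero `δ` of `σ`, where
`γ' = (-1, 0)`.

*From isoperimetry to the equation.* A set of revolution is the preimage of its planar section under
`profile x = (x₀, |x - x₀ e₁|)`. Weighted volume and weighted area of such sets are, up to
constants, plane area and arclength with the weight `|q| ^ p * q₁ ^ (n - 2)`: this is the content of
`exists_volume_const` and of the area formula `lintegral_surface`, which is proved by comparing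
small pieces of the surface with round cylinders. Since dilations scale volume and perimeter by
fixed powers, the isoperimetric region minimizes perimeter / volume ^ α among all regions
(`IsIsoperimetric.perimeter_le_mul`), so that the competitors of the first variation need not
preserve volume. Where the section is locally a subgraph, perturbing the graph gives the
Euler-Lagrange equation (`euler_lagrange_of_graph`), that is, the generalized mean curvature with
respect to the outward normal is a positive constant `Λ` (`IsIsoperimetric.exists_mean_curvature`).

*Both sides of the curve.* Near a point of `γ` the boundary is a graph, and each of its two sides is
inside or outside the section. Spherical symmetry says that rotating a point of the section towards
the positive axis keeps it in the section, so if the section lies on one side only, then the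
generalized mean curvature is `±Λ` and the sign determines the sign of `⟪γ, γ'⟫`; if it lies on both
sides, then `⟪γ, γ'⟫ = 0` (`IsGeneratingCurve.dichotomy`). Finite volume confines the section to the
unit disc. The two-sided points of `γ` form a clopen set, and if it were everything then `γ` would
run along the unit circle inside the open unit disc. Hence the generalized mean curvature is
constant and `⟪γ, γ'⟫ ≤ 0` (`IsGeneratingCurve.curvature_eq_const`).

*The equation.* Let `κ` be the curvature of `γ`, `λ = -c / y` the curvature of the canonical circle,
`F` its center, and `P = |γ|² - 2 x F` the difference between its squared radius and `F²`. The
weighted gap `N = |γ| ^ p * y ^ (n - 1) * (λ - κ)` tends to zero at both ends of the curve, because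
`n ≥ 3`. Its derivative has the sign of `⟪γ, γ'⟫ * c * P`, while `F' = y * (κ - λ) / c²` and
`P' = -2 x F'`. The left case means `P > 0` at the start, and as long as `c < 0` these relations
preserve `P > 0`, `N ≥ 0` and `F' ≤ 0` (`IsProfileSolution.power_pos`). As `F` stays bounded, `γ`
cannot become vertical, so `c < 0` throughout (`IsProfileSolution.cos_neg`); then `N` is monotone
with limit zero at both ends, so `κ = λ > 0` and `σ' = κ * c < 0`
(`IsProfileSolution.strictAntiOn_sin`).
-/

open scoped NNReal ENNReal Pointwise

noncomputable section

namespace RadialDensity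

/-! ### The profile of a point -/

section Profile

variable {n : ℕ} [NeZero n]

/-- The component of `x` orthogonal to the `e₁`-axis. -/
def radialPart (x : EuclideanSpace ℝ (Fin n)) : EuclideanSpace ℝ (Fin n) :=
  x - EuclideanSpace.single 0 (x 0)

/-- The point of the closed upper half-plane whose orbit under the rotations about the `e₁`-axis
contains `x`. -/
def profile (x : EuclideanSpace ℝ (Fin n)) : Plane := !₂[x 0, ‖radialPart x‖]

@[simp]
theorem profile_zero (x : EuclideanSpace ℝ (Fin n)) : profile x 0 = x 0 := by simp [profile]

@[simp]
theorem profile_one (x : EuclideanSpace ℝ (Fin n)) : profile x 1 = ‖radialPart x‖ := by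
  simp [profile]

@[simp]
theorem radialPart_apply_zero (x : EuclideanSpace ℝ (Fin n)) : radialPart x 0 = 0 := by
  simp [radialPart]

theorem single_add_radialPart (x : EuclideanSpace ℝ (Fin n)) :
    EuclideanSpace.single 0 (x 0) + radialPart x = x := by simp [radialPart]

theorem radialPart_sub (x y : EuclideanSpace ℝ (Fin n)) :
    radialPart (x - y) = radialPart x - radialPart y := by
  ext i
  by_cases hi : i = 0 <;> simp [radialPart, hi]

theorem radialPart_eq_self {x : EuclideanSpace ℝ (Fin n)} (hx : x 0 = 0) : radialPart x = x := by
  ext i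
  by_cases hi : i = 0 <;> simp [radialPart, hx]

theorem single_add_apply_zero {w : EuclideanSpace ℝ (Fin n)} (hw : w 0 = 0) (a : ℝ) :
    ((EuclideanSpace.single 0 a : EuclideanSpace ℝ (Fin n)) + w) 0 = a := by simp [hw]

theorem radialPart_single_add {w : EuclideanSpace ℝ (Fin n)} (hw : w 0 = 0) (a : ℝ) :
    radialPart ((EuclideanSpace.single 0 a : EuclideanSpace ℝ (Fin n)) + w) = w := by
  rw [radialPart, single_add_apply_zero hw]; simp

theorem norm_single_add_sq {w : EuclideanSpace ℝ (Fin n)} (hw : w 0 = 0) (a : ℝ) :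
    ‖(EuclideanSpace.single 0 a : EuclideanSpace ℝ (Fin n)) + w‖ ^ 2 = a ^ 2 + ‖w‖ ^ 2 := by
  rw [@norm_add_sq_real, EuclideanSpace.inner_single_left]
  simp [hw]

theorem norm_sq_eq (x : EuclideanSpace ℝ (Fin n)) : ‖x‖ ^ 2 = (x 0) ^ 2 + ‖radialPart x‖ ^ 2 := by
  conv_lhs => rw [← single_add_radialPart x]
  exact norm_single_add_sq (radialPart_apply_zero x) _

theorem plane_norm_sq (q : Plane) : ‖q‖ ^ 2 = q 0 ^ 2 + q 1 ^ 2 := by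
  simp [EuclideanSpace.norm_sq_eq, Fin.sum_univ_two]

@[simp]
theorem norm_profile (x : EuclideanSpace ℝ (Fin n)) : ‖profile x‖ = ‖x‖ := by
  have h : ‖profile x‖ ^ 2 = ‖x‖ ^ 2 := by rw [plane_norm_sq, norm_sq_eq x]; simp
  exact (sq_eq_sq₀ (norm_nonneg _) (norm_nonneg _)).1 h

@[fun_prop]
theorem continuous_radialPart :
    Continuous (radialPart : EuclideanSpace ℝ (Fin n) → EuclideanSpace ℝ (Fin n)) := by
  have : (radialPart : EuclideanSpace ℝ (Fin n) → _) =
      fun x => x - (x 0) • EuclideanSpace.single (0 : Fin n) (1 : ℝ) := by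
    funext x; ext i; simp [radialPart]
  rw [this]; fun_prop

@[fun_prop]
theorem continuous_profile : Continuous (profile : EuclideanSpace ℝ (Fin n) → Plane) := by
  refine (PiLp.continuous_toLp 2 _).comp (continuous_pi fun i => ?_)
  fin_cases i
  · simpa using (by fun_prop : Continuous fun x : EuclideanSpace ℝ (Fin n) => x 0)
  · simpa using (by fun_prop : Continuous fun x : EuclideanSpace ℝ (Fin n) => ‖radialPart x‖)

theorem dist_sq_eq (x y : EuclideanSpace ℝ (Fin n)) :
    dist x y ^ 2 = (x 0 - y 0) ^ 2 + dist (radialPart x) (radialPart y) ^ 2 := by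
  rw [dist_eq_norm, dist_eq_norm, norm_sq_eq, radialPart_sub]; simp

/-- Rescaling two vectors of the same length `b`. -/
theorem dist_smul_smul_sq {V : Type*} [NormedAddCommGroup V] [InnerProductSpace ℝ V] {w w' : V}
    {b : ℝ} (hw : ‖w‖ = b) (hw' : ‖w'‖ = b) (s t : ℝ) :
    dist (s • w) (t • w') ^ 2 = (s - t) ^ 2 * b ^ 2 + s * t * dist w w' ^ 2 := by
  simp only [dist_eq_norm, @norm_sub_sq_real, norm_smul, inner_smul_left, inner_smul_right, mul_pow,
    hw, hw', Real.norm_eq_abs, sq_abs]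
  simp
  ring

end Profile

/-! ### Comparison of measures -/

section Comparison

theorem euclideanHausdorffMeasure_image_le_of_lipschitzOnWith {X Y : Type*} [EMetricSpace X]
    [MeasurableSpace X] [BorelSpace X] [EMetricSpace Y] [MeasurableSpace Y] [BorelSpace Y]
    {K : ℝ≥0} {f : X → Y} {s : Set X} (h : LipschitzOnWith K f s) (d : ℕ) :
    μHE[d] (f '' s) ≤ (K : ℝ≥0∞) ^ d * μHE[d] s := by
  simp only [Measure.euclideanHausdorffMeasure_def, Measure.smul_apply]
  have := h.hausdorffMeasure_image_le (d := d) (by positivity)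
  rw [ENNReal.rpow_natCast] at this
  calc _ ≤ _ • ((K : ℝ≥0∞) ^ d * μH[d] s) := by gcongr
    _ = _ := by rw [mul_smul_comm]

theorem euclideanHausdorffMeasure_le_image_of_antilipschitzOn {X Y : Type*} [MetricSpace X]
    [MeasurableSpace X] [BorelSpace X] [MetricSpace Y] [MeasurableSpace Y] [BorelSpace Y]
    {K : ℝ≥0} {f : X → Y} {s : Set X}
    (h : ∀ x ∈ s, ∀ y ∈ s, dist x y ≤ K * dist (f x) (f y)) (d : ℕ) :
    μHE[d] s ≤ (K : ℝ≥0∞) ^ d * μHE[d] (f '' s) := by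
  have hinj : InjOn f s := fun x hx y hy hxy => by
    have := h x hx y hy
    rw [hxy, dist_self, mul_zero] at this
    exact dist_le_zero.1 this
  rcases s.eq_empty_or_nonempty with rfl | ⟨x₀, hx₀⟩
  · simp
  have : Nonempty X := ⟨x₀⟩
  have hl : LipschitzOnWith K (Function.invFunOn f s) (f '' s) := by
    refine LipschitzOnWith.of_dist_le_mul ?_
    rintro _ ⟨x, hx, rfl⟩ _ ⟨y, hy, rfl⟩
    rw [hinj.leftInvOn_invFunOn hx, hinj.leftInvOn_invFunOn hy]
    exact h x hx y hy
  have := euclideanHausdorffMeasure_image_le_of_lipschitzOnWith hl d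
  rwa [hinj.leftInvOn_invFunOn.image_image] at this

/-- A measure that is locally at most `1 + ε` times another one, for every `ε`, is at most the
other one. -/
theorem measure_le_of_locally_le {X : Type*} [TopologicalSpace X] [SecondCountableTopology X]
    [MeasurableSpace X] [BorelSpace X] {μ ν : Measure X} {s : Set X} (hs : MeasurableSet s)
    (h : ∀ x ∈ s, ∀ ε : ℝ≥0, 0 < ε → ∃ u ∈ 𝓝 x, ∀ t ⊆ s ∩ u, MeasurableSet t →
      μ t ≤ (1 + ε) * ν t) : μ s ≤ ν s := by
  have key : ∀ ε : ℝ≥0, 0 < ε → μ s ≤ (1 + ε) * ν s := by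
    intro ε hε
    choose! u hu hut using fun x hx => h x hx ε hε
    obtain ⟨c, hcs, hc, hcov⟩ := TopologicalSpace.countable_cover_nhdsWithin
      (f := fun x => interior (u x)) (s := s)
      (fun x hx => mem_nhdsWithin_of_mem_nhds (interior_mem_nhds.2 (hu x hx)))
    have := hc.to_subtype
    rcases c.eq_empty_or_nonempty with rfl | hne
    · have : s = ∅ := by simpa using hcov
      simp [this]
    obtain ⟨e, he⟩ := hc.exists_eq_range hne
    let v : ℕ → Set X := fun k => s ∩ disjointed (fun k => interior (u (e k))) k
    have hv : ∀ k, MeasurableSet (v k) := fun k =>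
      hs.inter (MeasurableSet.disjointed (fun i => isOpen_interior.measurableSet) k)
    have hdisj : Pairwise (Function.onFun Disjoint v) := fun i j hij =>
      ((disjoint_disjointed (fun k => interior (u (e k)))) hij).mono inter_subset_right
        inter_subset_right
    have hU : ⋃ k, v k = s := by
      rw [← inter_iUnion, iUnion_disjointed]
      refine inter_eq_left.2 fun x hx => ?_
      have := hcov hx
      rw [he, biUnion_range] at this
      exact this
    rw [← hU, measure_iUnion hdisj hv, measure_iUnion hdisj hv, ← ENNReal.tsum_mul_left]
    refine ENNReal.tsum_le_tsum fun k => ?_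
    refine hut (e k) (hcs (he ▸ mem_range_self k)) _ ?_ (hv k)
    exact inter_subset_inter_right _ ((disjointed_le _ k).trans interior_subset)
  have hlim : Tendsto (fun k : ℕ => (1 + ((1 / ((k : ℝ≥0) + 1) : ℝ≥0) : ℝ≥0∞)) * ν s) atTop
      (𝓝 ((1 + ((0 : ℝ≥0) : ℝ≥0∞)) * ν s)) := by
    refine ENNReal.Tendsto.mul_const ?_ (Or.inl (by simp))
    exact tendsto_const_nhds.add
      (ENNReal.tendsto_coe.2 tendsto_one_div_add_atTop_nhds_zero_nat)
  simp only [ENNReal.coe_zero, add_zero, one_mul] at hlim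
  exact ge_of_tendsto' hlim fun k => key _ (by positivity)

end Comparison

/-! ### The area of round cylinders -/

section Cylinder

variable {n : ℕ} [NeZero n]

/-- The points of the round cylinder of radius `b` around the `e₁`-axis whose first coordinate
lies in `J`. -/
def cylinder (n : ℕ) [NeZero n] (b : ℝ) (J : Set ℝ) : Set (EuclideanSpace ℝ (Fin n)) :=
  {x | x 0 ∈ J ∧ ‖radialPart x‖ = b}

theorem radialPart_add (x y : EuclideanSpace ℝ (Fin n)) :
    radialPart (x + y) = radialPart x + radialPart y := by
  ext i
  by_cases hi : i = 0 <;> simp [radialPart, hi]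

theorem radialPart_smul (c : ℝ) (x : EuclideanSpace ℝ (Fin n)) :
    radialPart (c • x) = c • radialPart x := by
  ext i
  by_cases hi : i = 0 <;> simp [radialPart, hi]

theorem radialPart_single (a : ℝ) :
    radialPart (EuclideanSpace.single 0 a : EuclideanSpace ℝ (Fin n)) = 0 := by
  simp [radialPart]

theorem contDiff_radialPart :
    ContDiff ℝ 1 (radialPart : EuclideanSpace ℝ (Fin n) → EuclideanSpace ℝ (Fin n)) := by
  have : (radialPart : EuclideanSpace ℝ (Fin n) → _) =
      fun x => x - (x 0) • EuclideanSpace.single (0 : Fin n) (1 : ℝ) := by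
    funext x; ext i; simp [radialPart]
  rw [this]; fun_prop

/-- Half of a bounded piece of the cylinder is a Lipschitz image of a bounded piece of a hyperplane,
by inverse stereographic projection in the spherical variable. -/
theorem cylinder_half_lt_top (hn : 1 ≤ n) {v : EuclideanSpace ℝ (Fin n)} (hv : ‖v‖ = 1)
    (hv0 : v 0 = 0) (a : ℝ) :
    μHE[n - 1] {x | x ∈ cylinder n 1 (Icc (-a) a) ∧ inner ℝ v (radialPart x) ≤ 0} < ⊤ := by
  set H : Submodule ℝ (EuclideanSpace ℝ (Fin n)) := (ℝ ∙ v)ᗮ with hH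
  let G : H → EuclideanSpace ℝ (Fin n) := fun z =>
    EuclideanSpace.single 0 ((z : EuclideanSpace ℝ (Fin n)) 0) + stereoInvFunAux v (radialPart z)
  have hG : ContDiff ℝ 1 G := by
    have h1 : ContDiff ℝ 1 fun z : H => stereoInvFunAux v (radialPart (z : EuclideanSpace ℝ _)) :=
      contDiff_stereoInvFunAux.comp (contDiff_radialPart.comp H.subtypeL.contDiff)
    have h2 : ContDiff ℝ 1 fun z : H =>
        (EuclideanSpace.single 0 ((z : EuclideanSpace ℝ (Fin n)) 0) :
          EuclideanSpace ℝ (Fin n)) := by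
      have : (fun z : H => (EuclideanSpace.single 0 ((z : EuclideanSpace ℝ (Fin n)) 0) :
          EuclideanSpace ℝ (Fin n))) =
          fun z : H => ((EuclideanSpace.proj 0).comp H.subtypeL : H →L[ℝ] ℝ) z •
            EuclideanSpace.single (0 : Fin n) (1 : ℝ) := by
        funext z; ext i; simp
      rw [this]
      exact ContDiff.smul (ContinuousLinearMap.contDiff
        ((EuclideanSpace.proj 0).comp H.subtypeL : H →L[ℝ] ℝ)) contDiff_const
    exact h2.add h1
  have hfin : Module.finrank ℝ H = n - 1 := by
    have := Submodule.finrank_add_finrank_orthogonal (𝕜 := ℝ) (ℝ ∙ v)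
    rw [finrank_span_singleton (by rintro rfl; simp at hv), finrank_euclideanSpace_fin,
      ← hH] at this
    omega
  have hloc : LocallyLipschitz G := hG.locallyLipschitz
  obtain ⟨K, hK⟩ := LocallyLipschitzOn.exists_lipschitzOnWith_of_compact
    (isCompact_closedBall (0 : H) (|a| + 2)) hloc.locallyLipschitzOn
  have hsub : {x | x ∈ cylinder n 1 (Icc (-a) a) ∧ inner ℝ v (radialPart x) ≤ 0} ⊆
      G '' Metric.closedBall (0 : H) (|a| + 2) := by
    rintro x ⟨⟨hx0, hx1⟩, hxv⟩
    set w := radialPart x with hw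
    set t := inner ℝ v w with ht
    have ht1 : t ≤ 0 := hxv
    have h1t : (1 - t) ≠ 0 := by linarith
    have hw0 : w 0 = 0 := radialPart_apply_zero x
    set z' : EuclideanSpace ℝ (Fin n) := (2 / (1 - t)) • (w - t • v) with hz'
    have hz'0 : z' 0 = 0 := by simp [hz', hw0, hv0]
    have hvv : inner ℝ v v = (1 : ℝ) := by rw [real_inner_self_eq_norm_sq, hv]; norm_num
    have hz'n : ‖z'‖ ^ 2 = 4 * (1 + t) / (1 - t) := by
      rw [hz', norm_smul, mul_pow, @norm_sub_sq_real, inner_smul_right, norm_smul, hv, hx1,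
        real_inner_comm, ← ht, mul_one, Real.norm_eq_abs, Real.norm_eq_abs, sq_abs, sq_abs]
      field_simp; ring
    have hz'H : z' ∈ H := by
      rw [hH, Submodule.mem_orthogonal_singleton_iff_inner_right, hz', inner_smul_right,
        inner_sub_right, inner_smul_right, hvv, ← ht]
      ring
    have hsH : (EuclideanSpace.single 0 (x 0) : EuclideanSpace ℝ (Fin n)) ∈ H := by
      rw [hH, Submodule.mem_orthogonal_singleton_iff_inner_right, EuclideanSpace.inner_single_right]
      simp [hv0]
    refine ⟨⟨EuclideanSpace.single 0 (x 0) + z', H.add_mem hsH hz'H⟩, ?_, ?_⟩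
    · rw [mem_closedBall_zero_iff, Submodule.coe_norm]
      refine (norm_add_le _ _).trans ?_
      have h2 : ‖z'‖ ≤ 2 := by
        refine abs_le_of_sq_le_sq' ?_ (by norm_num) |>.2
        rw [hz'n, div_le_iff₀ (by linarith)]
        nlinarith
      have h3 : |x 0| ≤ |a| := (abs_le.2 hx0).trans (le_abs_self a)
      simpa using add_le_add h3 h2
    · change EuclideanSpace.single 0 ((EuclideanSpace.single 0 (x 0) + z' :
        EuclideanSpace ℝ (Fin n)) 0) + stereoInvFunAux v (radialPart (_ + z')) = x
      rw [radialPart_single_add hz'0, single_add_apply_zero hz'0, stereoInvFunAux_apply, hz'n]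
      conv_rhs => rw [← single_add_radialPart x]
      congr 1
      rw [← hw, hz', smul_smul, smul_add, smul_smul, smul_smul]
      have e1 : (4 * (1 + t) / (1 - t) + 4)⁻¹ = (1 - t) / 8 := by
        have : 4 * (1 + t) / (1 - t) + 4 = 8 / (1 - t) := by field_simp; ring
        rw [this, inv_div]
      have e2 : (1 - t) / 8 * (4 * (2 / (1 - t))) = 1 := by field_simp; ring
      have e3 : (1 - t) / 8 * (4 * (1 + t) / (1 - t) - 4) = t := by field_simp; ring
      rw [e1, e2, e3]; module
  calc _ ≤ μHE[n - 1] (G '' Metric.closedBall (0 : H) (|a| + 2)) := measure_mono hsub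
    _ ≤ (K : ℝ≥0∞) ^ (n - 1) * μHE[n - 1] (Metric.closedBall (0 : H) (|a| + 2)) :=
      euclideanHausdorffMeasure_image_le_of_lipschitzOnWith hK _
    _ < ⊤ := by
      refine ENNReal.mul_lt_top (by simp) ?_
      rw [← hfin]
      exact (isCompact_closedBall _ _).measure_lt_top

theorem cylinder_lt_top (hn : 2 ≤ n) (a : ℝ) : μHE[n - 1] (cylinder n 1 (Icc (-a) a)) < ⊤ := by
  obtain ⟨i, hi⟩ : ∃ i : Fin n, i ≠ 0 := ⟨⟨1, hn⟩, by
    intro h; have := congrArg Fin.val h; simp at this⟩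
  set v : EuclideanSpace ℝ (Fin n) := EuclideanSpace.single i 1 with hv
  have h1 := cylinder_half_lt_top (n := n) (by omega) (v := v) (by simp [hv])
    (by simp [hv, hi.symm]) a
  have h2 := cylinder_half_lt_top (n := n) (by omega) (v := -v) (by simp [hv])
    (by simp [hv, hi.symm]) a
  refine (measure_mono ?_).trans_lt
    ((measure_union_le _ _).trans_lt (ENNReal.add_lt_top.2 ⟨h1, h2⟩))
  intro x hx
  rcases le_total (inner ℝ v (radialPart x)) 0 with h | h
  · exact Or.inl ⟨hx, h⟩
  · exact Or.inr ⟨hx, by rw [inner_neg_left]; linarith⟩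

/-- The cylinder has positive area, because its orthogonal projection to a hyperplane containing the
axis contains a ball. -/
theorem cylinder_pos (hn : 2 ≤ n) : 0 < μHE[n - 1] (cylinder n 1 (Icc (-1) 1)) := by
  obtain ⟨i, hi⟩ : ∃ i : Fin n, i ≠ 0 := ⟨⟨1, hn⟩, by
    intro h; have := congrArg Fin.val h; simp at this⟩
  set v : EuclideanSpace ℝ (Fin n) := EuclideanSpace.single i 1 with hv
  have hv1 : ‖v‖ = 1 := by simp [hv]
  have hv0 : v 0 = 0 := by simp [hv, hi.symm]
  set H : Submodule ℝ (EuclideanSpace ℝ (Fin n)) := (ℝ ∙ v)ᗮ with hH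
  have hfin : Module.finrank ℝ H = n - 1 := by
    have := Submodule.finrank_add_finrank_orthogonal (𝕜 := ℝ) (ℝ ∙ v)
    rw [finrank_span_singleton (by rintro h; simp [h] at hv1), finrank_euclideanSpace_fin,
      ← hH] at this
    omega
  have hball : Metric.ball (0 : H) 1 ⊆
      H.orthogonalProjectionOnto '' cylinder n 1 (Icc (-1) 1) := by
    intro z hz
    rw [mem_ball_zero_iff, Submodule.coe_norm] at hz
    have hz2 : ‖(z : EuclideanSpace ℝ (Fin n))‖ ^ 2 < 1 := by
      nlinarith [norm_nonneg (z : EuclideanSpace ℝ (Fin n))]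
    rw [norm_sq_eq] at hz2
    set r := ‖radialPart (z : EuclideanSpace ℝ (Fin n))‖ with hr
    have hr2 : 0 ≤ 1 - r ^ 2 := by nlinarith [sq_nonneg ((z : EuclideanSpace ℝ (Fin n)) 0)]
    have hzv : inner ℝ v (z : EuclideanSpace ℝ (Fin n)) = 0 :=
      (Submodule.mem_orthogonal_singleton_iff_inner_right).1 z.2
    have hrv : inner ℝ (radialPart (z : EuclideanSpace ℝ (Fin n))) v = 0 := by
      rw [radialPart, inner_sub_left, real_inner_comm, hzv, EuclideanSpace.inner_single_left]
      simp [hv0]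
    refine ⟨z + √(1 - r ^ 2) • v, ⟨?_, ?_⟩, ?_⟩
    · have : |(z : EuclideanSpace ℝ (Fin n)) 0| ≤ 1 := by
        apply abs_le_of_sq_le_sq _ (by norm_num) |> fun h => h
        nlinarith [sq_nonneg r]
      simpa [hv0] using abs_le.1 this
    · rw [radialPart_add, radialPart_smul, radialPart_eq_self hv0]
      have : ‖radialPart (z : EuclideanSpace ℝ (Fin n)) + √(1 - r ^ 2) • v‖ ^ 2 = 1 := by
        rw [@norm_add_sq_real, inner_smul_right, hrv, norm_smul, hv1, ← hr, mul_one,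
          Real.norm_eq_abs, sq_abs, Real.sq_sqrt hr2]
        ring
      nlinarith [norm_nonneg (radialPart (z : EuclideanSpace ℝ (Fin n)) + √(1 - r ^ 2) • v)]
    · rw [map_add, map_smul, Submodule.orthogonalProjectionOnto_mem_subspace_eq_self]
      have : H.orthogonalProjectionOnto v = 0 := by
        rw [Submodule.orthogonalProjectionOnto_eq_zero_iff, hH]
        exact Submodule.le_orthogonal_orthogonal _ (Submodule.mem_span_singleton_self v)
      simp [this]
  have hpos : 0 < μHE[n - 1] (Metric.ball (0 : H) 1) := by
    rw [← hfin]
    exact Metric.measure_ball_pos _ _ one_pos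
  refine hpos.trans_le ((measure_mono hball).trans ?_)
  have := euclideanHausdorffMeasure_image_le_of_lipschitzOnWith
    (H.lipschitzWith_orthogonalProjectionOnto.lipschitzOnWith (s := cylinder n 1 (Icc (-1) 1)))
    (n - 1)
  simpa using this

/-- The distribution of the area of the unit cylinder along the axis. -/
def cylinderMeasure (n : ℕ) [NeZero n] : Measure ℝ :=
  ((μHE[n - 1] : Measure (EuclideanSpace ℝ (Fin n))).restrict {x | ‖radialPart x‖ = 1}).map
    (fun x => x 0)

theorem cylinderMeasure_apply {J : Set ℝ} (hJ : MeasurableSet J) :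
    cylinderMeasure n J = μHE[n - 1] (cylinder n 1 J) := by
  have h0 : Measurable fun x : EuclideanSpace ℝ (Fin n) => x 0 := by fun_prop
  rw [cylinderMeasure, Measure.map_apply h0 hJ, Measure.restrict_apply (h0 hJ)]
  rfl

/-- The area of the unit cylinder over `J` is proportional to the length of `J`, by translation
invariance. The constant is the area of the unit sphere of `ℝⁿ⁻¹`, whose value is not needed. -/
theorem exists_cylinder_const (n : ℕ) [NeZero n] (hn : 2 ≤ n) : ∃ C : ℝ≥0, 0 < C ∧
    ∀ J : Set ℝ, MeasurableSet J → μHE[n - 1] (cylinder n 1 J) = C * volume J := by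
  have : (cylinderMeasure n).IsAddLeftInvariant := by
    refine ⟨fun a => ?_⟩
    refine Measure.ext fun J hJ => ?_
    rw [Measure.map_apply (measurable_const_add a) hJ, cylinderMeasure_apply hJ,
      cylinderMeasure_apply (measurable_const_add a hJ)]
    have hiso : Isometry (fun x : EuclideanSpace ℝ (Fin n) => EuclideanSpace.single 0 a + x) :=
      isometry_add_left _
    rw [← hiso.euclideanHausdorffMeasure_image]
    congr 1
    ext x
    simp only [mem_image, cylinder, mem_ofPred_eq, mem_preimage]
    constructor
    · rintro ⟨y, ⟨hy, hy1⟩, rfl⟩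
      rw [radialPart_add, radialPart_single, zero_add]
      exact ⟨by simpa using hy, hy1⟩
    · rintro ⟨hx, hx1⟩
      refine ⟨-EuclideanSpace.single 0 a + x, ⟨by simpa using hx, ?_⟩, by simp⟩
      rw [radialPart_add, ← neg_one_smul ℝ, radialPart_smul, radialPart_single]
      simpa using hx1
  have : IsFiniteMeasureOnCompacts (cylinderMeasure n) := by
    refine ⟨fun K hK => ?_⟩
    obtain ⟨a, ha⟩ := hK.isBounded.subset_closedBall 0
    refine (measure_mono ha).trans_lt ?_
    rw [Real.closedBall_eq_Icc, cylinderMeasure_apply measurableSet_Icc]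
    simpa using cylinder_lt_top hn a
  refine ⟨Measure.addHaarScalarFactor (cylinderMeasure n) volume, ?_, ?_⟩
  · rw [pos_iff_ne_zero]
    intro h0
    have h1 := Measure.isAddLeftInvariant_eq_smul (cylinderMeasure n) volume
    rw [h0, zero_smul] at h1
    have h2 := cylinder_pos hn
    rw [← cylinderMeasure_apply measurableSet_Icc, h1] at h2
    simp at h2
  · intro J hJ
    rw [← cylinderMeasure_apply hJ]
    conv_lhs => rw [Measure.isAddLeftInvariant_eq_smul (cylinderMeasure n) volume]
    rfl

end Cylinder

/-! ### The area of surfaces of revolution -/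

section Area

variable {n : ℕ} [NeZero n]

/-- The area of a cylinder of radius `b` follows from that of the unit cylinder by a dilation. -/
theorem cylinder_radius (hn : 2 ≤ n) {C : ℝ≥0}
    (hC : ∀ J : Set ℝ, MeasurableSet J → μHE[n - 1] (cylinder n 1 J) = C * volume J)
    {b : ℝ} (hb : 0 < b) {J : Set ℝ} (hJ : MeasurableSet J) :
    μHE[n - 1] (cylinder n b J) = C * ENNReal.ofReal (b ^ (n - 2)) * volume J := by
  have h1 : cylinder n b J = b • cylinder n 1 ((b * ·) ⁻¹' J) := by
    ext x
    rw [mem_smul_set_iff_inv_smul_mem₀ hb.ne']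
    simp only [cylinder, mem_ofPred_eq, mem_preimage, radialPart_smul, norm_smul, norm_inv,
      Real.norm_of_nonneg hb.le, PiLp.smul_apply, smul_eq_mul]
    rw [mul_inv_cancel_left₀ hb.ne', inv_mul_eq_one₀ hb.ne', eq_comm (a := b)]
  rw [h1, Measure.euclideanHausdorffMeasure_smul₀ _ hb.ne', hC _ (measurable_const_mul b hJ),
    Real.volume_preimage_mul_left hb.ne', abs_of_pos (inv_pos.2 hb)]
  obtain ⟨k, rfl⟩ := Nat.exists_eq_add_of_le hn
  have e1 : 2 + k - 1 = k + 1 := by omega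
  have e2 : 2 + k - 2 = k := by omega
  rw [e1, e2, ENNReal.smul_def, smul_eq_mul]
  have e3 : ((‖b‖₊ ^ (k + 1) : ℝ≥0) : ℝ≥0∞) = ENNReal.ofReal (b ^ k) * ENNReal.ofReal b := by
    rw [← ENNReal.ofReal_mul (by positivity), ← pow_succ, ENNReal.ofReal_pow hb.le,
      ENNReal.coe_pow, ← enorm_eq_nnnorm, Real.enorm_of_nonneg hb.le]
  rw [e3]
  calc _ = C * ENNReal.ofReal (b ^ k) * (ENNReal.ofReal b * ENNReal.ofReal b⁻¹) * volume J := by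
        ring
    _ = _ := by
      rw [← ENNReal.ofReal_mul hb.le, mul_inv_cancel₀ hb.ne', ENNReal.ofReal_one, mul_one]

/-- A piece of a surface of revolution on which the generating curve `c` is nearly an isometry up to
the factor `a`, and has nearly constant distance `b` to the axis, is bi-Lipschitz to a piece of the
cylinder of radius `b`. -/
theorem surface_le_cylinder {c : ℝ → Plane} {t : Set ℝ} {a b : ℝ} {K : ℝ≥0} (ha : 0 < a)
    (hb : 0 < b) (hK : 0 < K)
    (h1 : ∀ u ∈ t, ∀ v ∈ t, dist (c u) (c v) ≤ K * (a * |u - v|))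
    (h2 : ∀ u ∈ t, ∀ v ∈ t, a * |u - v| ≤ K * dist (c u) (c v))
    (h3 : ∀ u ∈ t, c u 1 ≤ K * b) (h4 : ∀ u ∈ t, b ≤ K * c u 1) :
    μHE[n - 1] (profile ⁻¹' (c '' t) : Set (EuclideanSpace ℝ (Fin n))) ≤
        (K : ℝ≥0∞) ^ (n - 1) * μHE[n - 1] (cylinder n b ((a⁻¹ * ·) ⁻¹' t)) ∧
      μHE[n - 1] (cylinder n b ((a⁻¹ * ·) ⁻¹' t)) ≤ (K : ℝ≥0∞) ^ (n - 1) *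
        μHE[n - 1] (profile ⁻¹' (c '' t) : Set (EuclideanSpace ℝ (Fin n))) := by
  let T : EuclideanSpace ℝ (Fin n) → EuclideanSpace ℝ (Fin n) := fun x =>
    EuclideanSpace.single 0 (c (a⁻¹ * x 0) 0) + (c (a⁻¹ * x 0) 1 / b) • radialPart x
  have hpos : ∀ u ∈ t, 0 < c u 1 := fun u hu => by
    by_contra! hneg
    have := h4 u hu
    have hK' : (0 : ℝ) < K := hK
    nlinarith
  have hr0 : ∀ (x : EuclideanSpace ℝ (Fin n)) (k : ℝ), (k • radialPart x) 0 = 0 := by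
    intro x k; simp
  have hTim : T '' cylinder n b ((a⁻¹ * ·) ⁻¹' t) = profile ⁻¹' (c '' t) := by
    ext y
    constructor
    · rintro ⟨x, ⟨hx0, hx1⟩, rfl⟩
      refine ⟨a⁻¹ * x 0, hx0, ?_⟩
      ext i
      fin_cases i
      · simp [T]
      · simp only [Fin.mk_one, profile_one, T]
        rw [radialPart_single_add (hr0 _ _), norm_smul, hx1, Real.norm_of_nonneg
          (div_nonneg (hpos _ hx0).le hb.le), div_mul_cancel₀ _ hb.ne']
    · rintro ⟨u, hu, huy⟩
      have hy0 : c u 0 = y 0 := by rw [huy]; simp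
      have hy1 : c u 1 = ‖radialPart y‖ := by rw [huy]; simp
      have hc1 := hpos u hu
      refine ⟨EuclideanSpace.single 0 (a * u) + (b / c u 1) • radialPart y, ⟨?_, ?_⟩, ?_⟩
      · rw [single_add_apply_zero (hr0 _ _), mem_preimage, inv_mul_cancel_left₀ ha.ne']
        exact hu
      · rw [radialPart_single_add (hr0 _ _), norm_smul, ← hy1, Real.norm_of_nonneg (by positivity),
          div_mul_cancel₀ _ hc1.ne']
      · simp only [T]
        rw [radialPart_single_add (hr0 _ _), single_add_apply_zero (hr0 _ _),
          inv_mul_cancel_left₀ ha.ne', smul_smul, hy0]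
        have : c u 1 / b * (b / c u 1) = 1 := by field_simp
        rw [this, one_smul, single_add_radialPart]
  have hdist : ∀ x ∈ cylinder n b ((a⁻¹ * ·) ⁻¹' t), ∀ y ∈ cylinder n b ((a⁻¹ * ·) ⁻¹' t),
      dist (T x) (T y) ^ 2 = dist (c (a⁻¹ * x 0)) (c (a⁻¹ * y 0)) ^ 2 +
        (c (a⁻¹ * x 0) 1 / b) * (c (a⁻¹ * y 0) 1 / b) *
          dist (radialPart x) (radialPart y) ^ 2 := by
    intro x hx y hy
    rw [dist_sq_eq]
    simp only [T]
    rw [radialPart_single_add (hr0 _ _), radialPart_single_add (hr0 _ _),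
      single_add_apply_zero (hr0 _ _), single_add_apply_zero (hr0 _ _),
      dist_smul_smul_sq hx.2 hy.2, dist_eq_norm (c _), plane_norm_sq]
    simp only [PiLp.sub_apply]
    field_simp
    ring
  have hax : ∀ x y : EuclideanSpace ℝ (Fin n), (x 0 - y 0) ^ 2 =
      (a * |a⁻¹ * x 0 - a⁻¹ * y 0|) ^ 2 := by
    intro x y
    rw [← mul_sub, abs_mul, abs_of_pos (inv_pos.2 ha), mul_inv_cancel_left₀ ha.ne', sq_abs]
  have hK0 : (0 : ℝ) < K := hK
  constructor
  · rw [← hTim]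
    refine euclideanHausdorffMeasure_image_le_of_lipschitzOnWith
      (LipschitzOnWith.of_dist_le_mul fun x hx y hy => ?_) _
    refine abs_le_of_sq_le_sq' ?_ (by positivity) |>.2
    rw [hdist x hx y hy, mul_pow, dist_sq_eq x y, hax, mul_add, ← mul_pow]
    have e1 := h1 _ hx.1 _ hy.1
    have e2 : c (a⁻¹ * x 0) 1 / b ≤ K := (div_le_iff₀ hb).2 (h3 _ hx.1)
    have e3 : c (a⁻¹ * y 0) 1 / b ≤ K := (div_le_iff₀ hb).2 (h3 _ hy.1)
    have e4 : 0 ≤ c (a⁻¹ * y 0) 1 / b := div_nonneg (hpos _ hy.1).le hb.le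
    refine add_le_add (pow_le_pow_left₀ dist_nonneg e1 2)
      (mul_le_mul_of_nonneg_right ?_ (by positivity))
    rw [sq]
    exact mul_le_mul e2 e3 e4 hK0.le
  · rw [← hTim]
    refine euclideanHausdorffMeasure_le_image_of_antilipschitzOn (fun x hx y hy => ?_) _
    refine abs_le_of_sq_le_sq' ?_ (by positivity) |>.2
    rw [mul_pow, hdist x hx y hy, dist_sq_eq x y, hax, mul_add, ← mul_pow]
    have e1 := h2 _ hx.1 _ hy.1
    have e2 : 1 ≤ K * (c (a⁻¹ * x 0) 1 / b) := by
      rw [← mul_div_assoc]; exact (one_le_div hb).2 (h4 _ hx.1)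
    have e3 : 1 ≤ K * (c (a⁻¹ * y 0) 1 / b) := by
      rw [← mul_div_assoc]; exact (one_le_div hb).2 (h4 _ hy.1)
    refine add_le_add (pow_le_pow_left₀ (by positivity) e1 2) ?_
    rw [← mul_assoc]
    refine le_mul_of_one_le_left (by positivity) ?_
    calc (1 : ℝ) ≤ (K * (c (a⁻¹ * x 0) 1 / b)) * (K * (c (a⁻¹ * y 0) 1 / b)) :=
          one_le_mul_of_one_le_of_one_le e2 e3
      _ = _ := by ring

variable {c c' : ℝ → Plane} {I : Set ℝ}

/-- The density of the area of a surface of revolution with respect to the parameter of its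
generating curve. -/
def areaDensity (n : ℕ) (c c' : ℝ → Plane) (u : ℝ) : ℝ := (c u 1) ^ (n - 2) * ‖c' u‖

/-- Near a parameter `u₀` the surface of revolution of `c` is almost isometric to a piece of the
cylinder of radius `c u₀ 1`, hence the area formula holds up to a factor `1 + ε`. -/
theorem surface_locally (hn : 2 ≤ n) {C : ℝ≥0}
    (hC : ∀ J : Set ℝ, MeasurableSet J → μHE[n - 1] (cylinder n 1 J) = C * volume J)
    {u₀ : ℝ} (hder : HasStrictDerivAt c (c' u₀) u₀) (hc' : ContinuousAt c' u₀)
    (hc'0 : c' u₀ ≠ 0) (hpos : 0 < c u₀ 1) {ε : ℝ≥0} (hε : 0 < ε) :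
    ∃ N ∈ 𝓝 u₀, ∀ t ⊆ N, MeasurableSet t →
      μHE[n - 1] (profile ⁻¹' (c '' t) : Set (EuclideanSpace ℝ (Fin n))) ≤
        (1 + ε) * (C * ∫⁻ u in t, ENNReal.ofReal (areaDensity n c c' u)) ∧
      C * ∫⁻ u in t, ENNReal.ofReal (areaDensity n c c' u) ≤
        (1 + ε) * μHE[n - 1] (profile ⁻¹' (c '' t) : Set (EuclideanSpace ℝ (Fin n))) := by
  obtain ⟨δ, hδ, hδε⟩ : ∃ δ : ℝ≥0, 0 < δ ∧ (1 + δ) ^ n ≤ 1 + ε := by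
    have h1 : Tendsto (fun δ : ℝ≥0 => (1 + δ) ^ n) (𝓝[>] 0) (𝓝 ((1 + 0) ^ n)) :=
      ((by fun_prop : Continuous fun δ : ℝ≥0 => (1 + δ) ^ n).tendsto 0).mono_left
        nhdsWithin_le_nhds
    have h2 : ∀ᶠ δ : ℝ≥0 in 𝓝[>] 0, (1 + δ) ^ n < 1 + ε :=
      h1.eventually_lt_const (by simpa using hε)
    obtain ⟨δ, hδ, hδ0⟩ := (h2.and self_mem_nhdsWithin).exists
    exact ⟨δ, hδ0, hδ.le⟩
  set a := ‖c' u₀‖ with ha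
  set b := c u₀ 1 with hb
  have ha0 : 0 < a := norm_pos_iff.2 hc'0
  set K : ℝ≥0 := 1 + δ with hK
  have hK1 : (1 : ℝ) < K := by rw [hK]; push_cast; have : (0 : ℝ) < δ := hδ; linarith
  have hK0 : (0 : ℝ) < K := by linarith
  set w₀ := b ^ (n - 2) * a with hw₀
  have hw₀pos : 0 < w₀ := by positivity
  have hcont : ContinuousAt c u₀ := hder.hasDerivAt.continuousAt
  have hc1 : ContinuousAt (fun u => c u 1) u₀ :=
    (EuclideanSpace.proj (1 : Fin 2)).continuous.continuousAt.comp hcont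
  have hw : ContinuousAt (areaDensity n c c') u₀ := (hc1.pow _).mul hc'.norm
  have n1 : ∀ᶠ u in 𝓝 u₀, c u 1 < K * b := hc1.eventually_lt_const (by nlinarith)
  have n2 : ∀ᶠ u in 𝓝 u₀, b < K * c u 1 :=
    (continuousAt_const.mul hc1).eventually_const_lt (by change b < K * b; nlinarith)
  have n3 : ∀ᶠ u in 𝓝 u₀, areaDensity n c c' u < K * w₀ :=
    hw.eventually_lt_const (by change w₀ < _; nlinarith)
  have n4 : ∀ᶠ u in 𝓝 u₀, w₀ < K * areaDensity n c c' u :=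
    (continuousAt_const.mul hw).eventually_const_lt (by change _ < _ * w₀; nlinarith)
  have n5 : ∀ᶠ q in 𝓝 (u₀, u₀), ‖c q.1 - c q.2 - (q.1 - q.2) • c' u₀‖ ≤
      (a * (1 - (K : ℝ)⁻¹)) * ‖q.1 - q.2‖ := by
    have := hder.isLittleO
    refine this.bound ?_
    have : (K : ℝ)⁻¹ < 1 := inv_lt_one_of_one_lt₀ hK1
    exact mul_pos ha0 (by linarith)
  rw [nhds_prod_eq] at n5
  obtain ⟨N', hN', hN5⟩ := (eventually_prod_self_iff (r := fun x y : ℝ =>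
    ‖c x - c y - (x - y) • c' u₀‖ ≤ (a * (1 - (K : ℝ)⁻¹)) * ‖x - y‖)).1 n5
  refine ⟨_, inter_mem hN' (n1.and (n2.and (n3.and n4))), fun t ht hmt => ?_⟩
  have hb0 : 0 < b := hpos
  have H := surface_le_cylinder (n := n) (c := c) (t := t) (a := a) (b := b) (K := K) ha0 hb0
    (by exact_mod_cast hK0) ?_ ?_
    (fun u hu => (ht hu).2.1.le) (fun u hu => (ht hu).2.2.1.le)
  · have hcyl : μHE[n - 1] (cylinder n b ((a⁻¹ * ·) ⁻¹' t)) =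
        C * (ENNReal.ofReal w₀ * volume t) := by
      rw [cylinder_radius hn hC hb0 (measurable_const_mul _ hmt),
        Real.volume_preimage_mul_left (inv_ne_zero ha0.ne'), inv_inv, abs_of_pos ha0, hw₀,
        ENNReal.ofReal_mul (by positivity)]
      ring
    rw [hcyl] at H
    have hKe : (K : ℝ≥0∞) = ENNReal.ofReal K := by simp
    have i1 : ENNReal.ofReal w₀ * volume t ≤
        K * ∫⁻ u in t, ENNReal.ofReal (areaDensity n c c' u) := by
      rw [← setLIntegral_const, ← lintegral_const_mul' _ _ ENNReal.coe_ne_top]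
      refine setLIntegral_mono' hmt fun u hu => ?_
      rw [hKe, ← ENNReal.ofReal_mul hK0.le]
      exact ENNReal.ofReal_le_ofReal (ht hu).2.2.2.2.le
    have i2 : ∫⁻ u in t, ENNReal.ofReal (areaDensity n c c' u) ≤
        K * (ENNReal.ofReal w₀ * volume t) := by
      rw [← mul_assoc, ← setLIntegral_const]
      refine setLIntegral_mono' hmt fun u hu => ?_
      rw [hKe, ← ENNReal.ofReal_mul hK0.le]
      exact ENNReal.ofReal_le_ofReal (ht hu).2.2.2.1.le
    have hKn : (K : ℝ≥0∞) ^ (n - 1) * K ≤ 1 + ε := by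
      rw [← pow_succ, Nat.sub_add_cancel (by omega)]
      exact_mod_cast hδε
    constructor
    · calc _ ≤ _ := H.1
        _ ≤ (K : ℝ≥0∞) ^ (n - 1) * (C *
            (K * ∫⁻ u in t, ENNReal.ofReal (areaDensity n c c' u))) := by gcongr
        _ = ((K : ℝ≥0∞) ^ (n - 1) * K) *
            (C * ∫⁻ u in t, ENNReal.ofReal (areaDensity n c c' u)) := by ring
        _ ≤ _ := by gcongr
    · calc _ ≤ C * (K * (ENNReal.ofReal w₀ * volume t)) := by gcongr
        _ = K * (C * (ENNReal.ofReal w₀ * volume t)) := by ring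
        _ ≤ K * ((K : ℝ≥0∞) ^ (n - 1) *
            μHE[n - 1] (profile ⁻¹' (c '' t) : Set (EuclideanSpace ℝ (Fin n)))) := by
          exact mul_le_mul_right H.2 _
        _ = ((K : ℝ≥0∞) ^ (n - 1) * K) *
            μHE[n - 1] (profile ⁻¹' (c '' t) : Set (EuclideanSpace ℝ (Fin n))) := by ring
        _ ≤ _ := by gcongr
  · intro u hu v hv
    have h := hN5 u (ht hu).1 v (ht hv).1
    rw [dist_eq_norm]
    have h' : ‖c u - c v‖ ≤ ‖(u - v) • c' u₀‖ + ‖c u - c v - (u - v) • c' u₀‖ := by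
      simpa using norm_add_le ((u - v) • c' u₀) (c u - c v - (u - v) • c' u₀)
    rw [norm_smul, ← ha, Real.norm_eq_abs] at h'
    simp only [Real.norm_eq_abs] at h
    have hk : 1 - (K : ℝ)⁻¹ ≤ K - 1 := by
      have : (K : ℝ) * (K : ℝ)⁻¹ = 1 := mul_inv_cancel₀ hK0.ne'
      have h2 : 0 < (K : ℝ)⁻¹ := inv_pos.2 hK0
      nlinarith
    have := mul_le_mul_of_nonneg_right (mul_le_mul_of_nonneg_left hk ha0.le) (abs_nonneg (u - v))
    nlinarith
  · intro u hu v hv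
    have h := hN5 u (ht hu).1 v (ht hv).1
    rw [dist_eq_norm]
    have h' : ‖(u - v) • c' u₀‖ ≤ ‖c u - c v‖ + ‖c u - c v - (u - v) • c' u₀‖ := by
      simpa using norm_sub_le (c u - c v) (c u - c v - (u - v) • c' u₀)
    rw [norm_smul, ← ha, Real.norm_eq_abs] at h'
    simp only [Real.norm_eq_abs] at h
    have h3 : a * |u - v| * (K : ℝ)⁻¹ ≤ ‖c u - c v‖ := by nlinarith
    rw [← div_eq_mul_inv, div_le_iff₀ hK0] at h3
    linarith

/-- **Area formula for surfaces of revolution.** The map `g` recovers the parameter of the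
generating curve. -/
theorem lintegral_surface (hn : 2 ≤ n) {C : ℝ≥0}
    (hC : ∀ J : Set ℝ, MeasurableSet J → μHE[n - 1] (cylinder n 1 J) = C * volume J)
    (hI : MeasurableSet I) {g : Plane → ℝ} (hg : Measurable g) (hgc : ∀ u ∈ I, g (c u) = u)
    (hder : ∀ u ∈ I, HasStrictDerivAt c (c' u) u) (hc' : ∀ u ∈ I, ContinuousAt c' u)
    (hc'0 : ∀ u ∈ I, c' u ≠ 0) (hpos : ∀ u ∈ I, 0 < c u 1) {φ : Plane → ℝ≥0∞}
    (hφ : Measurable φ) :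
    MeasurableSet (profile ⁻¹' (c '' I) : Set (EuclideanSpace ℝ (Fin n))) ∧
    ∫⁻ x in (profile ⁻¹' (c '' I) : Set (EuclideanSpace ℝ (Fin n))), φ (profile x) ∂μHE[n - 1] =
      C * ∫⁻ u in I, φ (c u) * ENNReal.ofReal (areaDensity n c c' u) := by
  have hcont : ContinuousOn c I := fun u hu =>
    (hder u hu).hasDerivAt.continuousAt.continuousWithinAt
  have hinj : InjOn c I := fun u hu v hv huv => by rw [← hgc u hu, ← hgc v hv, huv]
  have hmeas : ∀ t ⊆ I, MeasurableSet t →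
      MeasurableSet (profile ⁻¹' (c '' t) : Set (EuclideanSpace ℝ (Fin n))) := fun t htI ht =>
    continuous_profile.measurable
      (ht.image_of_continuousOn_injOn (hcont.mono htI) (hinj.mono htI))
  set S : Set (EuclideanSpace ℝ (Fin n)) := profile ⁻¹' (c '' I) with hS
  refine ⟨hmeas I subset_rfl hI, ?_⟩
  have hgp : Measurable fun x : EuclideanSpace ℝ (Fin n) => g (profile x) :=
    hg.comp continuous_profile.measurable
  -- Both sides of the formula are integrals over `I`, against the measures `μ` and `ν`, which are
  -- compared locally.
  set μ : Measure ℝ := ((μHE[n - 1]).restrict S).map (fun x => g (profile x)) with hμ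
  set ρ : ℝ → ℝ≥0∞ := I.indicator fun u => ENNReal.ofReal (areaDensity n c c' u) with hρ
  classical
  have hρm : Measurable ρ := by
    rw [hρ, ← piecewise_eq_indicator]
    refine ContinuousOn.measurable_piecewise ?_ continuousOn_const hI
    refine ENNReal.continuous_ofReal.comp_continuousOn ?_
    refine ContinuousOn.mul (ContinuousOn.pow ?_ _) (ContinuousOn.norm fun u hu =>
      (hc' u hu).continuousWithinAt)
    exact (EuclideanSpace.proj (1 : Fin 2)).continuous.comp_continuousOn hcont
  set ν : Measure ℝ := C • (volume.withDensity ρ) with hν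
  have hνt : ∀ t ⊆ I, MeasurableSet t →
      ν t = C * ∫⁻ u in t, ENNReal.ofReal (areaDensity n c c' u) := by
    intro t htI ht
    rw [hν, Measure.smul_apply, withDensity_apply _ ht, ENNReal.smul_def, smul_eq_mul]
    congr 1
    refine setLIntegral_congr_fun ht fun u hu => ?_
    simp [hρ, htI hu]
  have hμt : ∀ t ⊆ I, MeasurableSet t →
      μ t = μHE[n - 1] (profile ⁻¹' (c '' t) : Set (EuclideanSpace ℝ (Fin n))) := by
    intro t htI ht
    rw [hμ, Measure.map_apply hgp ht, Measure.restrict_apply (hgp ht)]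
    congr 1
    ext x
    constructor
    · rintro ⟨hx, u, hu, hux⟩
      refine ⟨u, ?_, hux⟩
      rw [mem_preimage, ← hux, hgc u hu] at hx
      exact hx
    · rintro ⟨u, hu, hux⟩
      refine ⟨?_, u, htI hu, hux⟩
      rw [mem_preimage, ← hux, hgc u (htI hu)]
      exact hu
  have hIc : ∀ t, MeasurableSet t → μ t = μ (t ∩ I) ∧ ν t = ν (t ∩ I) := by
    intro t ht
    constructor
    · rw [hμ, Measure.map_apply hgp ht, Measure.restrict_apply (hgp ht),
        Measure.map_apply hgp (ht.inter hI), Measure.restrict_apply (hgp (ht.inter hI))]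
      congr 1
      ext x
      simp only [mem_inter_iff, mem_preimage, and_congr_left_iff]
      rintro ⟨u, hu, hux⟩
      rw [← hux, hgc u hu]
      simp [hu]
    · rw [hν, Measure.smul_apply, Measure.smul_apply, withDensity_apply _ ht,
        withDensity_apply _ (ht.inter hI), hρ, lintegral_indicator hI, lintegral_indicator hI,
        Measure.restrict_restrict hI, Measure.restrict_restrict hI]
      congr 3
      ext; simp; tauto
  have hle : ∀ t ⊆ I, MeasurableSet t → μ t = ν t := by
    intro t htI ht
    apply le_antisymm
    · refine measure_le_of_locally_le ht fun u hu ε hε => ?_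
      obtain ⟨N, hN, h⟩ := surface_locally (n := n) hn hC (hder u (htI hu)) (hc' u (htI hu))
        (hc'0 u (htI hu)) (hpos u (htI hu)) hε
      refine ⟨N, hN, fun s hs hms => ?_⟩
      have hsI : s ⊆ I := fun x hx => htI (hs hx).1
      rw [hμt s hsI hms, hνt s hsI hms]
      exact (h s (fun x hx => (hs hx).2) hms).1
    · refine measure_le_of_locally_le ht fun u hu ε hε => ?_
      obtain ⟨N, hN, h⟩ := surface_locally (n := n) hn hC (hder u (htI hu)) (hc' u (htI hu))
        (hc'0 u (htI hu)) (hpos u (htI hu)) hε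
      refine ⟨N, hN, fun s hs hms => ?_⟩
      have hsI : s ⊆ I := fun x hx => htI (hs hx).1
      rw [hμt s hsI hms, hνt s hsI hms]
      exact (h s (fun x hx => (hs hx).2) hms).2
  have hμν : μ = ν := Measure.ext fun t ht => by
    rw [(hIc t ht).1, (hIc t ht).2, hle _ inter_subset_right (ht.inter hI)]
  have hcm : Measurable (I.indicator fun u => φ (c u)) := by
    have h0 : Measurable (I.piecewise c fun _ => 0) :=
      hcont.measurable_piecewise continuousOn_const hI
    have h1 : (I.indicator fun u => φ (c u)) =
        I.indicator fun u => φ (I.piecewise c (fun _ => 0) u) := by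
      ext u
      by_cases hu : u ∈ I <;> simp [hu]
    rw [h1]
    exact (hφ.comp h0).indicator hI
  have e1 : ∫⁻ x in S, φ (profile x) ∂μHE[n - 1] = ∫⁻ u, I.indicator (fun u => φ (c u)) u ∂μ := by
    rw [hμ, lintegral_map hcm hgp]
    refine setLIntegral_congr_fun (hmeas I subset_rfl hI) ?_
    rintro x ⟨u, hu, hux⟩
    simp only
    rw [← hux, hgc u hu, indicator_of_mem hu]
  rw [e1, hμν, hν, lintegral_smul_measure, ENNReal.smul_def, smul_eq_mul,
    lintegral_withDensity_eq_lintegral_mul _ hρm hcm, ← lintegral_indicator hI]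
  congr 1
  refine lintegral_congr fun u => ?_
  by_cases hu : u ∈ I
  · simp [hρ, hu, mul_comm]
  · simp [hρ, hu]

end Area

/-! ### Volumes of sets of revolution -/

section Volume

/-- Polar coordinates for functions of the norm. -/
theorem lintegral_fun_norm {V : Type*} [NormedAddCommGroup V] [InnerProductSpace ℝ V]
    [FiniteDimensional ℝ V] [MeasurableSpace V] [BorelSpace V] [Nontrivial V] {f : ℝ → ℝ≥0∞}
    (hf : Measurable f) :
    ∫⁻ w : V, f ‖w‖ = (volume : Measure V).toSphere univ *
      ∫⁻ y in Ioi (0 : ℝ), ENNReal.ofReal (y ^ (Module.finrank ℝ V - 1)) * f y := by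
  have h1 : ∫⁻ w : V, f ‖w‖ =
      ∫⁻ w : ({0}ᶜ : Set V), f ‖(w : V)‖ ∂((volume : Measure V).comap (↑)) := by
    rw [lintegral_subtype_comap (measurableSet_singleton _).compl fun w : V => f ‖w‖,
      restrict_compl_singleton]
  have h2 := (volume : Measure V).measurePreserving_homeomorphUnitSphereProd.lintegral_comp_emb
    (Homeomorph.measurableEmbedding _) (f ∘ Subtype.val ∘ Prod.snd)
  simp only [Function.comp_def, homeomorphUnitSphereProd_apply_snd_coe] at h2
  rw [h1, h2, lintegral_prod _ (by fun_prop)]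
  simp only [lintegral_const]
  rw [mul_comm, Measure.volumeIoiPow, lintegral_withDensity_eq_lintegral_mul _ (by fun_prop)
    (by fun_prop), ← lintegral_subtype_comap measurableSet_Ioi]
  rfl

theorem measurePreserving_plane_mk :
    MeasurePreserving (fun z : ℝ × ℝ => (!₂[z.1, z.2] : Plane)) := by
  have h := (PiLp.volume_preserving_toLp (Fin 2)).comp (volume_preserving_finTwoArrow ℝ).symm
  have e : (fun z : ℝ × ℝ => (!₂[z.1, z.2] : Plane)) =
      WithLp.toLp 2 ∘ (MeasurableEquiv.finTwoArrow (α := ℝ)).symm := by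
    funext z
    ext i
    fin_cases i <;> rfl
  rw [e]
  exact h

/-- The volume of a set of revolution, as an integral over its profile in the half-plane. -/
theorem exists_volume_const (n : ℕ) [NeZero n] (hn : 2 ≤ n) : ∃ C : ℝ≥0, 0 < C ∧
    ∀ φ : Plane → ℝ≥0∞, Measurable φ →
      ∫⁻ x : EuclideanSpace ℝ (Fin n), φ (profile x) =
        C * ∫⁻ q : Plane in {q | 0 < q 1}, φ q * ENNReal.ofReal (q 1 ^ (n - 2)) := by
  obtain ⟨m, rfl⟩ : ∃ m, n = m + 2 := ⟨n - 2, by omega⟩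
  set W := EuclideanSpace ℝ (Fin (m + 1)) with hW
  set κ := (volume : Measure W).toSphere univ with hκ
  have hκtop : κ ≠ ⊤ := measure_ne_top _ _
  have hκ0 : κ ≠ 0 := by
    rw [hκ, Ne, Measure.measure_univ_eq_zero]
    exact Measure.toSphere_ne_zero _
  refine ⟨κ.toNNReal, ENNReal.toNNReal_pos hκ0 hκtop, fun φ hφ => ?_⟩
  rw [ENNReal.coe_toNNReal hκtop]
  let T : EuclideanSpace ℝ (Fin (m + 2)) → ℝ × W := fun x =>
    (x 0, WithLp.toLp 2 fun i => x (Fin.succ i))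
  have hT : MeasurePreserving T := by
    have e1 := (volume_preserving_piFinSuccAbove (fun _ : Fin (m + 2) => ℝ) 0).comp
      (PiLp.volume_preserving_ofLp (Fin (m + 2)))
    have e2 := ((MeasurePreserving.id (volume : Measure ℝ)).prod
      (PiLp.volume_preserving_toLp (Fin (m + 1)))).comp e1
    exact e2
  have hTn : ∀ x : EuclideanSpace ℝ (Fin (m + 2)), profile x = !₂[(T x).1, ‖(T x).2‖] := by
    intro x
    have : ‖radialPart x‖ = ‖(T x).2‖ := by
      have h2 := norm_sq_eq x
      rw [EuclideanSpace.norm_sq_eq, Fin.sum_univ_succ] at h2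
      have h3 : ‖(T x).2‖ ^ 2 = ∑ i : Fin (m + 1), ‖x i.succ‖ ^ 2 := by
        rw [EuclideanSpace.norm_sq_eq]
      have h4 : ‖radialPart x‖ ^ 2 = ‖(T x).2‖ ^ 2 := by
        rw [h3]
        simp only [Real.norm_eq_abs, sq_abs] at h2 ⊢
        linarith
      exact (sq_eq_sq₀ (norm_nonneg _) (norm_nonneg _)).1 h4
    rw [profile, this]
  have hmk := measurePreserving_plane_mk.measurable
  have hP := measurePreserving_plane_mk
  have hφ2 : Measurable fun z : ℝ × W => φ (!₂[z.1, ‖z.2‖] : Plane) :=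
    hφ.comp (hmk.comp (measurable_fst.prodMk measurable_snd.norm))
  simp only [hTn]
  rw [hT.lintegral_comp hφ2, ← hP.setLIntegral_comp_preimage
    (measurableSet_lt measurable_const (by fun_prop))
    (f := fun q : Plane => φ q * ENNReal.ofReal (q 1 ^ (m + 2 - 2)))
    (hφ.mul (by fun_prop))]
  have hset : (fun z : ℝ × ℝ => (!₂[z.1, z.2] : Plane)) ⁻¹' {q | 0 < q 1} =
      univ ×ˢ Ioi (0 : ℝ) := by ext z; simp
  rw [hset, Measure.volume_eq_prod, lintegral_prod _ hφ2.aemeasurable, Measure.volume_eq_prod,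
    ← Measure.prod_restrict,
    Measure.restrict_univ, lintegral_prod _ (by
      exact ((hφ.comp hmk).mul (by fun_prop)).aemeasurable),
    ← lintegral_const_mul' _ _ hκtop]
  refine lintegral_congr fun a => ?_
  have hm1 : Measurable fun y : ℝ => φ (!₂[a, y] : Plane) :=
    hφ.comp (hmk.comp measurable_prodMk_left)
  have hd : Module.finrank ℝ W - 1 = m + 2 - 2 := by simp [W]
  rw [lintegral_fun_norm (V := W) hm1, hd]
  congr 1
  refine lintegral_congr fun y => ?_
  simp [mul_comm]

end Volume

/-! ### Dilations and the isoperimetric inequality -/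

section Dilation

/-- Integrals against `d`-dimensional Hausdorff measure scale with the factor `k ^ d`. -/
theorem lintegral_smul_set {n : ℕ} (d : ℕ) {k : ℝ} (hk : 0 < k) {F : Set (EuclideanSpace ℝ (Fin n))}
    (f : EuclideanSpace ℝ (Fin n) → ℝ≥0∞) :
    ∫⁻ x in k • F, f x ∂μHE[d] = ENNReal.ofReal (k ^ d) * ∫⁻ x in F, f (k • x) ∂μHE[d] := by
  let e : EuclideanSpace ℝ (Fin n) ≃ᵐ EuclideanSpace ℝ (Fin n) :=
    (Homeomorph.smulOfNeZero k hk.ne').toMeasurableEquiv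
  have hmap : Measure.map e (ENNReal.ofReal (k ^ d) • μHE[d]) = μHE[d] := by
    refine Measure.ext fun s hs => ?_
    rw [e.map_apply, Measure.smul_apply, smul_eq_mul]
    have h1 : s = k • (e ⁻¹' s) := by
      ext x
      rw [mem_smul_set_iff_inv_smul_mem₀ hk.ne']
      simp [e, smul_smul, hk.ne']
    conv_rhs => rw [h1, Measure.euclideanHausdorffMeasure_smul₀ _ hk.ne']
    rw [ENNReal.smul_def, smul_eq_mul, ENNReal.coe_pow, ENNReal.ofReal_pow hk.le,
      ← enorm_eq_nnnorm, Real.enorm_of_nonneg hk.le]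
  have h2 : k • F = e '' F := rfl
  have h3 :=
    (MeasurePreserving.mk e.measurable hmap).setLIntegral_comp_emb e.measurableEmbedding f F
  rw [h2, ← h3, Measure.restrict_smul, lintegral_smul_measure, smul_eq_mul]
  rfl

variable {n : ℕ} {p : ℝ}

theorem weightedVolume_smul {k : ℝ} (hk : 0 < k) (F : Set (EuclideanSpace ℝ (Fin n))) :
    weightedVolume p (k • F) = ENNReal.ofReal (k ^ (n + p)) * weightedVolume p F := by
  have h : (volume : Measure (EuclideanSpace ℝ (Fin n))) = μHE[n] :=
    (EuclideanSpace.euclideanHausdorffMeasure_eq_volume n).symm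
  rw [weightedVolume, weightedVolume, h, lintegral_smul_set n hk]
  simp only [norm_smul, Real.norm_of_nonneg hk.le]
  rw [Real.rpow_add hk, Real.rpow_natCast, ENNReal.ofReal_mul (by positivity), mul_assoc]
  congr 1
  rw [← lintegral_const_mul' _ _ ENNReal.ofReal_ne_top]
  refine lintegral_congr fun x => ?_
  rw [Real.mul_rpow hk.le (norm_nonneg _), ENNReal.ofReal_mul (by positivity)]

theorem weightedPerimeter_smul (hn : 1 ≤ n) {k : ℝ} (hk : 0 < k)
    (F : Set (EuclideanSpace ℝ (Fin n))) :
    weightedPerimeter p (k • F) = ENNReal.ofReal (k ^ (n - 1 + p)) * weightedPerimeter p F := by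
  have h : frontier (k • F) = k • frontier F :=
    ((Homeomorph.smulOfNeZero k hk.ne').image_frontier F).symm
  rw [weightedPerimeter, weightedPerimeter, h, lintegral_smul_set (n - 1) hk]
  simp only [norm_smul, Real.norm_of_nonneg hk.le]
  have h2 : ((n : ℝ) - 1) = ((n - 1 : ℕ) : ℝ) := by push_cast [hn]; ring
  rw [h2, Real.rpow_add hk, Real.rpow_natCast, ENNReal.ofReal_mul (by positivity), mul_assoc]
  congr 1
  rw [← lintegral_const_mul' _ _ ENNReal.ofReal_ne_top]
  refine lintegral_congr fun x => ?_
  rw [Real.mul_rpow hk.le (norm_nonneg _), ENNReal.ofReal_mul (by positivity)]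

variable [NeZero n]

theorem weightedVolume_pos {F : Set (EuclideanSpace ℝ (Fin n))} (hF : IsOpen F)
    (hne : F.Nonempty) : 0 < weightedVolume p F := by
  rw [weightedVolume, setLIntegral_pos_iff (by fun_prop)]
  have hsub : F \ {0} ⊆ Function.support (fun x : EuclideanSpace ℝ (Fin n) =>
      ENNReal.ofReal (‖x‖ ^ p)) ∩ F := by
    rintro x ⟨hx, hx0⟩
    refine ⟨?_, hx⟩
    have : 0 < ‖x‖ ^ p := Real.rpow_pos_of_pos (norm_pos_iff.2 hx0) _
    simp [this]
  refine lt_of_lt_of_le ?_ (measure_mono hsub)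
  rw [measure_sdiff_null (measure_singleton 0)]
  exact hF.measure_pos _ hne

/-- Comparison with a region of a different volume, after a dilation. -/
theorem IsIsoperimetric.perimeter_le_mul (hn : 1 ≤ n) (hp : 0 < p)
    {E : Set (EuclideanSpace ℝ (Fin n))} (hE : IsIsoperimetric p E) (hEo : IsOpen E)
    (hne : E.Nonempty) {E' : Set (EuclideanSpace ℝ (Fin n))} (hE' : MeasurableSet E')
    (hV0 : weightedVolume p E' ≠ 0) (hV1 : weightedVolume p E' ≠ ⊤) :
    weightedPerimeter p E ≤ ENNReal.ofReal (((weightedVolume p E).toReal /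
      (weightedVolume p E').toReal) ^ (((n : ℝ) - 1 + p) / (n + p))) * weightedPerimeter p E' := by
  set V := (weightedVolume p E).toReal with hV
  set V' := (weightedVolume p E').toReal with hV'
  have hVpos : 0 < V := ENNReal.toReal_pos (weightedVolume_pos hEo hne).ne' hE.volume_ne_top
  have hV'pos : 0 < V' := ENNReal.toReal_pos hV0 hV1
  have hnp : (0 : ℝ) < n + p := by positivity
  set k := (V / V') ^ (1 / ((n : ℝ) + p)) with hk
  have hk0 : 0 < k := by positivity
  have h1 : weightedVolume p (k • E') = weightedVolume p E := by
    rw [weightedVolume_smul hk0, hk, ← Real.rpow_mul (by positivity), one_div_mul_cancel hnp.ne',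
      Real.rpow_one, ← ENNReal.ofReal_toReal hV1, ← ENNReal.ofReal_toReal hE.volume_ne_top,
      ← ENNReal.ofReal_mul (by positivity), ← hV, ← hV', div_mul_cancel₀ _ hV'pos.ne']
  have h2 := hE.perimeter_le (k • E') (hE'.const_smul₀ k) h1
  rwa [weightedPerimeter_smul hn hk0, hk, ← Real.rpow_mul (by positivity), one_div_mul_eq_div] at h2

theorem weightedVolume_lt_top_of_isBounded {n : ℕ} {p : ℝ} (hp : 0 < p)
    {F : Set (EuclideanSpace ℝ (Fin n))} (hF : Bornology.IsBounded F) : weightedVolume p F < ⊤ := by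
  obtain ⟨R, hR⟩ := hF.subset_closedBall 0
  refine (lintegral_mono_set hR).trans_lt ?_
  calc ∫⁻ x in Metric.closedBall (0 : EuclideanSpace ℝ (Fin n)) R, ENNReal.ofReal (‖x‖ ^ p) ≤
      ∫⁻ x in Metric.closedBall (0 : EuclideanSpace ℝ (Fin n)) R, ENNReal.ofReal (|R| ^ p) := by
        refine setLIntegral_mono' Metric.isClosed_closedBall.measurableSet fun x hx => ?_
        rw [mem_closedBall_zero_iff] at hx
        exact ENNReal.ofReal_le_ofReal (Real.rpow_le_rpow (norm_nonneg _)
          (hx.trans (le_abs_self R)) hp.le)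
    _ < ⊤ := by
      rw [setLIntegral_const]
      exact ENNReal.mul_lt_top ENNReal.ofReal_lt_top measure_closedBall_lt_top

/-- A solid cylinder has finite weighted perimeter, hence so does an isoperimetric region. -/
theorem IsIsoperimetric.perimeter_lt_top (hn : 2 ≤ n) (hp : 0 < p)
    {E : Set (EuclideanSpace ℝ (Fin n))} (hE : IsIsoperimetric p E) (hEo : IsOpen E)
    (hne : E.Nonempty) : weightedPerimeter p E < ⊤ := by
  set Z : Set (EuclideanSpace ℝ (Fin n)) := profile ⁻¹' {q | 0 < q 0 ∧ q 0 < 1 ∧ q 1 < 1} with hZ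
  have hZo : IsOpen Z := by
    refine IsOpen.preimage continuous_profile ?_
    have c0 : Continuous fun q : Plane => q 0 := by fun_prop
    have c1 : Continuous fun q : Plane => q 1 := by fun_prop
    exact (isOpen_lt continuous_const c0).inter
      ((isOpen_lt c0 continuous_const).inter (isOpen_lt c1 continuous_const))
  have hcl : closure Z ⊆ {x | 0 ≤ x 0 ∧ x 0 ≤ 1 ∧ ‖radialPart x‖ ≤ 1} := by
    refine closure_minimal (fun x hx => ?_) ?_
    · simp only [hZ, mem_preimage, mem_ofPred_eq, profile_zero, profile_one] at hx
      exact ⟨hx.1.le, hx.2.1.le, hx.2.2.le⟩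
    · have c0 : Continuous fun x : EuclideanSpace ℝ (Fin n) => x 0 := by fun_prop
      have c1 : Continuous fun x : EuclideanSpace ℝ (Fin n) => ‖radialPart x‖ := by fun_prop
      exact (isClosed_le continuous_const c0).inter
        ((isClosed_le c0 continuous_const).inter (isClosed_le c1 continuous_const))
  have hnorm : ∀ x ∈ closure Z, ‖x‖ ≤ 2 := by
    intro x hx
    obtain ⟨h1, h2, h3⟩ := hcl hx
    have := norm_sq_eq x
    nlinarith [norm_nonneg x, norm_nonneg (radialPart x)]
  have hZne : Z.Nonempty := by
    refine ⟨EuclideanSpace.single 0 (1 / 2), ?_⟩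
    simp only [hZ, mem_preimage, mem_ofPred_eq, profile_zero, profile_one, radialPart_single]
    norm_num
  set H : Submodule ℝ (EuclideanSpace ℝ (Fin n)) := (ℝ ∙ EuclideanSpace.single 0 1)ᗮ with hH
  have hfin : Module.finrank ℝ H = n - 1 := by
    have := Submodule.finrank_add_finrank_orthogonal (𝕜 := ℝ)
      (ℝ ∙ (EuclideanSpace.single 0 1 : EuclideanSpace ℝ (Fin n)))
    rw [finrank_span_singleton (by simp), finrank_euclideanSpace_fin, ← hH] at this
    omega
  have hdisc : ∀ a : ℝ, μHE[n - 1] {x : EuclideanSpace ℝ (Fin n) | x 0 = a ∧ ‖radialPart x‖ ≤ 1}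
      < ⊤ := by
    intro a
    have hiso : Isometry fun z : H => (EuclideanSpace.single 0 a : EuclideanSpace ℝ (Fin n)) + z :=
      (isometry_add_left _).comp isometry_subtype_coe
    have hsub : {x : EuclideanSpace ℝ (Fin n) | x 0 = a ∧ ‖radialPart x‖ ≤ 1} ⊆
        (fun z : H => (EuclideanSpace.single 0 a : EuclideanSpace ℝ (Fin n)) + z) ''
          Metric.closedBall 0 1 := by
      rintro x ⟨hx0, hx1⟩
      refine ⟨⟨radialPart x, ?_⟩, by simpa using hx1, ?_⟩
      · rw [hH, Submodule.mem_orthogonal_singleton_iff_inner_right,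
            EuclideanSpace.inner_single_left]
        simp
      · simp only
        rw [← hx0, single_add_radialPart]
    refine (measure_mono hsub).trans_lt ?_
    rw [hiso.euclideanHausdorffMeasure_image, ← hfin]
    exact (isCompact_closedBall _ _).measure_lt_top
  obtain ⟨C, -, hC⟩ := exists_cylinder_const n hn
  have hfr : μHE[n - 1] (frontier Z) < ⊤ := by
    have hsub : frontier Z ⊆ cylinder n 1 (Icc 0 1) ∪
        ({x | x 0 = 0 ∧ ‖radialPart x‖ ≤ 1} ∪ {x | x 0 = 1 ∧ ‖radialPart x‖ ≤ 1}) := by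
      rw [hZo.frontier_eq]
      rintro x ⟨hx, hxZ⟩
      obtain ⟨h1, h2, h3⟩ := hcl hx
      simp only [hZ, mem_preimage, mem_ofPred_eq, profile_zero, profile_one, not_and, not_lt] at hxZ
      rcases h1.eq_or_lt with h1' | h1'
      · exact Or.inr (Or.inl ⟨h1'.symm, h3⟩)
      rcases h2.eq_or_lt with h2' | h2'
      · exact Or.inr (Or.inr ⟨h2', h3⟩)
      · exact Or.inl ⟨⟨h1, h2⟩, le_antisymm h3 (hxZ h1' h2')⟩
    refine (measure_mono hsub).trans_lt ((measure_union_le _ _).trans_lt (ENNReal.add_lt_top.2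
      ⟨?_, (measure_union_le _ _).trans_lt (ENNReal.add_lt_top.2 ⟨hdisc 0, hdisc 1⟩)⟩))
    rw [hC _ measurableSet_Icc]
    exact ENNReal.mul_lt_top (by simp) (by simp)
  have hPZ : weightedPerimeter p Z < ⊤ := by
    calc weightedPerimeter p Z ≤ ∫⁻ x in frontier Z, ENNReal.ofReal ((2 : ℝ) ^ p) ∂μHE[n - 1] := by
          refine setLIntegral_mono' isClosed_frontier.measurableSet fun x hx => ?_
          exact ENNReal.ofReal_le_ofReal (Real.rpow_le_rpow (norm_nonneg _)
            (hnorm x (frontier_subset_closure hx)) hp.le)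
      _ < ⊤ := by
        rw [setLIntegral_const]
        exact ENNReal.mul_lt_top ENNReal.ofReal_lt_top hfr
  have hb : Bornology.IsBounded Z := (Metric.isBounded_closedBall (x := 0) (r := 2)).subset
    fun x hx => mem_closedBall_zero_iff.2 (hnorm x (subset_closure hx))
  refine (hE.perimeter_le_mul (by omega) hp hEo hne hZo.measurableSet
    (weightedVolume_pos hZo hZne).ne' (weightedVolume_lt_top_of_isBounded hp hb).ne).trans_lt ?_
  exact ENNReal.mul_lt_top ENNReal.ofReal_lt_top hPZ

end Dilation

/-! ### The one-dimensional first variation -/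

section Variation

theorem hasDerivAt_intervalIntegral_of_continuousOn {F F' : ℝ → ℝ → ℝ} {T a b : ℝ} (hT : 0 < T)
    (hab : a ≤ b) (hF : ∀ t ∈ Ioo (-T) T, ContinuousOn (F t) (Icc a b))
    (hd : ∀ t ∈ Ioo (-T) T, ∀ u ∈ Icc a b, HasDerivAt (fun t => F t u) (F' t u) t)
    (hF' : ContinuousOn (fun z : ℝ × ℝ => F' z.1 z.2) (Ioo (-T) T ×ˢ Icc a b)) :
    HasDerivAt (fun t => ∫ u in a..b, F t u) (∫ u in a..b, F' 0 u) 0 := by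
  have hsub : Icc (-(T / 2)) (T / 2) ⊆ Ioo (-T) T := Icc_subset_Ioo (by linarith) (by linarith)
  have h0 : (0 : ℝ) ∈ Ioo (-T) T := ⟨by linarith, hT⟩
  have hU : Set.uIoc a b ⊆ Icc a b := by rw [uIoc_of_le hab]; exact Ioc_subset_Icc_self
  obtain ⟨B, hB⟩ := (isCompact_Icc.prod isCompact_Icc).exists_bound_of_continuousOn
    (hF'.mono (prod_mono hsub subset_rfl))
  have hcont : ContinuousOn (F' 0) (Icc a b) :=
    hF'.comp (f := fun u => ((0 : ℝ), u)) (by fun_prop) fun u hu => ⟨h0, hu⟩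
  refine (intervalIntegral.hasDerivAt_integral_of_dominated_loc_of_deriv_le (F := F) (F' := F')
    (s := Icc (-(T / 2)) (T / 2)) (bound := fun _ => B)
    (Icc_mem_nhds (by linarith) (by linarith)) ?_ ?_ ?_ ?_ ?_ ?_).2
  · filter_upwards [Ioo_mem_nhds h0.1 h0.2] with t ht
    exact ((hF t ht).mono hU).aestronglyMeasurable measurableSet_uIoc
  · exact ((hF 0 h0).mono (by rw [uIcc_of_le hab])).intervalIntegrable
  · exact (hcont.mono hU).aestronglyMeasurable measurableSet_uIoc
  · exact Eventually.of_forall fun u hu t ht => hB (t, u) ⟨ht, hU hu⟩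
  · exact intervalIntegrable_const
  · exact Eventually.of_forall fun u hu t ht => hd t (hsub ht) u (hU hu)

/-- The Euler-Lagrange equation at a horizontal point of the graph of `f`, for the length of the
graph with weight `C * Ω` and the area below it with weight `C' * Ω`. The minimality assumption says
that the graph minimizes (total length) / (total area) ^ α among its small vertical perturbations,
where `P` and `V` are the total length and area. -/
theorem euler_lagrange_of_graph {ε η P V C C' α : ℝ} (hε : 0 < ε) (hV : 0 < V)
    {f f' f'' : ℝ → ℝ} (hf : ∀ u ∈ Icc (-ε) ε, HasDerivAt f (f' u) u)
    (hf' : ∀ u ∈ Icc (-ε) ε, HasDerivAt f' (f'' u) u) (hf'' : ContinuousOn f'' (Icc (-ε) ε))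
    (hfη : ∀ u ∈ Icc (-ε) ε, |f u| < η) (hf'0 : f' 0 = 0)
    {Ω : ℝ × ℝ → ℝ} (hΩ : Continuous Ω)
    (hΩ1 : ∀ u ∈ Icc (-ε) ε, ∀ v ∈ Ioo (-η) η, ContDiffAt ℝ 1 Ω (u, v))
    (hmin : ∀ φ : ℝ → ℝ, ContDiff ℝ ∞ φ → HasCompactSupport φ → tsupport φ ⊆ Ioo (-ε) ε →
      ∀ᶠ t in 𝓝 (0 : ℝ), P ≤
        (V / (V + C' * ∫ u in (-ε)..ε, ∫ v in (f u)..(f u + t * φ u), Ω (u, v))) ^ α *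
        (P + C * ((∫ u in (-ε)..ε, √(1 + (f' u + t * deriv φ u) ^ 2) * Ω (u, f u + t * φ u)) -
          ∫ u in (-ε)..ε, √(1 + (f' u) ^ 2) * Ω (u, f u)))) :
    C * (-(f'' 0) * Ω (0, f 0) + fderiv ℝ Ω (0, f 0) (0, 1)) = C' * (α * P / V) * Ω (0, f 0) := by
  have hεε : -ε ≤ ε := by linarith
  have hfc : ContinuousOn f (Icc (-ε) ε) := fun u hu => (hf u hu).continuousAt.continuousWithinAt
  have hf'c : ContinuousOn f' (Icc (-ε) ε) := fun u hu => (hf' u hu).continuousAt.continuousWithinAt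
  have hgraph : ∀ u ∈ Icc (-ε) ε, ContDiffAt ℝ 1 Ω (u, f u) := fun u hu =>
    hΩ1 u hu _ (abs_lt.1 (hfη u hu))
  -- the derivatives of length and area in the direction `φ`
  have weak : ∀ φ : ℝ → ℝ, ContDiff ℝ ∞ φ → HasCompactSupport φ → tsupport φ ⊆ Ioo (-ε) ε →
      C * (∫ u in (-ε)..ε, (f' u * deriv φ u / √(1 + (f' u) ^ 2) * Ω (u, f u) +
        √(1 + (f' u) ^ 2) * (fderiv ℝ Ω (u, f u) (0, 1) * φ u))) -
      α * P / V * (C' * ∫ u in (-ε)..ε, Ω (u, f u) * φ u) = 0 := by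
    intro φ hφ hφc hφs
    have hφ1 : Continuous φ := hφ.continuous
    have hφd : Continuous (deriv φ) := hφ.continuous_deriv (by simp)
    -- a range of `t` for which the perturbed graph stays in the box
    obtain ⟨T, hT, hTη⟩ : ∃ T > 0, ∀ t ∈ Ioo (-T) T, ∀ u ∈ Icc (-ε) ε,
        f u + t * φ u ∈ Ioo (-η) η := by
      obtain ⟨B, hB⟩ := isCompact_Icc.exists_bound_of_continuousOn
        (hφ1.continuousOn (s := Icc (-ε) ε))
      obtain ⟨u₀, hu₀, hmax⟩ := isCompact_Icc.exists_isMaxOn (nonempty_Icc.2 hεε) hfc.abs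
      have hgap : 0 < η - |f u₀| := by linarith [hfη u₀ hu₀]
      have hB0 : 0 ≤ B := (norm_nonneg _).trans (hB 0 ⟨by linarith, hε.le⟩)
      refine ⟨(η - |f u₀|) / (B + 1), by positivity, fun t ht u hu => abs_lt.1 ?_⟩
      have h1 : |t| < (η - |f u₀|) / (B + 1) := abs_lt.2 ht
      have h2 : |φ u| ≤ B := hB u hu
      have h3 : |f u| ≤ |f u₀| := hmax hu
      rw [lt_div_iff₀ (by positivity)] at h1
      calc |f u + t * φ u| ≤ |f u| + |t| * |φ u| := by
            rw [← abs_mul]; exact abs_add_le _ _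
        _ ≤ |f u₀| + |t| * (B + 1) := by gcongr; linarith
        _ < η := by linarith
    have h0T : (0 : ℝ) ∈ Ioo (-T) T := ⟨by linarith, hT⟩
    have hpt : ContinuousOn (fun z : ℝ × ℝ => f z.2 + z.1 * φ z.2) (Ioo (-T) T ×ˢ Icc (-ε) ε) :=
      (hfc.comp continuousOn_snd fun z hz => hz.2).add (by fun_prop)
    have hslope : ContinuousOn (fun z : ℝ × ℝ => f' z.2 + z.1 * deriv φ z.2)
        (Ioo (-T) T ×ˢ Icc (-ε) ε) :=
      (hf'c.comp continuousOn_snd fun z hz => hz.2).add (by fun_prop)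
    have hΩc : ContinuousOn (fun z : ℝ × ℝ => Ω (z.2, f z.2 + z.1 * φ z.2))
        (Ioo (-T) T ×ˢ Icc (-ε) ε) := hΩ.comp_continuousOn (continuousOn_snd.prodMk hpt)
    have hΩd : ContinuousOn (fun z : ℝ × ℝ => fderiv ℝ Ω (z.2, f z.2 + z.1 * φ z.2) (0, 1))
        (Ioo (-T) T ×ˢ Icc (-ε) ε) := by
      intro z hz
      have h1 : ContinuousAt (fderiv ℝ Ω) (z.2, f z.2 + z.1 * φ z.2) :=
        (hΩ1 z.2 hz.2 _ (hTη z.1 hz.1 z.2 hz.2)).continuousAt_fderiv (by simp)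
      have h2 := ContinuousAt.comp_continuousWithinAt
        (f := fun z : ℝ × ℝ => (z.2, f z.2 + z.1 * φ z.2)) h1 ((continuousOn_snd.prodMk hpt) z hz)
      exact h2.clm_apply continuousWithinAt_const
    have hslice : ∀ t ∈ Ioo (-T) T, MapsTo (fun u : ℝ => (t, u)) (Icc (-ε) ε)
        (Ioo (-T) T ×ˢ Icc (-ε) ε) := fun t ht u hu => ⟨ht, hu⟩
    have hpos : ∀ x : ℝ, 0 < 1 + x ^ 2 := fun x => by positivity
    have hΩv : ∀ t ∈ Ioo (-T) T, ∀ u ∈ Icc (-ε) ε,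
        HasDerivAt (fun t => Ω (u, f u + t * φ u))
          (fderiv ℝ Ω (u, f u + t * φ u) (0, 1) * φ u) t := by
      intro t ht u hu
      have h1 := ((hΩ1 u hu _ (hTη t ht u hu)).differentiableAt (by simp)).hasFDerivAt
      have h2 : HasDerivAt (fun t : ℝ => (u, f u + t * φ u)) (0, φ u) t :=
        (hasDerivAt_const t u).prodMk (by
          simpa using ((hasDerivAt_id t).mul_const (φ u)).const_add (f u))
      have h3 := h1.comp_hasDerivAt t h2
      have h4 : ((0 : ℝ), φ u) = φ u • ((0 : ℝ), (1 : ℝ)) := by simp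
      rw [h4, map_smul, smul_eq_mul, mul_comm] at h3
      exact h3
    -- derivative of the length
    have hlen : HasDerivAt (fun t => ∫ u in (-ε)..ε,
        √(1 + (f' u + t * deriv φ u) ^ 2) * Ω (u, f u + t * φ u))
        (∫ u in (-ε)..ε, (f' u * deriv φ u / √(1 + (f' u) ^ 2) * Ω (u, f u) +
          √(1 + (f' u) ^ 2) * (fderiv ℝ Ω (u, f u) (0, 1) * φ u))) 0 := by
      have := hasDerivAt_intervalIntegral_of_continuousOn (T := T) (a := -ε) (b := ε)
        (F := fun t u => √(1 + (f' u + t * deriv φ u) ^ 2) * Ω (u, f u + t * φ u))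
        (F' := fun t u => (f' u + t * deriv φ u) * deriv φ u / √(1 + (f' u + t * deriv φ u) ^ 2) *
          Ω (u, f u + t * φ u) + √(1 + (f' u + t * deriv φ u) ^ 2) *
          (fderiv ℝ Ω (u, f u + t * φ u) (0, 1) * φ u)) hT hεε ?_ ?_ ?_
      · simpa using this
      · intro t ht
        have h1 := (hslope.comp (f := fun u : ℝ => (t, u)) (by fun_prop) (hslice t ht))
        have h2 := (hΩc.comp (f := fun u : ℝ => (t, u)) (by fun_prop) (hslice t ht))
        exact ((continuousOn_const.add (h1.pow 2)).sqrt).mul h2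
      · intro t ht u hu
        have h1 : HasDerivAt (fun t : ℝ => f' u + t * deriv φ u) (deriv φ u) t := by
          simpa using ((hasDerivAt_id t).mul_const (deriv φ u)).const_add (f' u)
        have h2 := ((h1.pow 2).const_add 1).sqrt (hpos _).ne'
        refine (h2.mul (hΩv t ht u hu)).congr_deriv ?_
        congr 2
        simp only [Pi.pow_apply, Nat.cast_ofNat, Nat.add_one_sub_one, pow_one]
        have : √(1 + (f' u + t * deriv φ u) ^ 2) ≠ 0 := (Real.sqrt_pos.2 (hpos _)).ne'
        field_simp
      · have hs : ContinuousOn (fun z : ℝ × ℝ => √(1 + (f' z.2 + z.1 * deriv φ z.2) ^ 2))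
            (Ioo (-T) T ×ˢ Icc (-ε) ε) := (continuousOn_const.add (hslope.pow 2)).sqrt
        have hd : ContinuousOn (fun z : ℝ × ℝ => deriv φ z.2) (Ioo (-T) T ×ˢ Icc (-ε) ε) := by
          fun_prop
        have hp : ContinuousOn (fun z : ℝ × ℝ => φ z.2) (Ioo (-T) T ×ˢ Icc (-ε) ε) := by
          fun_prop
        exact (((hslope.mul hd).div hs fun z _ => (Real.sqrt_pos.2 (hpos _)).ne').mul hΩc).add
          (hs.mul (hΩd.mul hp))
    -- derivative of the area
    have harea : HasDerivAt (fun t => ∫ u in (-ε)..ε, ∫ v in (f u)..(f u + t * φ u), Ω (u, v))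
        (∫ u in (-ε)..ε, Ω (u, f u) * φ u) 0 := by
      have hJ : Continuous fun z : ℝ × ℝ => ∫ v in (0 : ℝ)..z.2, Ω (z.1, v) := by
        have h := intervalIntegral.continuous_parametric_intervalIntegral_of_continuous
          (μ := volume) (f := fun (z : ℝ × ℝ) v => Ω (z.1, v)) (a₀ := 0) (s := fun z => z.2)
          (by fun_prop) (by fun_prop)
        exact h
      have hint : ∀ u a b, IntervalIntegrable (fun v => Ω (u, v)) volume a b := fun u a b =>
        (by fun_prop : Continuous fun v => Ω (u, v)).intervalIntegrable _ _
      have := hasDerivAt_intervalIntegral_of_continuousOn (T := T) (a := -ε) (b := ε)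
        (F := fun t u => ∫ v in (f u)..(f u + t * φ u), Ω (u, v))
        (F' := fun t u => Ω (u, f u + t * φ u) * φ u) hT hεε ?_ ?_ ?_
      · simpa using this
      · intro t ht
        have h1 : ContinuousOn (fun u => f u + t * φ u) (Icc (-ε) ε) := hfc.add (by fun_prop)
        have h2 : ∀ u, ∫ v in (f u)..(f u + t * φ u), Ω (u, v) =
            (∫ v in (0 : ℝ)..(f u + t * φ u), Ω (u, v)) - ∫ v in (0 : ℝ)..(f u), Ω (u, v) :=
          fun u => (intervalIntegral.integral_interval_sub_left (hint u _ _) (hint u _ _)).symm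
        simp only [h2]
        exact (hJ.comp_continuousOn (continuousOn_id.prodMk h1)).sub
          (hJ.comp_continuousOn (continuousOn_id.prodMk hfc))
      · intro t ht u hu
        have h1 : HasDerivAt (fun t : ℝ => f u + t * φ u) (φ u) t := by
          simpa using ((hasDerivAt_id t).mul_const (φ u)).const_add (f u)
        have h2 := intervalIntegral.integral_hasDerivAt_right (hint u (f u) (f u + t * φ u))
          ((by fun_prop : Continuous fun v => Ω (u, v)).stronglyMeasurableAtFilter _ _)
          (by fun_prop : Continuous fun v => Ω (u, v)).continuousAt
        exact h2.comp t h1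
      · exact hΩc.mul (by fun_prop)
    -- the minimum of the quotient
    set L := fun t => ∫ u in (-ε)..ε,
        √(1 + (f' u + t * deriv φ u) ^ 2) * Ω (u, f u + t * φ u) with hL
    set A := fun t => ∫ u in (-ε)..ε, ∫ v in (f u)..(f u + t * φ u), Ω (u, v) with hA
    set L' := ∫ u in (-ε)..ε, (f' u * deriv φ u / √(1 + (f' u) ^ 2) * Ω (u, f u) +
          √(1 + (f' u) ^ 2) * (fderiv ℝ Ω (u, f u) (0, 1) * φ u)) with hL'
    set A' := ∫ u in (-ε)..ε, Ω (u, f u) * φ u with hA'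
    have hL0 : L 0 = ∫ u in (-ε)..ε, √(1 + (f' u) ^ 2) * Ω (u, f u) := by simp [hL]
    have hA0 : A 0 = 0 := by simp [hA]
    have hquot : HasDerivAt (fun t => V / (V + C' * A t)) (-(C' * A') / V) 0 := by
      have h1 := (hasDerivAt_const (0 : ℝ) V).div ((harea.const_mul C').const_add V)
        (by rw [hA0]; simpa using hV.ne')
      refine h1.congr_deriv ?_
      have hV' := hV.ne'
      simp only [hA0, mul_zero, add_zero, zero_mul, zero_sub]
      field_simp
    have hq0 : V / (V + C' * A 0) = 1 := by rw [hA0]; simp [hV.ne']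
    have hpow : HasDerivAt (fun t => (V / (V + C' * A t)) ^ α) (-(C' * A') / V * α) 0 := by
      have := hquot.rpow_const (p := α) (Or.inl (by rw [hq0]; norm_num))
      simpa [hq0] using this
    have hψ := hpow.mul (((hlen.sub_const (L 0)).const_mul C).const_add P)
    have hloc : IsLocalMin (fun t => (V / (V + C' * A t)) ^ α * (P + C * (L t - L 0))) 0 := by
      filter_upwards [hmin φ hφ hφc hφs] with t ht
      rw [hq0, Real.one_rpow, sub_self, mul_zero, add_zero, one_mul, hL0]
      exact ht
    have hz := hloc.hasDerivAt_eq_zero hψ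
    change _ * (P + C * (L 0 - L 0)) + (V / (V + C' * A 0)) ^ α * (C * L') = 0 at hz
    rw [hq0, Real.one_rpow, sub_self, mul_zero, add_zero, one_mul] at hz
    rw [← hz]
    ring
  -- integration by parts
  set X : ℝ → ℝ := fun u => f' u / √(1 + (f' u) ^ 2) * Ω (u, f u) with hX
  set X' : ℝ → ℝ := fun u => (f'' u * √(1 + (f' u) ^ 2) - f' u * (f' u * f'' u / √(1 + (f' u) ^ 2)))
    / (√(1 + (f' u) ^ 2)) ^ 2 * Ω (u, f u) +
    f' u / √(1 + (f' u) ^ 2) * fderiv ℝ Ω (u, f u) (1, f' u) with hX'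
  have hspos : ∀ u, √(1 + (f' u) ^ 2) ≠ 0 := fun u => (Real.sqrt_pos.2 (by positivity)).ne'
  have hXd : ∀ u ∈ Icc (-ε) ε, HasDerivAt X (X' u) u := by
    intro u hu
    have h1 := (((hf' u hu).pow 2).const_add 1).sqrt (by positivity : 1 + f' u ^ 2 ≠ 0)
    have h2 := (hf' u hu).div h1 (hspos u)
    have h3 := ((hgraph u hu).differentiableAt (by simp)).hasFDerivAt.comp_hasDerivAt u
      ((hasDerivAt_id u).prodMk (hf u hu))
    refine (h2.mul h3).congr_deriv ?_
    simp only [hX', Pi.pow_apply, Nat.cast_ofNat, Nat.add_one_sub_one, pow_one, Pi.div_apply,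
      Function.comp_apply, id]
    congr 4
    field_simp
  have hgc : ContinuousOn (fun u => (u, f u)) (Icc (-ε) ε) := continuousOn_id.prodMk hfc
  have hΩg : ContinuousOn (fun u => Ω (u, f u)) (Icc (-ε) ε) := hΩ.comp_continuousOn hgc
  have hfdg : ContinuousOn (fun u => fderiv ℝ Ω (u, f u)) (Icc (-ε) ε) := fun u hu =>
    ContinuousAt.comp_continuousWithinAt (f := fun u => (u, f u))
      ((hgraph u hu).continuousAt_fderiv (by simp)) (hgc u hu)
  have hsc : ContinuousOn (fun u => √(1 + (f' u) ^ 2)) (Icc (-ε) ε) :=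
    (continuousOn_const.add (hf'c.pow 2)).sqrt
  have hX'c : ContinuousOn X' (Icc (-ε) ε) := by
    refine ContinuousOn.add (ContinuousOn.mul (ContinuousOn.div ((hf''.mul hsc).sub
      (hf'c.mul ((hf'c.mul hf'').div hsc fun u _ => hspos u))) (hsc.pow 2)
      fun u _ => pow_ne_zero 2 (hspos u)) hΩg)
      (ContinuousOn.mul (hf'c.div hsc fun u _ => hspos u) ?_)
    exact hfdg.clm_apply (continuousOn_const.prodMk hf'c)
  set Y : ℝ → ℝ := fun u => √(1 + (f' u) ^ 2) * fderiv ℝ Ω (u, f u) (0, 1) with hY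
  have hYc : ContinuousOn Y (Icc (-ε) ε) := hsc.mul (hfdg.clm_apply continuousOn_const)
  set g : ℝ → ℝ := fun u => C * (-(X' u) + Y u) - α * P / V * (C' * Ω (u, f u)) with hg
  have hgcont : ContinuousOn g (Icc (-ε) ε) :=
    (continuousOn_const.mul (hX'c.neg.add hYc)).sub
      (continuousOn_const.mul (continuousOn_const.mul hΩg))
  have hstrong : ∀ φ : ℝ → ℝ, ContDiff ℝ ∞ φ → HasCompactSupport φ → tsupport φ ⊆ Ioo (-ε) ε →
      ∫ u, φ u • g u = 0 := by
    intro φ hφ hφc hφs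
    have hφ1 : Continuous φ := hφ.continuous
    have hφd : Continuous (deriv φ) := hφ.continuous_deriv (by simp)
    have hend : φ ε = 0 ∧ φ (-ε) = 0 := by
      constructor
      · by_contra h
        exact lt_irrefl _ (hφs (subset_tsupport _ h)).2
      · by_contra h
        exact lt_irrefl _ (hφs (subset_tsupport _ h)).1
    have hII : ∀ {k : ℝ → ℝ}, ContinuousOn k (Icc (-ε) ε) → IntervalIntegrable k volume (-ε) ε :=
      fun hk => (hk.mono (by rw [uIcc_of_le hεε])).intervalIntegrable
    have hparts : ∫ u in (-ε)..ε, X u * deriv φ u = - ∫ u in (-ε)..ε, X' u * φ u := by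
      rw [intervalIntegral.integral_mul_deriv_eq_deriv_mul (u := X) (v := φ) (u' := X')
        (v' := deriv φ) (fun u hu => hXd u (by rwa [uIcc_of_le hεε] at hu))
        (fun u _ => (hφ.differentiable (by simp) u).hasDerivAt) (hII hX'c) (hII (by fun_prop))]
      rw [hend.1, hend.2]; ring
    have hw := weak φ hφ hφc hφs
    have hXc : ContinuousOn X (Icc (-ε) ε) := fun u hu =>
      (hXd u hu).continuousAt.continuousWithinAt
    have e1 : (∫ u in (-ε)..ε, (f' u * deriv φ u / √(1 + (f' u) ^ 2) * Ω (u, f u) +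
        √(1 + (f' u) ^ 2) * (fderiv ℝ Ω (u, f u) (0, 1) * φ u))) =
        ∫ u in (-ε)..ε, (-(X' u) + Y u) * φ u := by
      have : ∀ u, f' u * deriv φ u / √(1 + (f' u) ^ 2) * Ω (u, f u) +
        √(1 + (f' u) ^ 2) * (fderiv ℝ Ω (u, f u) (0, 1) * φ u) = X u * deriv φ u + Y u * φ u := by
        intro u; simp only [hX, hY]; ring
      simp only [this]
      rw [intervalIntegral.integral_add (f := fun u => X u * deriv φ u) (g := fun u => Y u * φ u)
        (hII (hXc.mul hφd.continuousOn)) (hII (hYc.mul hφ1.continuousOn)), hparts,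
        ← intervalIntegral.integral_neg, ← intervalIntegral.integral_add
        (f := fun u => -(X' u * φ u)) (g := fun u => Y u * φ u)
        (hII ((hX'c.mul hφ1.continuousOn).neg)) (hII (hYc.mul hφ1.continuousOn))]
      congr 1
      funext u; ring
    have e2 : ∫ u, φ u • g u = ∫ u in (-ε)..ε, φ u * g u := by
      rw [intervalIntegral.integral_of_le hεε, setIntegral_eq_integral_of_forall_compl_eq_zero]
      · rfl
      · intro u hu
        have : φ u = 0 := by
          by_contra h
          have := hφs (subset_tsupport _ h)
          exact hu ⟨this.1, this.2.le⟩
        simp [this]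
    rw [e2]
    rw [e1, ← intervalIntegral.integral_const_mul, ← intervalIntegral.integral_const_mul,
      ← intervalIntegral.integral_const_mul, ← intervalIntegral.integral_sub
      (f := fun u => C * ((-(X' u) + Y u) * φ u))
      (g := fun u => α * P / V * (C' * (Ω (u, f u) * φ u)))
      (hII (continuousOn_const.mul ((hX'c.neg.add hYc).mul hφ1.continuousOn)))
      (hII (continuousOn_const.mul (continuousOn_const.mul (hΩg.mul hφ1.continuousOn))))] at hw
    rw [← hw]
    congr 1
    funext u
    simp only [hg]
    ring
  have hae := isOpen_Ioo.ae_eq_zero_of_integral_contDiff_smul_eq_zero (μ := volume) (f := g)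
    (U := Ioo (-ε) ε)
    ((hgcont.mono Ioo_subset_Icc_self).locallyIntegrableOn measurableSet_Ioo)
    (fun φ hφ hφc hφs => hstrong φ hφ hφc hφs)
  have hae' : g =ᵐ[volume.restrict (Ioo (-ε) ε)] fun _ => 0 :=
    (ae_restrict_iff' measurableSet_Ioo).2 hae
  have h00 := Measure.eqOn_open_of_ae_eq hae' isOpen_Ioo (hgcont.mono Ioo_subset_Icc_self)
    continuousOn_const (x := 0) ⟨by linarith, hε⟩
  simp only [hg, hX', hY, hf'0] at h00
  norm_num at h00
  linarith

end Variation

/-! ### The first variation of regions of revolution -/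

section FirstVariation

variable {n : ℕ} {p : ℝ}

/-- Cartesian coordinates of the plane with origin `q₁` and axes `L (1, 0)`, `L (0, 1)`. -/
def frame (q₁ : Plane) (L : Plane ≃ₗᵢ[ℝ] Plane) : ℝ × ℝ ≃ₜ Plane where
  toFun z := q₁ + L !₂[z.1, z.2]
  invFun q := (L.symm (q - q₁) 0, L.symm (q - q₁) 1)
  left_inv z := by simp
  right_inv q := by
    have : (!₂[L.symm (q - q₁) 0, L.symm (q - q₁) 1] : Plane) = L.symm (q - q₁) := by
      ext i; fin_cases i <;> rfl
    simp only [this, LinearIsometryEquiv.apply_symm_apply, add_sub_cancel]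
  continuous_toFun := by fun_prop
  continuous_invFun := by fun_prop

theorem frame_apply (q₁ : Plane) (L : Plane ≃ₗᵢ[ℝ] Plane) (z : ℝ × ℝ) :
    frame q₁ L z = q₁ + L !₂[z.1, z.2] := rfl

theorem frame_apply_add_smul (q₁ : Plane) (L : Plane ≃ₗᵢ[ℝ] Plane) (u v : ℝ) :
    frame q₁ L (u, v) = q₁ + (u • L !₂[1, 0] + v • L !₂[0, 1]) := by
  rw [frame_apply, ← map_smul, ← map_smul, ← map_add]
  congr 2
  ext i; fin_cases i <;> simp

theorem measurePreserving_frame (q₁ : Plane) (L : Plane ≃ₗᵢ[ℝ] Plane) :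
    MeasurePreserving (frame q₁ L) :=
  (measurePreserving_add_left volume q₁).comp
    (L.measurePreserving.comp measurePreserving_plane_mk)

/-- The weight of the half-plane: `n`-dimensional weighted volumes and areas of objects of
revolution are, up to a constant, areas and lengths with this weight. -/
def planeDensity (n : ℕ) (p : ℝ) (q : Plane) : ℝ := ‖q‖ ^ p * q 1 ^ (n - 2)

theorem continuous_planeDensity (hp : 0 < p) : Continuous (planeDensity n p) :=
  (continuous_norm.rpow_const fun _ => Or.inr hp.le).mul (by fun_prop)

theorem planeDensity_pos {q : Plane} (hq : 0 < q 1) : 0 < planeDensity n p q := by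
  have : 0 < ‖q‖ := norm_pos_iff.2 fun h => by simp [h] at hq
  unfold planeDensity
  positivity

theorem contDiffAt_planeDensity {q : Plane} (hq : 0 < q 1) :
    ContDiffAt ℝ 1 (planeDensity n p) q := by
  have h0 : q ≠ 0 := fun h => by simp [h] at hq
  exact ((contDiffAt_norm ℝ h0).rpow_const_of_ne (norm_ne_zero_iff.2 h0)).mul
    ((by fun_prop : ContDiff ℝ 1 fun q : Plane => q 1).contDiffAt.pow _)

/-- The derivative of the weight of the half-plane. -/
theorem fderiv_planeDensity (hn : 2 ≤ n) {q : Plane} (hq : 0 < q 1) (e : Plane) :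
    fderiv ℝ (planeDensity n p) q e =
      planeDensity n p q * (p * inner ℝ q e / ‖q‖ ^ 2 + (n - 2) * e 1 / q 1) := by
  have h0 : q ≠ 0 := fun h => by simp [h] at hq
  have hr : 0 < ‖q‖ := norm_pos_iff.2 h0
  have hl : HasDerivAt (fun t : ℝ => q + t • e) e 0 := by
    simpa using ((hasDerivAt_id (0 : ℝ)).smul_const e).const_add q
  have h1 : HasDerivAt (fun t : ℝ => planeDensity n p (q + t • e))
      (fderiv ℝ (planeDensity n p) q e) 0 := by
    have := ((contDiffAt_planeDensity (n := n) (p := p) hq).differentiableAt (by simp)).hasFDerivAt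
    exact this.comp_hasDerivAt_of_eq (0 : ℝ) hl (by simp)
  have h2 : HasDerivAt (fun t : ℝ => ‖q + t • e‖) (inner ℝ q e / ‖q‖) 0 := by
    have h := hl.norm_sq
    simp only [zero_smul, add_zero] at h
    have h3 := h.sqrt (by simpa using hr.ne')
    simp only [Real.sqrt_sq (norm_nonneg _), zero_smul, add_zero] at h3
    refine h3.congr_deriv ?_
    field_simp
  have h3 := h2.rpow_const (p := p) (Or.inl (by simpa using hr.ne'))
  have h4 : HasDerivAt (fun t : ℝ => (q + t • e) 1) (e 1) 0 := by
    simpa using ((hasDerivAt_id (0 : ℝ)).mul_const (e 1)).const_add (q 1)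
  have h5 := h3.mul (h4.pow (n - 2))
  rw [h1.unique h5]
  obtain ⟨m, rfl⟩ : ∃ m, n = m + 2 := ⟨n - 2, by omega⟩
  simp only [zero_smul, add_zero, Nat.add_sub_cancel, planeDensity, Pi.pow_apply]
  rw [Real.rpow_sub_one hr.ne']
  push_cast
  rcases m with _ | m
  · simp; field_simp
  · simp only [Nat.add_sub_cancel]
    push_cast
    field_simp
    ring

theorem lintegral_ofReal_Ioo {h : ℝ → ℝ} {a b : ℝ} (hab : a ≤ b) (hc : ContinuousOn h (Icc a b))
    (h0 : ∀ x ∈ Icc a b, 0 ≤ h x) :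
    ∫⁻ x in Ioo a b, ENNReal.ofReal (h x) = ENNReal.ofReal (∫ x in a..b, h x) := by
  rw [intervalIntegral.integral_of_le hab, ← integral_Ioc_eq_integral_Ioo.symm,
    ofReal_integral_eq_lintegral_ofReal
      ((hc.integrableOn_Icc).mono_set Ioo_subset_Icc_self)
      ((ae_restrict_iff' measurableSet_Ioo).2
        (Eventually.of_forall fun x hx => h0 x (Ioo_subset_Icc_self hx)))]

variable [NeZero n]

/-- The volume of a set of revolution, in Cartesian coordinates of the half-plane. -/
theorem weightedVolume_preimage_frame {C : ℝ≥0} (hC : ∀ φ : Plane → ℝ≥0∞, Measurable φ →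
      ∫⁻ x : EuclideanSpace ℝ (Fin n), φ (profile x) =
        C * ∫⁻ q : Plane in {q | 0 < q 1}, φ q * ENNReal.ofReal (q 1 ^ (n - 2)))
    (q₁ : Plane) (L : Plane ≃ₗᵢ[ℝ] Plane) {T : Set (ℝ × ℝ)} (hT : MeasurableSet T)
    (hpos : ∀ z ∈ T, 0 < frame q₁ L z 1) :
    weightedVolume p {x : EuclideanSpace ℝ (Fin n) | (frame q₁ L).symm (profile x) ∈ T} =
      C * ∫⁻ z in T, ENNReal.ofReal (planeDensity n p (frame q₁ L z)) := by
  have hm : MeasurableSet ((frame q₁ L).symm ⁻¹' T) := (frame q₁ L).symm.continuous.measurable hT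
  have hm' : MeasurableSet {x : EuclideanSpace ℝ (Fin n) | (frame q₁ L).symm (profile x) ∈ T} :=
    continuous_profile.measurable hm
  have h1 := hC (((frame q₁ L).symm ⁻¹' T).indicator fun q => ENNReal.ofReal (‖q‖ ^ p))
    (Measurable.indicator (by fun_prop) hm)
  have h2 : weightedVolume p {x : EuclideanSpace ℝ (Fin n) | (frame q₁ L).symm (profile x) ∈ T} =
      ∫⁻ x : EuclideanSpace ℝ (Fin n), ((frame q₁ L).symm ⁻¹' T).indicator
        (fun q => ENNReal.ofReal (‖q‖ ^ p)) (profile x) := by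
    rw [weightedVolume, ← lintegral_indicator hm']
    refine lintegral_congr fun x => ?_
    by_cases hx : (frame q₁ L).symm (profile x) ∈ T <;> simp [indicator, hx, norm_profile]
  rw [h2, h1]
  congr 1
  have hmp : MeasurableSet {q : Plane | 0 < q 1} := measurableSet_lt measurable_const (by fun_prop)
  rw [← lintegral_indicator hmp, ← (measurePreserving_frame q₁ L).lintegral_comp_emb
    (frame q₁ L).measurableEmbedding, ← lintegral_indicator hT]
  refine lintegral_congr fun z => ?_
  by_cases hz : z ∈ T
  · have := hpos z hz
    simp only [indicator, mem_ofPred_eq, this, if_true, mem_preimage, Homeomorph.symm_apply_apply,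
      hz, planeDensity]
    rw [ENNReal.ofReal_mul (by positivity)]
  · simp [indicator, hz]

/-- A point with profile `q`, rotated like `x`. -/
def liftProfile (x : EuclideanSpace ℝ (Fin n)) (q : Plane) : EuclideanSpace ℝ (Fin n) :=
  EuclideanSpace.single 0 (q 0) + (q 1 / profile x 1) • radialPart x

theorem profile_liftProfile {x : EuclideanSpace ℝ (Fin n)} (hx : 0 < profile x 1) {q : Plane}
    (hq : 0 ≤ q 1) : profile (liftProfile x q) = q := by
  have h0 : ((q 1 / profile x 1) • radialPart x) 0 = 0 := by simp
  have hx' : ‖radialPart x‖ ≠ 0 := by rw [profile_one] at hx; exact hx.ne'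
  ext i
  fin_cases i
  · simp [liftProfile]
  · change profile (liftProfile x q) 1 = q 1
    rw [profile_one, liftProfile, radialPart_single_add h0, norm_smul, profile_one,
      Real.norm_eq_abs, abs_div, abs_norm, abs_of_nonneg hq, div_mul_cancel₀ _ hx']

theorem liftProfile_self {x : EuclideanSpace ℝ (Fin n)} (hx : 0 < profile x 1) :
    liftProfile x (profile x) = x := by
  rw [liftProfile, div_self hx.ne', one_smul, profile_zero, single_add_radialPart]

theorem continuous_liftProfile (x : EuclideanSpace ℝ (Fin n)) : Continuous (liftProfile x) := by
  have h : Continuous fun q : Plane => (q 1 / profile x 1) • radialPart x := by fun_prop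
  refine Continuous.add ?_ h
  have : (fun q : Plane => EuclideanSpace.single (0 : Fin n) (q 0)) =
      fun q : Plane => (q 0) • (EuclideanSpace.single (0 : Fin n) (1 : ℝ)) := by
    funext q
    ext i
    by_cases hi : i = 0 <;> simp [hi]
  rw [this]
  fun_prop

theorem mem_frontier_congr {X : Type*} [TopologicalSpace X] {S T : Set X} {x : X}
    (h : ∀ᶠ y in 𝓝 x, y ∈ S ↔ y ∈ T) : x ∈ frontier S ↔ x ∈ frontier T := by
  simp only [frontier_eq_closure_inter_closure, mem_inter_iff, mem_closure_iff_frequently,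
    mem_compl_iff]
  exact and_congr (frequently_congr h) (frequently_congr (h.mono fun y hy => not_congr hy))

/-- The points of the rectangle `(-ε, ε) × (-η, η)` below the graph of `g`. -/
def boxBelow (ε η : ℝ) (g : ℝ → ℝ) : Set (ℝ × ℝ) :=
  {z | z.1 ∈ Ioo (-ε) ε ∧ z.2 ∈ Ioo (-η) η ∧ z.2 < g z.1}

theorem isOpen_boxBelow {ε η : ℝ} {g : ℝ → ℝ} (hg : ContinuousOn g (Icc (-ε) ε)) :
    IsOpen (boxBelow ε η g) := by
  have h1 : IsOpen (Ioo (-ε) ε ×ˢ Ioo (-η) η) := isOpen_Ioo.prod isOpen_Ioo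
  have h2 : ContinuousOn (fun z : ℝ × ℝ => g z.1 - z.2) (Ioo (-ε) ε ×ˢ Ioo (-η) η) :=
    (hg.comp continuousOn_fst fun z hz => Ioo_subset_Icc_self hz.1).sub continuousOn_snd
  have h3 := h2.isOpen_inter_preimage h1 (isOpen_Ioi (a := (0 : ℝ)))
  convert h3 using 1
  ext z
  simp [boxBelow, and_assoc]

/-- Replacing the part of `E` with profile in a rectangle by the region below the graph of `g`. -/
def replaceBelow (E : Set (EuclideanSpace ℝ (Fin n))) (Φ : ℝ × ℝ ≃ₜ Plane) (ε η : ℝ) (g : ℝ → ℝ) :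
    Set (EuclideanSpace ℝ (Fin n)) :=
  (E \ {x | Φ.symm (profile x) ∈ Ioo (-ε) ε ×ˢ Ioo (-η) η}) ∪
    {x | Φ.symm (profile x) ∈ boxBelow ε η g}

theorem continuous_symm_profile (Φ : ℝ × ℝ ≃ₜ Plane) :
    Continuous fun x : EuclideanSpace ℝ (Fin n) => Φ.symm (profile x) :=
  Φ.symm.continuous.comp continuous_profile

/-- If the subgraphs of `f` and `g` differ only in a closed subset `K` of the open box, then
replacing the graph of `f` by that of `g` creates no boundary besides the graph of `g`; in particular
none on the walls of the box. -/
theorem frontier_replaceBelow_subset {E : Set (EuclideanSpace ℝ (Fin n))} {Φ : ℝ × ℝ ≃ₜ Plane}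
    {ε η : ℝ} {f g : ℝ → ℝ}
    (hE : ∀ x : EuclideanSpace ℝ (Fin n), Φ.symm (profile x) ∈ Ioo (-ε) ε ×ˢ Ioo (-η) η →
      (x ∈ E ↔ (Φ.symm (profile x)).2 < f (Φ.symm (profile x)).1))
    (hg : ContinuousOn g (Icc (-ε) ε)) {K : Set (ℝ × ℝ)} (hK : IsClosed K)
    (hKb : K ⊆ Ioo (-ε) ε ×ˢ Ioo (-η) η)
    (hfg : ∀ z ∈ Ioo (-ε) ε ×ˢ Ioo (-η) η, z ∉ K → (z.2 < f z.1 ↔ z.2 < g z.1)) :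
    frontier (replaceBelow E Φ ε η g) ⊆
      (frontier E \ {x | Φ.symm (profile x) ∈ Ioo (-ε) ε ×ˢ Ioo (-η) η}) ∪
      profile ⁻¹' ((fun u => Φ (u, g u)) '' Ioo (-ε) ε) := by
  intro x hx
  have hψ := continuous_symm_profile (n := n) Φ
  by_cases hxU : Φ.symm (profile x) ∈ Ioo (-ε) ε ×ˢ Ioo (-η) η
  · right
    set z := Φ.symm (profile x) with hz
    have hboxo : IsOpen (Ioo (-ε) ε ×ˢ Ioo (-η) η) := isOpen_Ioo.prod isOpen_Ioo
    have hgz : ContinuousAt g z.1 := hg.continuousAt (Icc_mem_nhds hxU.1.1 hxU.1.2)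
    have hlim : Tendsto (fun y : EuclideanSpace ℝ (Fin n) => g (Φ.symm (profile y)).1 -
        (Φ.symm (profile y)).2) (𝓝 x) (𝓝 (g z.1 - z.2)) := by
      refine Tendsto.sub ?_ ((continuous_snd.comp hψ).tendsto x)
      exact hgz.tendsto.comp ((continuous_fst.comp hψ).tendsto x)
    have hin : ∀ᶠ y in 𝓝 x, Φ.symm (profile y) ∈ Ioo (-ε) ε ×ˢ Ioo (-η) η :=
      hψ.continuousAt.eventually_mem (hboxo.mem_nhds hxU)
    rw [frontier_eq_closure_inter_closure, mem_inter_iff, mem_closure_iff_frequently,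
      mem_closure_iff_frequently] at hx
    have heq : g z.1 = z.2 := by
      rcases lt_trichotomy (g z.1) z.2 with h | h | h
      · exfalso
        refine hx.1 ?_
        filter_upwards [hin, hlim.eventually_lt_const (sub_neg.2 h)] with y hy hy2 hyE
        rcases hyE with hyE | hyE
        · exact hyE.2 hy
        · have := hyE.2.2
          linarith
      · exact h
      · exfalso
        refine hx.2 ?_
        filter_upwards [hin, hlim.eventually_const_lt (sub_pos.2 h)] with y hy hy2 hyE
        exact hyE (Or.inr ⟨hy.1, hy.2, by linarith⟩)
    refine ⟨z.1, hxU.1, ?_⟩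
    simp only [heq]
    exact Φ.apply_symm_apply _
  · left
    refine ⟨(mem_frontier_congr ?_).1 hx, hxU⟩
    have hnK : ∀ᶠ y in 𝓝 x, Φ.symm (profile y) ∉ K :=
      hψ.continuousAt.eventually_mem (hK.isOpen_compl.mem_nhds fun h => hxU (hKb h))
    filter_upwards [hnK] with y hy
    by_cases hyU : Φ.symm (profile y) ∈ Ioo (-ε) ε ×ˢ Ioo (-η) η
    · rw [hE y hyU, hfg _ hyU hy]
      constructor
      · rintro (h | h)
        · exact absurd hyU h.2
        · exact h.2.2
      · exact fun h => Or.inr ⟨hyU.1, hyU.2, h⟩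
    · constructor
      · rintro (h | h)
        · exact h.1
        · exact absurd ⟨h.1, h.2.1⟩ hyU
      · exact fun h => Or.inl ⟨h, hyU⟩

/-- Conversely, the graph consists of boundary points. Together with `frontier_replaceBelow_subset`
this compares the perimeters of an open region and of its variation. -/
theorem graph_subset_frontier {E : Set (EuclideanSpace ℝ (Fin n))} {Φ : ℝ × ℝ ≃ₜ Plane}
    {ε η : ℝ} {f : ℝ → ℝ} (hEo : IsOpen E)
    (hE : ∀ x : EuclideanSpace ℝ (Fin n), Φ.symm (profile x) ∈ Ioo (-ε) ε ×ˢ Ioo (-η) η →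
      (x ∈ E ↔ (Φ.symm (profile x)).2 < f (Φ.symm (profile x)).1))
    (hfη : ∀ u ∈ Ioo (-ε) ε, |f u| < η) (hpos : ∀ u ∈ Ioo (-ε) ε, 0 < Φ (u, f u) 1) :
    (profile ⁻¹' ((fun u => Φ (u, f u)) '' Ioo (-ε) ε) : Set (EuclideanSpace ℝ (Fin n))) ⊆
      frontier E := by
  rintro x ⟨u, hu, hux⟩
  have hx : Φ.symm (profile x) = (u, f u) := by rw [← hux]; exact Φ.symm_apply_apply _
  have hfu := abs_lt.1 (hfη u hu)
  have hx1 : 0 < profile x 1 := by rw [← hux]; exact hpos u hu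
  rw [hEo.frontier_eq]
  refine ⟨?_, fun h => ?_⟩
  · -- approach `x` by points whose profiles lie slightly below the graph
    have hline : Continuous fun h : ℝ => Φ (u, f u - h) := Φ.continuous.comp (by fun_prop)
    have hlim : Tendsto (fun h : ℝ => liftProfile x (Φ (u, f u - h))) (𝓝[>] 0) (𝓝 x) := by
      have h1 := ((continuous_liftProfile x).comp hline).tendsto 0
      simp only [Function.comp_apply, sub_zero] at h1
      have h2 : Φ (u, f u) = profile x := hux
      rw [h2, liftProfile_self hx1] at h1
      exact h1.mono_left nhdsWithin_le_nhds
    refine mem_closure_of_tendsto hlim ?_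
    have hp1 : ∀ᶠ h in 𝓝[>] (0 : ℝ), 0 < Φ (u, f u - h) 1 := by
      have h1 : Continuous fun h : ℝ => Φ (u, f u - h) 1 :=
        (by fun_prop : Continuous fun q : Plane => q 1).comp hline
      have h2 := h1.tendsto 0
      simp only [sub_zero] at h2
      exact (h2.mono_left nhdsWithin_le_nhds).eventually_const_lt (hpos u hu)
    have hp2 : ∀ᶠ h in 𝓝[>] (0 : ℝ), h < η + f u :=
      (eventually_lt_nhds (show (0 : ℝ) < η + f u by linarith)).filter_mono nhdsWithin_le_nhds
    filter_upwards [hp1, hp2, self_mem_nhdsWithin] with h h1 h2 h3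
    have h3' : 0 < h := h3
    have e : Φ.symm (profile (liftProfile x (Φ (u, f u - h)))) = (u, f u - h) := by
      rw [profile_liftProfile hx1 h1.le, Φ.symm_apply_apply]
    rw [hE _ (by rw [e]; exact ⟨hu, by constructor <;> dsimp <;> linarith⟩), e]
    dsimp
    linarith
  · rw [hE x (by rw [hx]; exact ⟨hu, hfu⟩), hx] at h
    exact lt_irrefl _ h

/-- The weighted area of the hypersurface of revolution generated by a graph in a tilted frame. -/
theorem lintegral_graph (hn : 2 ≤ n) (hp : 0 < p) {C : ℝ≥0}
    (hC : ∀ J : Set ℝ, MeasurableSet J → μHE[n - 1] (cylinder n 1 J) = C * volume J)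
    (q₁ : Plane) (L : Plane ≃ₗᵢ[ℝ] Plane) {ε : ℝ} (hε : 0 < ε) {g g' : ℝ → ℝ}
    (hg : ∀ u ∈ Icc (-ε) ε, HasDerivAt g (g' u) u) (hg' : ContinuousOn g' (Icc (-ε) ε))
    (hpos : ∀ u ∈ Icc (-ε) ε, 0 < frame q₁ L (u, g u) 1) :
    MeasurableSet (profile ⁻¹' ((fun u => frame q₁ L (u, g u)) '' Ioo (-ε) ε) :
      Set (EuclideanSpace ℝ (Fin n))) ∧
    ∫⁻ x in (profile ⁻¹' ((fun u => frame q₁ L (u, g u)) '' Ioo (-ε) ε) :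
      Set (EuclideanSpace ℝ (Fin n))), ENNReal.ofReal (‖x‖ ^ p) ∂μHE[n - 1] =
      C * ENNReal.ofReal (∫ u in (-ε)..ε, √(1 + (g' u) ^ 2) *
        planeDensity n p (frame q₁ L (u, g u))) := by
  have hsub : Ioo (-ε) ε ⊆ Icc (-ε) ε := Ioo_subset_Icc_self
  have hgc : ContinuousOn g (Icc (-ε) ε) := fun u hu => (hg u hu).continuousAt.continuousWithinAt
  have hmk : Continuous fun a : ℝ => (!₂[1, a] : Plane) := by fun_prop
  have hd : ∀ u ∈ Icc (-ε) ε,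
      HasDerivAt (fun u => frame q₁ L (u, g u)) (L !₂[1, g' u]) u := by
    intro u hu
    have e : (fun u => frame q₁ L (u, g u)) =
        fun u => q₁ + (u • L !₂[1, 0] + g u • L !₂[0, 1]) := by
      funext u; exact frame_apply_add_smul q₁ L u (g u)
    rw [e]
    refine ((((hasDerivAt_id u).smul_const _).add ((hg u hu).smul_const _)).const_add
      q₁).congr_deriv
      ?_
    rw [one_smul, ← map_smul, ← map_add]
    congr 1
    ext i; fin_cases i <;> simp
  have hc' : ∀ u ∈ Ioo (-ε) ε, ContinuousAt (fun u => L !₂[1, g' u]) u := fun u hu =>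
    L.continuous.continuousAt.comp (hmk.continuousAt.comp
      (hg'.continuousAt (Icc_mem_nhds hu.1 hu.2)))
  have hnorm : ∀ a : ℝ, ‖L !₂[1, a]‖ = √(1 + a ^ 2) := by
    intro a
    rw [LinearIsometryEquiv.norm_map, EuclideanSpace.norm_eq]
    simp
  have h := lintegral_surface (n := n) (I := Ioo (-ε) ε) (c := fun u => frame q₁ L (u, g u))
    (c' := fun u => L !₂[1, g' u]) hn hC measurableSet_Ioo
    (g := fun q => ((frame q₁ L).symm q).1)
    (measurable_fst.comp (frame q₁ L).symm.continuous.measurable)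
    (fun u _ => by simp)
    (fun u hu => hasStrictDerivAt_of_hasDerivAt_of_continuousAt
      (by filter_upwards [Icc_mem_nhds hu.1 hu.2] with v hv using hd v hv) (hc' u hu))
    hc' (fun u _ h0 => by
      have := hnorm (g' u)
      rw [h0, norm_zero] at this
      have h1 : 0 < √(1 + (g' u) ^ 2) := by positivity
      linarith)
    (fun u hu => hpos u (hsub hu)) (φ := fun q => ENNReal.ofReal (‖q‖ ^ p)) (by fun_prop)
  refine ⟨h.1, ?_⟩
  have h2 := h.2
  simp only [norm_profile] at h2
  rw [h2]
  congr 1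
  rw [← lintegral_ofReal_Ioo (by linarith)]
  · refine setLIntegral_congr_fun measurableSet_Ioo fun u _ => ?_
    rw [← ENNReal.ofReal_mul (by positivity), areaDensity, planeDensity, hnorm]
    congr 1
    ring
  · refine ContinuousOn.mul (continuousOn_const.add (hg'.pow 2)).sqrt ?_
    exact ((continuous_planeDensity hp).comp (frame q₁ L).continuous).comp_continuousOn
      (continuousOn_id.prodMk hgc)
  · exact fun u hu => mul_nonneg (Real.sqrt_nonneg _) (planeDensity_pos (hpos u hu)).le

theorem continuousOn_integral_below {Ω : ℝ × ℝ → ℝ} (hΩ : Continuous Ω) {ε : ℝ} (η : ℝ)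
    {g : ℝ → ℝ} (hg : ContinuousOn g (Icc (-ε) ε)) :
    ContinuousOn (fun u => ∫ v in (-η)..(g u), Ω (u, v)) (Icc (-ε) ε) := by
  have h : Continuous fun z : ℝ × ℝ => ∫ v in (-η)..z.2, Ω (z.1, v) :=
    intervalIntegral.continuous_parametric_intervalIntegral_of_continuous
      (μ := volume) (f := fun (z : ℝ × ℝ) v => Ω (z.1, v)) (a₀ := -η) (s := fun z => z.2)
      (by fun_prop) (by fun_prop)
  exact h.comp_continuousOn (continuousOn_id.prodMk hg)

/-- The weighted volume of the region of revolution below a graph in a box. -/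
theorem weightedVolume_boxBelow (hp : 0 < p) {C : ℝ≥0}
    (hC : ∀ φ : Plane → ℝ≥0∞, Measurable φ →
      ∫⁻ x : EuclideanSpace ℝ (Fin n), φ (profile x) =
        C * ∫⁻ q : Plane in {q | 0 < q 1}, φ q * ENNReal.ofReal (q 1 ^ (n - 2)))
    (q₁ : Plane) (L : Plane ≃ₗᵢ[ℝ] Plane) {ε η : ℝ} (hε : 0 < ε) {g : ℝ → ℝ}
    (hg : ContinuousOn g (Icc (-ε) ε)) (hgη : ∀ u ∈ Icc (-ε) ε, |g u| < η)
    (hpos : ∀ u ∈ Icc (-ε) ε, ∀ v ∈ Icc (-η) η, 0 < frame q₁ L (u, v) 1) :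
    weightedVolume p {x : EuclideanSpace ℝ (Fin n) |
        (frame q₁ L).symm (profile x) ∈ boxBelow ε η g} =
      C * ENNReal.ofReal (∫ u in (-ε)..ε, ∫ v in (-η)..(g u),
        planeDensity n p (frame q₁ L (u, v))) := by
  have hΩ : Continuous fun z : ℝ × ℝ => planeDensity n p (frame q₁ L z) :=
    (continuous_planeDensity hp).comp (frame q₁ L).continuous
  have hm := (isOpen_boxBelow (η := η) hg).measurableSet
  rw [weightedVolume_preimage_frame hC q₁ L hm fun z hz =>
    hpos z.1 (Ioo_subset_Icc_self hz.1) z.2 (Ioo_subset_Icc_self hz.2.1)]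
  congr 1
  have hnn : ∀ u ∈ Icc (-ε) ε, ∀ v ∈ Icc (-η) (g u), 0 ≤ planeDensity n p (frame q₁ L (u, v)) :=
    fun u hu v hv => (planeDensity_pos
      (hpos u hu v ⟨hv.1, hv.2.trans (abs_lt.1 (hgη u hu)).2.le⟩)).le
  rw [← lintegral_ofReal_Ioo (by linarith)
    (continuousOn_integral_below hΩ η hg) fun u hu =>
      intervalIntegral.integral_nonneg (abs_lt.1 (hgη u hu)).1.le (hnn u hu),
    ← lintegral_indicator hm, Measure.volume_eq_prod, lintegral_prod _
    ((hΩ.measurable.ennreal_ofReal).indicator hm).aemeasurable,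
    ← lintegral_indicator measurableSet_Ioo]
  refine lintegral_congr fun u => ?_
  by_cases hu : u ∈ Ioo (-ε) ε
  · have hu' := Ioo_subset_Icc_self hu
    have hgu := abs_lt.1 (hgη u hu')
    rw [indicator_of_mem hu, ← lintegral_ofReal_Ioo
      (h := fun v => planeDensity n p (frame q₁ L (u, v))) hgu.1.le
      (hΩ.comp (by fun_prop : Continuous fun v : ℝ => (u, v))).continuousOn
      (hnn u hu'), ← lintegral_indicator measurableSet_Ioo]
    refine lintegral_congr fun v => ?_
    have : (u, v) ∈ boxBelow ε η g ↔ v ∈ Ioo (-η) (g u) :=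
      ⟨fun h => ⟨h.2.1.1, h.2.2⟩, fun h => ⟨hu, ⟨h.1, h.2.trans hgu.2⟩, h.2⟩⟩
    simp only [indicator, this]
  · rw [indicator_of_notMem hu]
    have : ∀ v, (u, v) ∉ boxBelow ε η g := fun v h => hu h.1
    simp [indicator, this]

theorem measurableSet_replaceBelow {E : Set (EuclideanSpace ℝ (Fin n))} (hE : MeasurableSet E)
    (Φ : ℝ × ℝ ≃ₜ Plane) {ε η : ℝ} {g : ℝ → ℝ} (hg : ContinuousOn g (Icc (-ε) ε)) :
    MeasurableSet (replaceBelow E Φ ε η g) :=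
  (hE.diff
    ((continuous_symm_profile Φ).measurable (measurableSet_Ioo.prod measurableSet_Ioo))).union
    ((continuous_symm_profile Φ).measurable (isOpen_boxBelow hg).measurableSet)

theorem weightedVolume_replaceBelow (E : Set (EuclideanSpace ℝ (Fin n))) (Φ : ℝ × ℝ ≃ₜ Plane)
    {ε η : ℝ} {g : ℝ → ℝ} (hg : ContinuousOn g (Icc (-ε) ε)) :
    weightedVolume p (replaceBelow E Φ ε η g) =
      weightedVolume p (E \ {x | Φ.symm (profile x) ∈ Ioo (-ε) ε ×ˢ Ioo (-η) η}) +
      weightedVolume p {x : EuclideanSpace ℝ (Fin n) | Φ.symm (profile x) ∈ boxBelow ε η g} := by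
  rw [weightedVolume, replaceBelow, lintegral_union]
  · rfl
  · exact (continuous_symm_profile Φ).measurable (isOpen_boxBelow hg).measurableSet
  · rw [disjoint_left]
    exact fun x hx hx' => hx.2 ⟨hx'.1, hx'.2.1⟩

theorem replaceBelow_self {E : Set (EuclideanSpace ℝ (Fin n))} {Φ : ℝ × ℝ ≃ₜ Plane}
    {ε η : ℝ} {f : ℝ → ℝ}
    (hE : ∀ x : EuclideanSpace ℝ (Fin n), Φ.symm (profile x) ∈ Ioo (-ε) ε ×ˢ Ioo (-η) η →
      (x ∈ E ↔ (Φ.symm (profile x)).2 < f (Φ.symm (profile x)).1)) :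
    replaceBelow E Φ ε η f = E := by
  ext x
  constructor
  · rintro (h | h)
    · exact h.1
    · exact (hE x ⟨h.1, h.2.1⟩).2 h.2.2
  · intro h
    by_cases hx : Φ.symm (profile x) ∈ Ioo (-ε) ε ×ˢ Ioo (-η) η
    · exact Or.inr ⟨hx.1, hx.2, (hE x hx).1 h⟩
    · exact Or.inl ⟨h, hx⟩

/-- `f` is a `C²` function on `[-ε, ε]` whose graph, drawn in the frame at `q₁`, is tangent to the
first axis at `q₁` and stays inside the rectangle `[-ε, ε] × [-η, η]`, which lies in the open upper
half-plane. -/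
structure IsGraphBox (q₁ : Plane) (L : Plane ≃ₗᵢ[ℝ] Plane) (ε η : ℝ) (f f' f'' : ℝ → ℝ) : Prop where
  pos : 0 < ε
  hasDerivAt : ∀ u ∈ Icc (-ε) ε, HasDerivAt f (f' u) u
  hasDerivAt_deriv : ∀ u ∈ Icc (-ε) ε, HasDerivAt f' (f'' u) u
  continuousOn : ContinuousOn f'' (Icc (-ε) ε)
  abs_lt : ∀ u ∈ Icc (-ε) ε, |f u| < η
  map_zero : f 0 = 0
  deriv_zero : f' 0 = 0
  above_axis : ∀ u ∈ Icc (-ε) ε, ∀ v ∈ Icc (-η) η, 0 < frame q₁ L (u, v) 1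

/-- **First variation.** Where the profile of an isoperimetric region is a subgraph, the generalized
mean curvature of the boundary, with respect to the outward normal `L (0, 1)`, is a positive
constant. -/
theorem IsIsoperimetric.exists_mean_curvature (hn : 2 ≤ n) (hp : 0 < p)
    {E : Set (EuclideanSpace ℝ (Fin n))} (hE : IsIsoperimetric p E) (hEo : IsOpen E)
    (hne : E.Nonempty) : ∃ Λ : ℝ, ∀ (q₁ : Plane) (L : Plane ≃ₗᵢ[ℝ] Plane) (ε η : ℝ)
      (f f' f'' : ℝ → ℝ), IsGraphBox q₁ L ε η f f' f'' →
      (∀ x : EuclideanSpace ℝ (Fin n),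
        (frame q₁ L).symm (profile x) ∈ Ioo (-ε) ε ×ˢ Ioo (-η) η →
        (x ∈ E ↔ ((frame q₁ L).symm (profile x)).2 < f ((frame q₁ L).symm (profile x)).1)) →
      0 < Λ ∧ -(f'' 0) + p * inner ℝ q₁ (L !₂[0, 1]) / ‖q₁‖ ^ 2 +
        (n - 2) * (L !₂[0, 1]) 1 / q₁ 1 = Λ := by
  obtain ⟨C, hC0, hC⟩ := exists_cylinder_const n hn
  obtain ⟨C', hC'0, hC'⟩ := exists_volume_const n hn
  set P := (weightedPerimeter p E).toReal with hPdef
  set V := (weightedVolume p E).toReal with hVdef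
  have hPtop : weightedPerimeter p E ≠ ⊤ := (hE.perimeter_lt_top hn hp hEo hne).ne
  have hV : 0 < V := ENNReal.toReal_pos (weightedVolume_pos hEo hne).ne' hE.volume_ne_top
  have hC0' : (0 : ℝ) < C := by exact_mod_cast hC0
  have hC'0' : (0 : ℝ) < C' := by exact_mod_cast hC'0
  set α : ℝ := ((n : ℝ) - 1 + p) / (n + p) with hα
  have hn2 : (2 : ℝ) ≤ n := by exact_mod_cast hn
  have hα0 : 0 < α := by
    have h1 : (0 : ℝ) < (n : ℝ) - 1 + p := by linarith
    have h2 : (0 : ℝ) < n + p := by linarith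
    positivity
  -- By dilation `E` minimizes `perimeter / volume ^ α` without any constraint, so that the Lagrange
  -- multiplier `α P / V` is explicit and the same for all frames.
  refine ⟨C' * (α * P / V) / C, ?_⟩
  intro q₁ L ε η f f' f'' ⟨hε, hf, hf', hf'', hfη, hf0, hf'0, hpos⟩ hbox
  have hεε : -ε ≤ ε := by linarith
  have hsub : Ioo (-ε) ε ⊆ Icc (-ε) ε := Ioo_subset_Icc_self
  have h0 : (0 : ℝ) ∈ Icc (-ε) ε := ⟨by linarith, hε.le⟩
  have hη : 0 < η := (abs_nonneg _).trans_lt (hfη 0 h0)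
  have hfc : ContinuousOn f (Icc (-ε) ε) := fun u hu => (hf u hu).continuousAt.continuousWithinAt
  have hf'c : ContinuousOn f' (Icc (-ε) ε) := fun u hu => (hf' u hu).continuousAt.continuousWithinAt
  have hposf : ∀ g : ℝ → ℝ, (∀ u ∈ Icc (-ε) ε, |g u| < η) →
      ∀ u ∈ Icc (-ε) ε, 0 < frame q₁ L (u, g u) 1 := fun g hg u hu =>
    hpos u hu _ (abs_le.1 (hg u hu).le)
  set Ω : ℝ × ℝ → ℝ := fun z => planeDensity n p (frame q₁ L z) with hΩdef
  have hΩ : Continuous Ω := (continuous_planeDensity hp).comp (frame q₁ L).continuous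
  set U : Set (EuclideanSpace ℝ (Fin n)) :=
    {x | (frame q₁ L).symm (profile x) ∈ Ioo (-ε) ε ×ˢ Ioo (-η) η} with hU
  set R : ℝ≥0∞ := ∫⁻ x in frontier E \ U, ENNReal.ofReal (‖x‖ ^ p) ∂μHE[n - 1] with hR
  set ℓ := ∫ u in (-ε)..ε, √(1 + (f' u) ^ 2) * Ω (u, f u) with hℓ
  have hgraphf := lintegral_graph hn hp hC q₁ L hε hf hf'c (hposf f hfη)
  have hlow : R + C * ENNReal.ofReal ℓ ≤ weightedPerimeter p E := by
    rw [hR, ← hgraphf.2, ← lintegral_union hgraphf.1]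
    · refine lintegral_mono_set (union_subset sdiff_subset ?_)
      exact graph_subset_frontier hEo hbox (fun u hu => hfη u (hsub hu))
        fun u hu => hposf f hfη u (hsub hu)
    · rw [disjoint_left]
      rintro x hx ⟨u, hu, hux⟩
      refine hx.2 ?_
      simp only [hU, mem_ofPred_eq, ← hux, Homeomorph.symm_apply_apply]
      exact ⟨hu, abs_lt.1 (hfη u (hsub hu))⟩
  have hℓpos : 0 < ℓ := by
    refine intervalIntegral.intervalIntegral_pos_of_pos_on ?_ (fun u hu => ?_) (by linarith)
    · refine ContinuousOn.intervalIntegrable ?_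
      rw [uIcc_of_le hεε]
      exact (continuousOn_const.add (hf'c.pow 2)).sqrt.mul
        (hΩ.comp_continuousOn (continuousOn_id.prodMk hfc))
    · have := planeDensity_pos (n := n) (p := p) (hposf f hfη u (hsub hu))
      have h2 : 0 < √(1 + (f' u) ^ 2) := by positivity
      positivity
  have hRtop : R ≠ ⊤ := fun h => by
    rw [h, top_add, top_le_iff] at hlow
    exact hPtop hlow
  have hlow' : R.toReal + C * ℓ ≤ P := by
    have := ENNReal.toReal_mono hPtop hlow
    rwa [ENNReal.toReal_add hRtop (by finiteness), ENNReal.toReal_mul,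
      ENNReal.toReal_ofReal hℓpos.le, ENNReal.coe_toReal] at this
  have hP : 0 < P := lt_of_lt_of_le (by positivity) hlow'
  set M : (ℝ → ℝ) → ℝ := fun g => ∫ u in (-ε)..ε, ∫ v in (-η)..(g u), Ω (u, v) with hM
  have hvol : ∀ g : ℝ → ℝ, ContinuousOn g (Icc (-ε) ε) → (∀ u ∈ Icc (-ε) ε, |g u| < η) →
      weightedVolume p (replaceBelow E (frame q₁ L) ε η g) =
        weightedVolume p (E \ U) + C' * ENNReal.ofReal (M g) := fun g hg hgη => by
    rw [weightedVolume_replaceBelow _ _ hg, weightedVolume_boxBelow hp hC' q₁ L hε hg hgη hpos]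
  have hMnn : ∀ g : ℝ → ℝ, (∀ u ∈ Icc (-ε) ε, |g u| < η) → 0 ≤ M g := by
    intro g hgη
    refine intervalIntegral.integral_nonneg hεε fun u hu => ?_
    have hgu := abs_lt.1 (hgη u hu)
    refine intervalIntegral.integral_nonneg hgu.1.le fun v hv => ?_
    exact (planeDensity_pos (hpos u hu v ⟨hv.1, hv.2.trans hgu.2.le⟩)).le
  have hEU : weightedVolume p (E \ U) ≠ ⊤ :=
    ((lintegral_mono_set sdiff_subset).trans_lt (lt_top_iff_ne_top.2 hE.volume_ne_top)).ne
  have hvol' : ∀ g : ℝ → ℝ, ContinuousOn g (Icc (-ε) ε) → (∀ u ∈ Icc (-ε) ε, |g u| < η) →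
      (weightedVolume p (replaceBelow E (frame q₁ L) ε η g)).toReal =
        (weightedVolume p (E \ U)).toReal + C' * M g := fun g hg hgη => by
    rw [hvol g hg hgη, ENNReal.toReal_add hEU (by finiteness), ENNReal.toReal_mul,
      ENNReal.toReal_ofReal (hMnn g hgη), ENNReal.coe_toReal]
  have hVf : V = (weightedVolume p (E \ U)).toReal + C' * M f := by
    rw [← hvol' f hfc hfη, replaceBelow_self hbox]
  obtain ⟨u₀, hu₀, hmax⟩ := isCompact_Icc.exists_isMaxOn (nonempty_Icc.2 hεε) hfc.abs
  have hgap : 0 < η - |f u₀| := by linarith [hfη u₀ hu₀]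
  have key := euler_lagrange_of_graph (P := P) (V := V) (C := C) (C' := C') (α := α) (η := η)
    hε hV hf hf' hf'' hfη hf'0 hΩ ?_ ?_
  · refine ⟨by positivity, ?_⟩
    have hz : frame q₁ L (0, 0) = q₁ := by rw [frame_apply_add_smul]; simp
    have hq : 0 < q₁ 1 := by
      have := hpos 0 h0 0 ⟨by linarith, hη.le⟩
      rwa [hz] at this
    have hd : fderiv ℝ Ω (0, 0) (0, 1) = fderiv ℝ (planeDensity n p) q₁ (L !₂[0, 1]) := by
      have h1 : HasDerivAt (fun v : ℝ => ((0 : ℝ), v)) (0, 1) 0 :=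
        (hasDerivAt_const _ _).prodMk (hasDerivAt_id _)
      have hΩd : DifferentiableAt ℝ Ω (0, 0) := by
        have h2 : DifferentiableAt ℝ (planeDensity n p) (frame q₁ L (0, 0)) := by
          rw [hz]
          exact (contDiffAt_planeDensity hq).differentiableAt (by simp)
        refine h2.comp (0, 0) ?_
        have : (frame q₁ L : ℝ × ℝ → Plane) =
            fun z => q₁ + (z.1 • L !₂[1, 0] + z.2 • L !₂[0, 1]) := by
          funext z; exact frame_apply_add_smul q₁ L z.1 z.2
        rw [this]
        fun_prop
      have h3 := hΩd.hasFDerivAt.comp_hasDerivAt (0 : ℝ) h1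
      have h4 : HasDerivAt (fun v : ℝ => q₁ + v • L !₂[0, 1]) (L !₂[0, 1]) 0 := by
        simpa using ((hasDerivAt_id (0 : ℝ)).smul_const (L !₂[0, 1])).const_add q₁
      have h5 := ((contDiffAt_planeDensity (n := n) (p := p) hq).differentiableAt
        (by simp)).hasFDerivAt.comp_hasDerivAt_of_eq (0 : ℝ) h4 (by simp)
      refine h3.unique (h5.congr_of_eventuallyEq (Eventually.of_forall fun v => ?_))
      simp only [hΩdef, Function.comp_apply, frame_apply_add_smul, zero_smul, zero_add]
    rw [hf0, hd, fderiv_planeDensity hn hq] at key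
    have hΩ0 : Ω (0, 0) = planeDensity n p q₁ := by rw [hΩdef]; simp only [hz]
    rw [hΩ0] at key
    have hw := planeDensity_pos (n := n) (p := p) hq
    rw [eq_div_iff hC0'.ne']
    refine mul_right_cancel₀ hw.ne' ?_
    rw [← key]
    ring
  · intro u hu v hv
    refine (contDiffAt_planeDensity (hpos u hu v (Ioo_subset_Icc_self hv))).comp (u, v) ?_
    have : (frame q₁ L : ℝ × ℝ → Plane) =
        fun z => q₁ + (z.1 • L !₂[1, 0] + z.2 • L !₂[0, 1]) := by
      funext z; exact frame_apply_add_smul q₁ L z.1 z.2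
    rw [this]
    fun_prop
  · intro φ hφ hφc hφs
    obtain ⟨B, hB⟩ := isCompact_Icc.exists_bound_of_continuousOn
      (hφ.continuous.continuousOn (s := Icc (-ε) ε))
    have hB0 : 0 ≤ B := (norm_nonneg _).trans (hB 0 h0)
    set m := (η + |f u₀|) / 2 with hm
    have hmη : m < η := by rw [hm]; linarith
    have hT : 0 < (η - |f u₀|) / 2 / (B + 1) := by positivity
    filter_upwards [Ioo_mem_nhds (neg_lt_zero.2 hT) hT] with t ht
    have ht' : |t| < (η - |f u₀|) / 2 / (B + 1) := abs_lt.2 ht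
    rw [lt_div_iff₀ (by positivity)] at ht'
    -- For small `t` the varied graph stays in the smaller box of height `m < η`.
    set g : ℝ → ℝ := fun u => f u + t * φ u with hg
    have hgm : ∀ u ∈ Icc (-ε) ε, |g u| ≤ m := by
      intro u hu
      have h3 : |f u| ≤ |f u₀| := hmax hu
      have h2 : |φ u| ≤ B := hB u hu
      calc |f u + t * φ u| ≤ |f u| + |t| * |φ u| := by
            rw [← abs_mul]; exact abs_add_le _ _
        _ ≤ |f u₀| + |t| * (B + 1) := by gcongr; linarith
        _ ≤ m := by rw [hm]; linarith
    have hgη : ∀ u ∈ Icc (-ε) ε, |g u| < η := fun u hu => (hgm u hu).trans_lt hmη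
    have hgc : ContinuousOn g (Icc (-ε) ε) :=
      hfc.add (continuousOn_const.mul hφ.continuous.continuousOn)
    have hgd : ∀ u ∈ Icc (-ε) ε, HasDerivAt g (f' u + t * deriv φ u) u := fun u hu =>
      (hf u hu).add (((hφ.differentiable (by simp) u).hasDerivAt).const_mul t)
    have hg'c : ContinuousOn (fun u => f' u + t * deriv φ u) (Icc (-ε) ε) :=
      hf'c.add (continuousOn_const.mul (hφ.continuous_deriv (by simp)).continuousOn)
    set Et := replaceBelow E (frame q₁ L) ε η g with hEt
    -- The competitor's boundary agrees with that of `E` outside the box.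
    set ℓt := ∫ u in (-ε)..ε, √(1 + (f' u + t * deriv φ u) ^ 2) * Ω (u, g u) with hℓt
    have hgraphg := lintegral_graph hn hp hC q₁ L hε hgd hg'c (hposf g hgη)
    have hup : weightedPerimeter p Et ≤ R + C * ENNReal.ofReal ℓt := by
      rw [hR, ← hgraphg.2]
      refine (lintegral_mono_set (frontier_replaceBelow_subset hbox hgc
        (K := tsupport φ ×ˢ Icc (-m) m) ((isClosed_tsupport φ).prod isClosed_Icc) ?_ ?_)).trans
        (lintegral_union_le _ _ _)
      · exact prod_mono hφs (Icc_subset_Ioo (by linarith) hmη)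
      · intro z hz hzK
        by_cases hz1 : z.1 ∈ tsupport φ
        · have hz2 : z.2 ∉ Icc (-m) m := fun h => hzK ⟨hz1, h⟩
          have hgz := abs_le.1 (hgm z.1 (hsub hz.1))
          have hfz : |f z.1| ≤ m := by
            have h3 : |f z.1| ≤ |f u₀| := hmax (hsub hz.1)
            rw [hm]; linarith
          have hfz' := abs_le.1 hfz
          rw [mem_Icc, not_and_or, not_le, not_le] at hz2
          rcases hz2 with h | h
          · exact ⟨fun _ => by linarith, fun _ => by linarith⟩
          · exact ⟨fun _ => by linarith, fun _ => by linarith⟩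
        · simp [hg, image_eq_zero_of_notMem_tsupport hz1]
    have hℓt0 : 0 ≤ ℓt := intervalIntegral.integral_nonneg hεε fun u hu =>
      mul_nonneg (Real.sqrt_nonneg _) (planeDensity_pos (hposf g hgη u hu)).le
    have hVt : (weightedVolume p Et).toReal =
        V + C' * ∫ u in (-ε)..ε, ∫ v in (f u)..(f u + t * φ u), Ω (u, v) := by
      rw [hEt, hvol' g hgc hgη, hVf, add_assoc, ← mul_add]
      congr 2
      have hint : ∀ u a b, IntervalIntegrable (fun v => Ω (u, v)) volume a b := fun u a b =>
        (by fun_prop : Continuous fun v => Ω (u, v)).intervalIntegrable _ _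
      have hII : ∀ {k : ℝ → ℝ}, ContinuousOn k (Icc (-ε) ε) →
          IntervalIntegrable k volume (-ε) ε :=
        fun hk => (hk.mono (by rw [uIcc_of_le hεε])).intervalIntegrable
      have h1 : ∀ u, ∫ v in (f u)..(f u + t * φ u), Ω (u, v) =
          (∫ v in (-η)..(g u), Ω (u, v)) - ∫ v in (-η)..(f u), Ω (u, v) := fun u =>
        (intervalIntegral.integral_interval_sub_left (hint u _ _) (hint u _ _)).symm
      simp only [h1]
      rw [intervalIntegral.integral_sub (hII (continuousOn_integral_below hΩ η hgc))
        (hII (continuousOn_integral_below hΩ η hfc))]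
      simp only [hM]
      ring
    have hV1 : weightedVolume p Et ≠ ⊤ := by
      rw [hEt, hvol g hgc hgη]
      finiteness
    have hV0 : weightedVolume p Et ≠ 0 := by
      have hz : ((0 : ℝ), (-η + g 0) / 2) ∈ boxBelow ε η g := by
        have := abs_lt.1 (hgη 0 h0)
        exact ⟨⟨by simpa using hε, hε⟩, by constructor <;> dsimp <;> linarith,
          by dsimp; linarith⟩
      set q := frame q₁ L ((0 : ℝ), (-η + g 0) / 2) with hq
      have hq1 : 0 < q 1 := hpos 0 h0 _ (Ioo_subset_Icc_self hz.2.1)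
      have hn1 : (⟨1, by omega⟩ : Fin n) ≠ 0 := fun h => by
        have := congrArg Fin.val h
        simp at this
      set x₀ : EuclideanSpace ℝ (Fin n) := EuclideanSpace.single ⟨1, by omega⟩ 1
      have hx₀ : 0 < profile x₀ 1 := by
        rw [profile_one, radialPart_eq_self (by simp [x₀, hn1.symm])]
        simp [x₀]
      have hopen : IsOpen {x : EuclideanSpace ℝ (Fin n) |
          (frame q₁ L).symm (profile x) ∈ boxBelow ε η g} :=
        (isOpen_boxBelow hgc).preimage (continuous_symm_profile _)
      have hne' : {x : EuclideanSpace ℝ (Fin n) |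
          (frame q₁ L).symm (profile x) ∈ boxBelow ε η g}.Nonempty := by
        refine ⟨liftProfile x₀ q, ?_⟩
        rw [mem_ofPred_eq, profile_liftProfile hx₀ hq1.le, hq, Homeomorph.symm_apply_apply]
        exact hz
      refine ((weightedVolume_pos (p := p) hopen hne').trans_le ?_).ne'
      exact lintegral_mono_set subset_union_right
    have hmeas : MeasurableSet Et := measurableSet_replaceBelow hE.measurableSet _ hgc
    have hfin := hE.perimeter_le_mul (by omega) hp hEo hne hmeas hV0 hV1
    have hfin2 := hfin.trans (mul_le_mul_right hup _)
    have hfin3 := ENNReal.toReal_mono (by finiteness) hfin2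
    rw [ENNReal.toReal_mul, ENNReal.toReal_ofReal (by positivity),
      ENNReal.toReal_add hRtop (by finiteness), ENNReal.toReal_mul,
      ENNReal.toReal_ofReal hℓt0, ENNReal.coe_toReal, hVt] at hfin3
    refine hfin3.trans (mul_le_mul_of_nonneg_left ?_ ?_)
    · change R.toReal + C * ℓt ≤ P + C * (ℓt - ℓ)
      linarith
    · rw [← hVt]
      positivity

end FirstVariation

/-! ### The generating set -/

section GeneratingSet

/-- A preconnected set that misses the boundary of `S` lies on one side of it. -/
theorem subset_or_subset_compl_of_notMem_frontier {X : Type*} [TopologicalSpace X] {S T : Set X}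
    (hT : IsPreconnected T) (h : ∀ x ∈ T, x ∉ frontier S) : T ⊆ S ∨ T ⊆ Sᶜ := by
  refine (hT.subset_or_subset isOpen_interior isClosed_closure.isOpen_compl
    (disjoint_left.2 fun x hx hx' => hx' (interior_subset_closure hx)) fun x hx => ?_).imp
    (fun h => h.trans interior_subset) fun h => h.trans (compl_subset_compl.2 subset_closure)
  by_contra hx'
  rw [mem_union, not_or, mem_compl_iff, not_not] at hx'
  exact h x hx ⟨hx'.2, hx'.1⟩

variable {n : ℕ} [NeZero n] {p : ℝ} {E : Set (EuclideanSpace ℝ (Fin n))}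

theorem IsSphericallySymmetric.mem_of_le (hE : IsSphericallySymmetric E)
    {x y : EuclideanSpace ℝ (Fin n)} (hx : x ∈ E) (hxy : ‖x‖ = ‖y‖) (h0 : x 0 ≤ y 0) : y ∈ E := by
  rcases (norm_nonneg x).eq_or_lt with hr | hr
  · rw [← hr] at hxy
    rwa [norm_eq_zero.1 hxy.symm, ← norm_eq_zero.1 hr.symm]
  obtain ⟨t, ht | ht⟩ := hE ‖x‖ hr
  · have h1 : x ∈ E ∩ Metric.sphere 0 ‖x‖ := ⟨hx, by simp⟩
    have h2 : y ∈ E ∩ Metric.sphere 0 ‖x‖ := by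
      rw [ht] at h1 ⊢
      exact ⟨by simp [hxy], h1.2.trans_le h0⟩
    exact h2.1
  · have h1 : x ∈ E ∩ Metric.sphere 0 ‖x‖ := ⟨hx, by simp⟩
    have h2 : y ∈ E ∩ Metric.sphere 0 ‖x‖ := by
      rw [ht] at h1 ⊢
      exact ⟨by simp [hxy], le_trans h1.2 h0⟩
    exact h2.1

theorem fin_one_ne_zero (hn : 2 ≤ n) : (1 : Fin n) ≠ 0 := by
  obtain ⟨m, rfl⟩ : ∃ m, n = m + 2 := ⟨n - 2, by omega⟩
  simp

theorem norm_single_add_single (hn : 2 ≤ n) (q : Plane) :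
    ‖(EuclideanSpace.single (0 : Fin n) (q 0) + EuclideanSpace.single (1 : Fin n) (q 1) :
      EuclideanSpace ℝ (Fin n))‖ = ‖q‖ := by
  rw [← sq_eq_sq₀ (norm_nonneg _) (norm_nonneg _), norm_single_add_sq
    (by simp [(fin_one_ne_zero hn).symm]), plane_norm_sq]
  simp

theorem single_add_single_zero (hn : 2 ≤ n) (a b : ℝ) :
    (EuclideanSpace.single (0 : Fin n) a + EuclideanSpace.single (1 : Fin n) b :
      EuclideanSpace ℝ (Fin n)) 0 = a :=
  single_add_apply_zero (by simp [(fin_one_ne_zero hn).symm]) a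

theorem isOpen_generatingSet (hE : IsOpen E) : IsOpen (generatingSet E) := by
  refine hE.preimage (f := fun q : Plane => (EuclideanSpace.single (0 : Fin n) (q 0) +
    EuclideanSpace.single (1 : Fin n) (q 1) : EuclideanSpace ℝ (Fin n))) ?_
  have : ∀ i : Fin n, ∀ j : Fin 2, Continuous fun q : Plane =>
      (EuclideanSpace.single i (q j) : EuclideanSpace ℝ (Fin n)) := by
    intro i j
    have : (fun q : Plane => (EuclideanSpace.single i (q j) : EuclideanSpace ℝ (Fin n))) =
        fun q : Plane => q j • (EuclideanSpace.single i (1 : ℝ)) := by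
      funext q
      ext k
      by_cases hk : k = i <;> simp [hk]
    rw [this]
    fun_prop
  exact (this 0 0).add (this 1 1)

/-- On each circle around the origin, membership in the generating set is preserved by moving to the
right. -/
theorem mem_generatingSet_of_le (hn : 2 ≤ n) (hE : IsSphericallySymmetric E) {q q' : Plane}
    (hq : q ∈ generatingSet E) (hqq : ‖q‖ = ‖q'‖) (h0 : q 0 ≤ q' 0) : q' ∈ generatingSet E := by
  refine hE.mem_of_le hq ?_ ?_
  · rw [norm_single_add_single hn, norm_single_add_single hn, hqq]
  · rwa [single_add_single_zero hn, single_add_single_zero hn]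

/-- A spherically symmetric set is the preimage of its generating set, so it is a set of
revolution. -/
theorem mem_iff_profile_mem (hn : 2 ≤ n) (hE : IsSphericallySymmetric E)
    (x : EuclideanSpace ℝ (Fin n)) : x ∈ E ↔ profile x ∈ generatingSet E := by
  have h1 : ‖x‖ = ‖(EuclideanSpace.single (0 : Fin n) (profile x 0) +
      EuclideanSpace.single (1 : Fin n) (profile x 1) : EuclideanSpace ℝ (Fin n))‖ := by
    rw [norm_single_add_single hn, norm_profile]
  have h2 : (EuclideanSpace.single (0 : Fin n) (profile x 0) +
      EuclideanSpace.single (1 : Fin n) (profile x 1) : EuclideanSpace ℝ (Fin n)) 0 = x 0 := by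
    rw [single_add_single_zero hn, profile_zero]
  exact ⟨fun h => hE.mem_of_le h h1 h2.ge, fun h => hE.mem_of_le h h1.symm h2.le⟩

theorem volume_halfSpace : volume {x : EuclideanSpace ℝ (Fin n) | 1 < x 0} = ⊤ := by
  have hu : (univ : Set (EuclideanSpace ℝ (Fin n))) =
      ⋃ k : ℕ, {x : EuclideanSpace ℝ (Fin n) | -(k : ℝ) < x 0} := by
    symm
    rw [eq_univ_iff_forall]
    intro x
    obtain ⟨k, hk⟩ := exists_nat_gt (-(x 0))
    exact mem_iUnion.2 ⟨k, by rw [mem_ofPred_eq]; linarith⟩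
  have hmono : Monotone fun k : ℕ => {x : EuclideanSpace ℝ (Fin n) | -(k : ℝ) < x 0} := by
    intro k l hkl x hx
    have : (k : ℝ) ≤ l := by exact_mod_cast hkl
    simp only [mem_ofPred_eq] at hx ⊢
    linarith
  have hk : ∀ k : ℕ, volume {x : EuclideanSpace ℝ (Fin n) | -(k : ℝ) < x 0} =
      volume {x : EuclideanSpace ℝ (Fin n) | 1 < x 0} := by
    intro k
    rw [← measure_preimage_add volume (EuclideanSpace.single (0 : Fin n) ((k : ℝ) + 1))
      {x : EuclideanSpace ℝ (Fin n) | 1 < x 0}]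
    congr 1
    ext x
    simp only [mem_preimage, mem_ofPred_eq, PiLp.add_apply, PiLp.single_apply, if_true]
    constructor <;> intro h <;> linarith
  have := hmono.measure_iUnion (μ := volume)
  rw [← hu] at this
  simp only [hk, ciSup_const] at this
  rw [← this]
  exact measure_univ_of_isAddLeftInvariant _

/-- A point of the generating set outside the unit disc could be rotated to the right of
all boundary points, but the half-plane `{x > 1}` misses the boundary and is too large to belong to
the generating set. -/
theorem generatingSet_subset_closedBall (hn : 2 ≤ n) (hp : 0 < p) (hE : IsSphericallySymmetric E)
    (hvol : weightedVolume p E ≠ ⊤) (hr : ∀ q ∈ frontier (generatingSet E), q 0 ≤ 1) :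
    generatingSet E ⊆ Metric.closedBall 0 1 := by
  intro q hq
  by_contra hq1
  rw [mem_closedBall_zero_iff, not_le] at hq1
  have hq' : (!₂[‖q‖, 0] : Plane) ∈ generatingSet E := by
    refine mem_generatingSet_of_le hn hE hq ?_ ?_
    · rw [← sq_eq_sq₀ (norm_nonneg _) (norm_nonneg _), plane_norm_sq !₂[‖q‖, 0]]
      simp
    · have := plane_norm_sq q
      simp only [Matrix.cons_val_zero]
      exact le_of_sq_le_sq (by nlinarith [sq_nonneg (q 1)]) (norm_nonneg _)
  have hconv : Convex ℝ {q : Plane | 1 < q 0} :=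
    convex_halfSpace_gt (f := fun q : Plane => q 0) ⟨fun _ _ => rfl, fun _ _ => rfl⟩ 1
  have hsub : {q : Plane | 1 < q 0} ⊆ generatingSet E := by
    refine (subset_or_subset_compl_of_notMem_frontier (T := {q : Plane | 1 < q 0})
      hconv.isPreconnected fun z hz hz' => absurd (hr z hz') (not_le.2 hz)).resolve_right
      fun h => ?_
    exact h (show (!₂[‖q‖, 0] : Plane) ∈ _ by simpa using hq1) hq'
  apply hvol
  rw [eq_top_iff, ← volume_halfSpace (n := n)]
  have hm : MeasurableSet {x : EuclideanSpace ℝ (Fin n) | 1 < x 0} :=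
    measurableSet_lt measurable_const (by fun_prop)
  calc volume {x : EuclideanSpace ℝ (Fin n) | 1 < x 0}
      = ∫⁻ x in {x : EuclideanSpace ℝ (Fin n) | 1 < x 0}, 1 := by simp
    _ ≤ ∫⁻ x in {x : EuclideanSpace ℝ (Fin n) | 1 < x 0}, ENNReal.ofReal (‖x‖ ^ p) := by
      refine setLIntegral_mono' hm fun x hx => ?_
      rw [← ENNReal.ofReal_one]
      refine ENNReal.ofReal_le_ofReal (Real.one_le_rpow ?_ hp.le)
      have h1 : (1 : ℝ) < x 0 := hx
      have := norm_sq_eq x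
      nlinarith [norm_nonneg x, sq_nonneg ‖radialPart x‖]
    _ ≤ weightedVolume p E := by
      refine lintegral_mono_set fun x hx => ?_
      rw [mem_iff_profile_mem hn hE]
      refine hsub ?_
      simp only [mem_ofPred_eq, profile_zero]
      exact hx

end GeneratingSet

/-! ### The generating curve as a graph -/

section LocalGraph

/-- A plane curve `(U, V)` with horizontal tangent at the origin is locally the graph of a function
`f`; the function `g` recovers the parameter of the curve from the abscissa. -/
theorem exists_graph_of_curve {U V : ℝ → ℝ} {s₁ : ℝ} (hU : ContDiffAt ℝ 2 U s₁)
    (hV : ContDiffAt ℝ 2 V s₁) (hU0 : U s₁ = 0) (hV0 : V s₁ = 0) (hU1 : deriv U s₁ = 1)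
    (hV1 : deriv V s₁ = 0) : ∃ f g : ℝ → ℝ, ContDiffAt ℝ 2 f 0 ∧ f 0 = 0 ∧ deriv f 0 = 0 ∧
      deriv (deriv f) 0 = deriv (deriv V) s₁ ∧ Tendsto g (𝓝 0) (𝓝 s₁) ∧
      (∀ᶠ u in 𝓝 0, U (g u) = u ∧ V (g u) = f u) ∧ ∀ᶠ s in 𝓝 s₁, V s = f (U s) := by
  have hUd : HasDerivAt U 1 s₁ := by
    have := (hU.differentiableAt (by simp)).hasDerivAt
    rwa [hU1] at this
  have hUf : HasFDerivAt U ((ContinuousLinearEquiv.refl ℝ ℝ : ℝ ≃L[ℝ] ℝ) : ℝ →L[ℝ] ℝ) s₁ := by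
    refine hUd.hasFDerivAt.congr_fderiv ?_
    ext
    simp
  have hUs := hU.hasStrictFDerivAt' hUf (by simp)
  set g := hU.localInverse hUf (by simp) with hg
  have hgC : ContDiffAt ℝ 2 g 0 := by
    have := hU.to_localInverse hUf (by simp)
    rwa [hU0] at this
  have hg0 : g 0 = s₁ := by
    have := hU.localInverse_apply_image hUf (by simp)
    rwa [hU0] at this
  have hright : ∀ᶠ u in 𝓝 0, U (g u) = u := by
    have := hUs.eventually_right_inverse
    rwa [hU0] at this
  have hleft : ∀ᶠ s in 𝓝 s₁, g (U s) = s := hUs.eventually_left_inverse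
  have hfC : ContDiffAt ℝ 2 (V ∘ g) 0 := ContDiffAt.comp 0 (by rwa [hg0]) hgC
  have hVf : ∀ᶠ s in 𝓝 s₁, V s = (V ∘ g) (U s) := by
    filter_upwards [hleft] with s hs
    rw [Function.comp_apply, hs]
  have hUc : Tendsto U (𝓝 s₁) (𝓝 0) := by
    have := hU.continuousAt.tendsto
    rwa [hU0] at this
  have hfd : ∀ᶠ u in 𝓝 0, DifferentiableAt ℝ (V ∘ g) u :=
    (hfC.eventually (by simp)).mono fun u hu => hu.differentiableAt (by simp)
  have hUdiff : ∀ᶠ s in 𝓝 s₁, DifferentiableAt ℝ U s :=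
    (hU.eventually (by simp)).mono fun u hu => hu.differentiableAt (by simp)
  have hderiv : deriv V =ᶠ[𝓝 s₁] fun s => deriv (V ∘ g) (U s) * deriv U s := by
    filter_upwards [hVf.eventually_nhds, hUc.eventually hfd, hUdiff] with s h1 h2 h3
    have h4 : V =ᶠ[𝓝 s] (V ∘ g) ∘ U := h1
    rw [h4.deriv_eq]
    exact deriv_comp s h2 h3
  have hf1 : deriv (V ∘ g) 0 = 0 := by
    have := hderiv.eq_of_nhds
    rw [hU0, hU1, hV1, mul_one] at this
    exact this.symm
  have hf'd : HasDerivAt (deriv (V ∘ g)) (deriv (deriv (V ∘ g)) 0) (U s₁) := by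
    rw [hU0]
    exact ((hfC.derivWithin (m := 1) one_add_one_eq_two.le).differentiableAt (by simp)).hasDerivAt
  have hU'd : HasDerivAt (deriv U) (deriv (deriv U) s₁) s₁ :=
    ((hU.derivWithin (m := 1) one_add_one_eq_two.le).differentiableAt (by simp)).hasDerivAt
  refine ⟨V ∘ g, g, hfC, by simp [hg0, hV0], hf1, ?_, ?_, ?_, hVf⟩
  · have h : HasDerivAt (fun s => deriv (V ∘ g) (U s) * deriv U s)
        (deriv (deriv (V ∘ g)) 0 * 1 * deriv U s₁ + deriv (V ∘ g) (U s₁) * deriv (deriv U) s₁) s₁ :=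
      (hf'd.comp s₁ hUd).mul hU'd
    rw [hderiv.deriv_eq, h.deriv]
    simp [hU1, hU0, hf1]
  · have := hgC.continuousAt.tendsto
    rwa [hg0] at this
  · filter_upwards [hright] with u hu using ⟨hu, rfl⟩

theorem frame_symm_apply (q₁ : Plane) (L : Plane ≃ₗᵢ[ℝ] Plane) (q : Plane) :
    (frame q₁ L).symm q = (inner ℝ (L !₂[1, 0]) (q - q₁), inner ℝ (L !₂[0, 1]) (q - q₁)) := by
  have h : ∀ a : Plane, inner ℝ (L a) (q - q₁) = inner ℝ a (L.symm (q - q₁)) := fun a => by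
    rw [← L.inner_map_map a, LinearIsometryEquiv.apply_symm_apply]
  rw [h, h]
  change (L.symm (q - q₁) 0, L.symm (q - q₁) 1) = _
  simp [PiLp.inner_apply, Fin.sum_univ_two]

theorem isPreconnected_between {s : Set ℝ} (hs : Convex ℝ s) {a b : ℝ → ℝ} (ha : ContinuousOn a s)
    (hb : ContinuousOn b s) (hab : ∀ u ∈ s, a u < b u) :
    IsPreconnected {z : ℝ × ℝ | z.1 ∈ s ∧ a z.1 < z.2 ∧ z.2 < b z.1} := by
  have h1 : IsPreconnected (s ×ˢ Ioo (0 : ℝ) 1) := (hs.prod (convex_Ioo 0 1)).isPreconnected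
  have h2 : ContinuousOn (fun z : ℝ × ℝ => (z.1, a z.1 + z.2 * (b z.1 - a z.1)))
      (s ×ˢ Ioo (0 : ℝ) 1) := by
    have h3 : ContinuousOn (fun z : ℝ × ℝ => a z.1) (s ×ˢ Ioo (0 : ℝ) 1) :=
      ha.comp continuousOn_fst fun z hz => hz.1
    have h4 : ContinuousOn (fun z : ℝ × ℝ => b z.1) (s ×ˢ Ioo (0 : ℝ) 1) :=
      hb.comp continuousOn_fst fun z hz => hz.1
    exact continuousOn_fst.prodMk (h3.add (continuousOn_snd.mul (h4.sub h3)))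
  convert h1.image _ h2 using 1
  ext ⟨u, v⟩
  simp only [mem_ofPred_eq, mem_image, mem_prod, Prod.mk.injEq, Prod.exists]
  constructor
  · rintro ⟨hu, h3, h4⟩
    have hd : 0 < b u - a u := sub_pos.2 (hab u hu)
    refine ⟨u, (v - a u) / (b u - a u), ⟨hu, div_pos (by linarith) hd, ?_⟩, rfl, ?_⟩
    · rw [div_lt_one hd]; linarith
    · field_simp; ring
  · rintro ⟨u', t, ⟨hu, ht0, ht1⟩, rfl, rfl⟩
    have hd : 0 < b u' - a u' := sub_pos.2 (hab u' hu)
    exact ⟨hu, by nlinarith, by nlinarith⟩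

variable {A : Set Plane} {β : ℝ} {γ : ℝ → Plane}

theorem IsGeneratingCurve.contDiffAt (hγ : IsGeneratingCurve A β γ) {s : ℝ}
    (hs : s ∈ Ioo (-β) β) : ContDiffAt ℝ ∞ γ s :=
  (hγ.contDiffOn s hs).contDiffAt (Ioo_mem_nhds hs.1 hs.2)

/-- Near `γ s₁`, the boundary is the part of the curve with parameter near `s₁`. -/
theorem IsGeneratingCurve.eventually_mem_image (hγ : IsGeneratingCurve A β γ) {s₁ : ℝ}
    (hs₁ : s₁ ∈ Ioo 0 β) {N : Set ℝ} (hN : N ∈ 𝓝 s₁) :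
    ∀ᶠ q in 𝓝 (γ s₁), q ∈ frontier A → q ∈ γ '' N := by
  have hs₁' : s₁ ∈ Ioo (-β) β := ⟨by linarith [hs₁.1, hγ.pos], hs₁.2⟩
  have hK : IsCompact (Icc (-β) β \ interior N) := isCompact_Icc.diff isOpen_interior
  have hKc : IsClosed (γ '' (Icc (-β) β \ interior N)) :=
    (hK.image_of_continuousOn (hγ.continuousOn.mono sdiff_subset)).isClosed
  have hnot : γ s₁ ∉ γ '' (Icc (-β) β \ interior N) := by
    rintro ⟨s, ⟨hs, hsN⟩, hss⟩
    rcases hs.2.eq_or_lt with h | h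
    · have h1 := hγ.above_axis s₁ hs₁
      rw [← hss, h, hγ.end_on_axis] at h1
      exact lt_irrefl _ h1
    · have : s = s₁ := hγ.injOn ⟨hs.1, h⟩ ⟨hs₁'.1.le, hs₁'.2⟩ hss
      rw [this] at hsN
      exact hsN (mem_interior_iff_mem_nhds.2 hN)
  filter_upwards [hγ.follows_frontier s₁ hs₁', hKc.isOpen_compl.mem_nhds hnot] with q h1 h2 h3
  obtain ⟨s, hs, rfl⟩ := h1 h3
  refine ⟨s, ?_, rfl⟩
  by_contra hsN
  exact h2 ⟨s, ⟨Ioo_subset_Icc_self hs, fun h => hsN (interior_subset h)⟩, rfl⟩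

/-- In a frame with first axis tangent to the generating curve at `γ s₁`, the boundary is
near `γ s₁` the graph of a function. -/
theorem IsGeneratingCurve.exists_local_graph (hγ : IsGeneratingCurve A β γ) {s₁ : ℝ}
    (hs₁ : s₁ ∈ Ioo 0 β) (L : Plane ≃ₗᵢ[ℝ] Plane) (hL : L !₂[1, 0] = deriv γ s₁) :
    ∃ (ε η : ℝ) (f f' f'' : ℝ → ℝ), IsGraphBox (γ s₁) L ε η f f' f'' ∧
      f'' 0 = inner ℝ (L !₂[0, 1]) (deriv (deriv γ) s₁) ∧
      ∀ z ∈ Ioo (-ε) ε ×ˢ Ioo (-η) η, frame (γ s₁) L z ∈ frontier A ↔ z.2 = f z.1 := by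
  have hs₁' : s₁ ∈ Ioo (-β) β := ⟨by linarith [hs₁.1, hγ.pos], hs₁.2⟩
  have hγC := hγ.contDiffAt hs₁'
  have hγd : ∀ᶠ s in 𝓝 s₁, HasDerivAt γ (deriv γ s) s := by
    filter_upwards [Ioo_mem_nhds hs₁'.1 hs₁'.2] with s hs
    exact ((hγ.contDiffAt hs).differentiableAt (by simp)).hasDerivAt
  have hγ'd : HasDerivAt (deriv γ) (deriv (deriv γ) s₁) s₁ := by
    have h2 : ContDiffAt ℝ 2 γ s₁ := hγC.of_le (by norm_cast)
    exact ((h2.derivWithin (m := 1) one_add_one_eq_two.le).differentiableAt (by simp)).hasDerivAt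
  have hcoord : ∀ a : Plane, ∀ᶠ s in 𝓝 s₁,
      HasDerivAt (fun s => inner ℝ a (γ s - γ s₁)) (inner ℝ a (deriv γ s)) s := by
    intro a
    filter_upwards [hγd] with s hs
    simpa using (hasDerivAt_const s a).inner ℝ (hs.sub_const (γ s₁))
  have hcoordC : ∀ a : Plane, ContDiffAt ℝ 2 (fun s => inner ℝ a (γ s - γ s₁)) s₁ := fun a =>
    contDiffAt_const.inner ℝ ((hγC.of_le (by norm_cast)).sub contDiffAt_const)
  have hLL : ∀ a b : Plane, inner ℝ (L a) (L b) = inner ℝ a b := L.inner_map_map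
  obtain ⟨f, g, hfC, hf0, hf1, hf2, hgt, hgU, hVf⟩ := exists_graph_of_curve
    (hcoordC (L !₂[1, 0])) (hcoordC (L !₂[0, 1])) (by simp) (by simp)
    (by rw [(hcoord _).self_of_nhds.deriv, ← hL, hLL, PiLp.inner_apply]; simp)
    (by rw [(hcoord _).self_of_nhds.deriv, ← hL, hLL, PiLp.inner_apply]; simp)
  have hf2' : deriv (deriv f) 0 = inner ℝ (L !₂[0, 1]) (deriv (deriv γ) s₁) := by
    rw [hf2]
    have : deriv (fun s => inner ℝ (L !₂[0, 1]) (γ s - γ s₁)) =ᶠ[𝓝 s₁]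
        fun s => inner ℝ (L !₂[0, 1]) (deriv γ s) := (hcoord _).mono fun s hs => hs.deriv
    rw [this.deriv_eq]
    have h := (hasDerivAt_const s₁ (L !₂[0, 1])).inner ℝ hγ'd
    rw [h.deriv]
    simp
  have hz0 : frame (γ s₁) L (0, 0) = γ s₁ := by rw [frame_apply_add_smul]; simp
  have hΦ : Tendsto (frame (γ s₁) L) (𝓝 (0, 0)) (𝓝 (γ s₁)) := by
    have := (frame (γ s₁) L).continuous.tendsto (0, 0)
    rwa [hz0] at this
  -- the boundary lies on the graph
  have h1 : ∀ᶠ z in 𝓝 ((0 : ℝ), (0 : ℝ)), frame (γ s₁) L z ∈ frontier A → z.2 = f z.1 := by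
    filter_upwards [hΦ.eventually (hγ.eventually_mem_image hs₁ hVf)] with z hz hzA
    obtain ⟨s, hs, hsz⟩ := hz hzA
    have h2 : z = (frame (γ s₁) L).symm (γ s) := by rw [hsz, Homeomorph.symm_apply_apply]
    rw [frame_symm_apply] at h2
    rw [h2]
    exact hs
  -- the graph consists of boundary points
  have h2 : ∀ᶠ u in 𝓝 (0 : ℝ), frame (γ s₁) L (u, f u) ∈ frontier A := by
    filter_upwards [hgU, hgt.eventually (Ioo_mem_nhds hs₁'.1 hs₁'.2)] with u hu hgu
    have h3 : (frame (γ s₁) L).symm (γ (g u)) = (u, f u) := by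
      rw [frame_symm_apply, hu.1, hu.2]
    rw [← h3, Homeomorph.apply_symm_apply]
    exact hγ.mem_frontier _ (Ioo_subset_Icc_self hgu)
  have h3 : ∀ᶠ z in 𝓝 ((0 : ℝ), (0 : ℝ)), 0 < frame (γ s₁) L z 1 := by
    have hc : Tendsto (fun q : Plane => q 1) (𝓝 (γ s₁)) (𝓝 (γ s₁ 1)) :=
      (by fun_prop : Continuous fun q : Plane => q 1).tendsto _
    exact (hc.comp hΦ).eventually_const_lt (hγ.above_axis s₁ hs₁)
  have h4 : ∀ᶠ u in 𝓝 (0 : ℝ), ContDiffAt ℝ 2 f u := hfC.eventually (by simp)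
  obtain ⟨η, hη, hηb⟩ : ∃ η > 0, ∀ z : ℝ × ℝ, |z.1| ≤ η → |z.2| ≤ η →
      (frame (γ s₁) L z ∈ frontier A → z.2 = f z.1) ∧ 0 < frame (γ s₁) L z 1 := by
    obtain ⟨r, hr, h⟩ := Metric.eventually_nhds_iff.1 (h1.and h3)
    refine ⟨r / 2, by positivity, fun z hz1 hz2 => h ?_⟩
    rw [Prod.dist_eq]
    simp only [Real.dist_eq, sub_zero]
    exact max_lt (by linarith) (by linarith)
  have hfc : Tendsto f (𝓝 0) (𝓝 0) := by
    have := hfC.continuousAt.tendsto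
    rwa [hf0] at this
  have h5 : ∀ᶠ u in 𝓝 (0 : ℝ), |f u| < η := by
    have := hfc.abs
    rw [abs_zero] at this
    exact this.eventually_lt_const hη
  obtain ⟨r, hr, hrb⟩ := Metric.eventually_nhds_iff.1 (h2.and (h4.and h5))
  have hmem : ∀ u ∈ Icc (-(min η (r / 2))) (min η (r / 2)), |u| ≤ η ∧ dist u 0 < r := by
    intro u hu
    have := abs_le.2 hu
    rw [Real.dist_eq, sub_zero]
    exact ⟨this.trans (min_le_left _ _), this.trans_lt ((min_le_right _ _).trans_lt (by linarith))⟩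
  refine ⟨min η (r / 2), η, f, deriv f, deriv (deriv f),
    ⟨lt_min hη (by positivity), ?_, ?_, ?_, ?_, hf0, hf1, ?_⟩, hf2', ?_⟩
  · exact fun u hu => ((hrb (hmem u hu).2).2.1.differentiableAt (by simp)).hasDerivAt
  · exact fun u hu =>
      (((hrb (hmem u hu).2).2.1.derivWithin (m := 1) one_add_one_eq_two.le).differentiableAt
        (by simp)).hasDerivAt
  · exact fun u hu =>
      (((hrb (hmem u hu).2).2.1.derivWithin (m := 1) one_add_one_eq_two.le).derivWithin (m := 0)
        (by simp)).continuousAt.continuousWithinAt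
  · exact fun u hu => (hrb (hmem u hu).2).2.2
  · exact fun u hu v hv => (hηb (u, v) (hmem u hu).1 (abs_le.2 hv)).2
  · rintro ⟨u, v⟩ ⟨hu, hv⟩
    have hu' := hmem u (Ioo_subset_Icc_self hu)
    refine ⟨(hηb (u, v) hu'.1 (abs_lt.2 hv).le).1, fun h => ?_⟩
    simp only at h
    rw [h]
    exact (hrb hu'.2).1

end LocalGraph

/-! ### Constancy of the generalized mean curvature along the generating curve -/

section Dichotomy

theorem exists_linearIsometryEquiv {τ e : Plane} (hτ : ‖τ‖ = 1) (he : ‖e‖ = 1)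
    (h : inner ℝ τ e = 0) : ∃ L : Plane ≃ₗᵢ[ℝ] Plane, L !₂[1, 0] = τ ∧ L !₂[0, 1] = e := by
  let T : Plane →ₗ[ℝ] Plane :=
    { toFun := fun q => q 0 • τ + q 1 • e
      map_add' := fun q q' => by simp only [PiLp.add_apply, add_smul]; abel
      map_smul' := fun a q => by simp [mul_smul] }
  have hT : ∀ q, ‖T q‖ = ‖q‖ := by
    intro q
    rw [← sq_eq_sq₀ (norm_nonneg _) (norm_nonneg _)]
    change ‖q 0 • τ + q 1 • e‖ ^ 2 = _
    rw [norm_add_sq_real, norm_smul, norm_smul, hτ, he, inner_smul_left, inner_smul_right, h,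
      plane_norm_sq]
    simp
  refine ⟨LinearIsometry.toLinearIsometryEquiv ⟨T, hT⟩ rfl, ?_, ?_⟩
  · change T !₂[1, 0] = τ
    simp [T]
  · change T !₂[0, 1] = e
    simp [T]

/-- The point `q` rotated counterclockwise about the origin by the angle `θ`. -/
def rotatePoint (q : Plane) (θ : ℝ) : Plane :=
  !₂[Real.cos θ * q 0 - Real.sin θ * q 1, Real.sin θ * q 0 + Real.cos θ * q 1]

theorem rotatePoint_zero (q : Plane) : rotatePoint q 0 = q := by
  ext i; fin_cases i <;> simp [rotatePoint]

theorem norm_rotatePoint (q : Plane) (θ : ℝ) : ‖rotatePoint q θ‖ = ‖q‖ := by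
  rw [← sq_eq_sq₀ (norm_nonneg _) (norm_nonneg _), plane_norm_sq, plane_norm_sq]
  simp only [rotatePoint, Matrix.cons_val_zero, Matrix.cons_val_one]
  linear_combination (q 0 ^ 2 + q 1 ^ 2) * Real.sin_sq_add_cos_sq θ

theorem hasDerivAt_inner_rotatePoint (q a b : Plane) :
    HasDerivAt (fun θ => inner ℝ a (rotatePoint q θ - b)) (inner ℝ a !₂[-(q 1), q 0]) 0 := by
  have h0 : HasDerivAt (fun θ : ℝ => a 0 * (Real.cos θ * q 0 - Real.sin θ * q 1 - b 0) +
      a 1 * (Real.sin θ * q 0 + Real.cos θ * q 1 - b 1)) (a 0 * -(q 1) + a 1 * q 0) 0 := by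
    have hc := Real.hasDerivAt_cos 0
    have hs := Real.hasDerivAt_sin 0
    refine (((((hc.mul_const (q 0)).sub (hs.mul_const (q 1))).sub_const (b 0)).const_mul (a 0)).add
      ((((hs.mul_const (q 0)).add (hc.mul_const (q 1))).sub_const (b 1)).const_mul
        (a 1))).congr_deriv ?_
    simp
  have e1 : (fun θ => inner ℝ a (rotatePoint q θ - b)) =
      fun θ : ℝ => a 0 * (Real.cos θ * q 0 - Real.sin θ * q 1 - b 0) +
      a 1 * (Real.sin θ * q 0 + Real.cos θ * q 1 - b 1) := by
    funext θ
    simp only [PiLp.inner_apply, Fin.sum_univ_two, rotatePoint, PiLp.sub_apply,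
      Matrix.cons_val_zero, Matrix.cons_val_one, RCLike.inner_apply, conj_trivial]
    ring
  have e2 : inner ℝ a !₂[-(q 1), q 0] = a 0 * -(q 1) + a 1 * q 0 := by
    simp only [PiLp.inner_apply, Fin.sum_univ_two,
      Matrix.cons_val_zero, Matrix.cons_val_one, RCLike.inner_apply, conj_trivial]
    ring
  rw [e1, e2]
  exact h0

theorem continuous_rotatePoint (q : Plane) : Continuous (rotatePoint q) := by
  unfold rotatePoint
  fun_prop

variable {n : ℕ} [NeZero n] {p : ℝ} {E : Set (EuclideanSpace ℝ (Fin n))}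

theorem deriv_nonneg_of_eventually {h : ℝ → ℝ} {d : ℝ} (hd : HasDerivAt h d 0) (h0 : h 0 = 0)
    (hev : ∀ᶠ θ in 𝓝[>] (0 : ℝ), 0 ≤ h θ) : 0 ≤ d := by
  have h1 := (hasDerivAt_iff_tendsto_slope.1 hd).mono_left
    (show 𝓝[>] (0 : ℝ) ≤ 𝓝[≠] 0 from
    nhdsWithin_mono 0 fun x (hx : 0 < x) => hx.ne')
  refine ge_of_tendsto h1 ?_
  filter_upwards [hev, self_mem_nhdsWithin] with θ h2 (h3 : 0 < θ)
  rw [slope_def_field, h0, sub_zero, sub_zero]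
  positivity

/-- A point of the upper half-plane outside the generating set stays outside when rotated away
from the positive axis. -/
theorem eventually_rotatePoint_notMem (hn : 2 ≤ n) (hE : IsSphericallySymmetric E) {q : Plane}
    (hq : 0 < q 1) (hqE : q ∉ generatingSet E) :
    ∀ᶠ θ in 𝓝[>] (0 : ℝ), rotatePoint q θ ∉ generatingSet E := by
  have h1 : ∀ᶠ θ in 𝓝[>] (0 : ℝ), rotatePoint q θ 0 ≤ q 0 := by
    have hd := (hasDerivAt_inner_rotatePoint q !₂[1, 0] 0).tendsto_slope.mono_left
      (show 𝓝[>] (0 : ℝ) ≤ 𝓝[≠] 0 from nhdsWithin_mono 0 fun x (hx : 0 < x) => hx.ne')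
    have h2 : inner ℝ (!₂[1, 0] : Plane) !₂[-(q 1), q 0] < 0 := by
      simpa [PiLp.inner_apply, Fin.sum_univ_two] using hq
    filter_upwards [hd.eventually_lt_const h2, self_mem_nhdsWithin] with θ h3 (h4 : 0 < θ)
    rw [slope_def_field, sub_zero θ, div_neg_iff] at h3
    have h5 : inner ℝ !₂[1, 0] (rotatePoint q θ - 0) - inner ℝ !₂[1, 0] (rotatePoint q 0 - 0) < 0 :=
      (h3.resolve_left fun h => absurd h.2 (not_lt.2 h4.le)).1
    rw [rotatePoint_zero] at h5
    simp [PiLp.inner_apply, Fin.sum_univ_two] at h5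
    exact h5.le
  filter_upwards [h1] with θ hθ hmem
  exact hqE (mem_generatingSet_of_le hn hE hmem (norm_rotatePoint q θ) hθ)

/-- The height of the rotated point above the graph. -/
theorem IsGraphBox.hasDerivAt_height {q₁ : Plane} {L : Plane ≃ₗᵢ[ℝ] Plane} {ε η : ℝ}
    {f f' f'' : ℝ → ℝ} (G : IsGraphBox q₁ L ε η f f' f'') :
    HasDerivAt (fun θ => ((frame q₁ L).symm (rotatePoint q₁ θ)).2 -
      f ((frame q₁ L).symm (rotatePoint q₁ θ)).1) (inner ℝ (L !₂[0, 1]) !₂[-(q₁ 1), q₁ 0]) 0 := by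
  simp only [frame_symm_apply]
  have h1 := hasDerivAt_inner_rotatePoint q₁ (L !₂[1, 0]) q₁
  have h2 := hasDerivAt_inner_rotatePoint q₁ (L !₂[0, 1]) q₁
  have h3 : HasDerivAt f 0 (inner ℝ (L !₂[1, 0]) (rotatePoint q₁ 0 - q₁)) := by
    have := G.hasDerivAt 0 ⟨by linarith [G.pos], G.pos.le⟩
    rw [G.deriv_zero] at this
    rwa [rotatePoint_zero, sub_self, inner_zero_right]
  refine (h2.sub (h3.comp 0 h1)).congr_deriv ?_
  simp

theorem IsGraphBox.height_pos {q₁ : Plane} {L : Plane ≃ₗᵢ[ℝ] Plane} {ε η : ℝ}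
    {f f' f'' : ℝ → ℝ} (G : IsGraphBox q₁ L ε η f f' f'') : 0 < η :=
  (abs_nonneg _).trans_lt (G.abs_lt 0 ⟨by linarith [G.pos], G.pos.le⟩)

theorem frame_symm_self (q₁ : Plane) (L : Plane ≃ₗᵢ[ℝ] Plane) :
    (frame q₁ L).symm q₁ = (0, 0) := by
  rw [frame_symm_apply]; simp

theorem IsGraphBox.eventually_mem {q₁ : Plane} {L : Plane ≃ₗᵢ[ℝ] Plane} {ε η : ℝ}
    {f f' f'' : ℝ → ℝ} (G : IsGraphBox q₁ L ε η f f' f'') :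
    ∀ᶠ q in 𝓝 q₁, (frame q₁ L).symm q ∈ Ioo (-ε) ε ×ˢ Ioo (-η) η := by
  have h := (frame q₁ L).symm.continuous.tendsto q₁
  rw [frame_symm_self] at h
  have := G.height_pos
  exact h.eventually ((isOpen_Ioo.prod isOpen_Ioo).mem_nhds
    ⟨⟨by linarith [G.pos], G.pos⟩, ⟨by linarith, this⟩⟩)

theorem tendsto_rotatePoint (q : Plane) : Tendsto (rotatePoint q) (𝓝[>] 0) (𝓝 q) := by
  have := (continuous_rotatePoint q).tendsto 0
  rw [rotatePoint_zero] at this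
  exact this.mono_left nhdsWithin_le_nhds

/-- If the generating set is locally a subgraph, then the graph's normal does not point towards
the positive axis. -/
theorem IsGraphBox.inner_nonneg (hn : 2 ≤ n) (hE : IsSphericallySymmetric E) {q₁ : Plane}
    {L : Plane ≃ₗᵢ[ℝ] Plane} {ε η : ℝ} {f f' f'' : ℝ → ℝ} (G : IsGraphBox q₁ L ε η f f' f'')
    (hq : 0 < q₁ 1) (hqE : q₁ ∉ generatingSet E)
    (hlow : ∀ z ∈ Ioo (-ε) ε ×ˢ Ioo (-η) η, z.2 < f z.1 → frame q₁ L z ∈ generatingSet E) :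
    0 ≤ inner ℝ (L !₂[0, 1]) !₂[-(q₁ 1), q₁ 0] := by
  refine deriv_nonneg_of_eventually G.hasDerivAt_height ?_ ?_
  · rw [rotatePoint_zero, frame_symm_self, G.map_zero, sub_zero]
  · filter_upwards [(tendsto_rotatePoint q₁).eventually G.eventually_mem,
      eventually_rotatePoint_notMem hn hE hq hqE] with θ h1 h2
    by_contra h3
    refine h2 ?_
    have := hlow _ h1 (by linarith)
    rwa [Homeomorph.apply_symm_apply] at this

/-- The mirror image of a graph. -/
theorem IsGraphBox.neg {q₁ : Plane} {L L' : Plane ≃ₗᵢ[ℝ] Plane} {ε η : ℝ}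
    {f f' f'' : ℝ → ℝ} (G : IsGraphBox q₁ L ε η f f' f'') (h0 : L' !₂[1, 0] = L !₂[1, 0])
    (h1 : L' !₂[0, 1] = -(L !₂[0, 1])) : (∀ u v, frame q₁ L' (u, v) = frame q₁ L (u, -v)) ∧
    IsGraphBox q₁ L' ε η (fun u => -(f u)) (fun u => -(f' u)) fun u => -(f'' u) := by
  have h : ∀ u v, frame q₁ L' (u, v) = frame q₁ L (u, -v) := fun u v => by
    rw [frame_apply_add_smul, frame_apply_add_smul, h0, h1, smul_neg, neg_smul]
  refine ⟨h, G.pos, fun u hu => (G.hasDerivAt u hu).neg, fun u hu => (G.hasDerivAt_deriv u hu).neg,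
    G.continuousOn.neg, fun u hu => by rw [abs_neg]; exact G.abs_lt u hu,
    by rw [G.map_zero, neg_zero], by rw [G.deriv_zero, neg_zero], fun u hu v hv => ?_⟩
  rw [h]
  exact G.above_axis u hu _ ⟨by linarith [hv.2], by linarith [hv.1]⟩

/-- The generalized mean curvature, with respect to the right normal of the generating curve, of the
hypersurface of revolution generated by `γ`. -/
def generalizedCurvature (n : ℕ) (p : ℝ) (γ : ℝ → Plane) (s : ℝ) : ℝ :=
  deriv γ s 0 * deriv (deriv γ) s 1 - deriv γ s 1 * deriv (deriv γ) s 0 -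
    (n - 2) * deriv γ s 0 / γ s 1 +
    p * (γ s 0 * deriv γ s 1 - γ s 1 * deriv γ s 0) / ‖γ s‖ ^ 2

/-- At each point of the generating curve, either the generating set lies on both sides and the
curve is tangent to a circle around the origin, or it lies on one side. -/
theorem IsGeneratingCurve.dichotomy (hn : 2 ≤ n) (hp : 0 < p) (hE : IsIsoperimetric p E)
    (hEo : IsOpen E) (hne : E.Nonempty) (hsymm : IsSphericallySymmetric E) : ∃ Λ : ℝ,
    ∀ (β : ℝ) (γ : ℝ → Plane), IsGeneratingCurve (generatingSet E) β γ → ∀ s ∈ Ioo 0 β,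
      (γ s ∈ interior (closure (generatingSet E)) ∧ inner ℝ (γ s) (deriv γ s) = 0) ∨
      ((∀ᶠ t in 𝓝 s, γ t ∉ interior (closure (generatingSet E))) ∧ 0 < Λ ∧
        ((generalizedCurvature n p γ s = Λ ∧ inner ℝ (γ s) (deriv γ s) ≤ 0) ∨
        (generalizedCurvature n p γ s = -Λ ∧ 0 ≤ inner ℝ (γ s) (deriv γ s)))) := by
  obtain ⟨Λ, hΛ⟩ := hE.exists_mean_curvature hn hp hEo hne
  refine ⟨Λ, fun β γ hγ s hs => ?_⟩
  set A := generatingSet E with hA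
  have hAo : IsOpen A := isOpen_generatingSet hEo
  have hs' : s ∈ Ioo (-β) β := ⟨by linarith [hs.1, hγ.pos], hs.2⟩
  have hfr : γ s ∈ frontier A := hγ.mem_frontier s (Ioo_subset_Icc_self hs')
  have hfrA : ∀ q ∈ frontier A, q ∉ A := fun q hq hqA => by
    rw [hAo.frontier_eq] at hq
    exact hq.2 hqA
  have hq : 0 < γ s 1 := hγ.above_axis s hs
  -- one-sided points
  have one_sided : ∀ (L : Plane ≃ₗᵢ[ℝ] Plane) (ε η : ℝ) (f f' f'' : ℝ → ℝ),
      IsGraphBox (γ s) L ε η f f' f'' →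
      (∀ z ∈ Ioo (-ε) ε ×ˢ Ioo (-η) η, frame (γ s) L z ∈ A ↔ z.2 < f z.1) →
      (∀ᶠ t in 𝓝 s, γ t ∉ interior (closure A)) ∧ 0 < Λ ∧
        -(f'' 0) + p * inner ℝ (γ s) (L !₂[0, 1]) / ‖γ s‖ ^ 2 +
        (n - 2) * (L !₂[0, 1]) 1 / γ s 1 = Λ ∧
      0 ≤ inner ℝ (L !₂[0, 1]) !₂[-(γ s 1), γ s 0] := by
    intro L ε η f f' f'' G hbox
    have h1 := hΛ (γ s) L ε η f f' f'' G fun x hx => by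
      rw [mem_iff_profile_mem hn hsymm, ← hA, ← hbox _ hx, Homeomorph.apply_symm_apply]
    refine ⟨?_, h1.1, h1.2, G.inner_nonneg hn hsymm hq (hfrA _ hfr) fun z hz => (hbox z hz).2⟩
    have hγc : ContinuousAt γ s := (hγ.contDiffAt hs').continuousAt
    filter_upwards [hγc.eventually G.eventually_mem, Ioo_mem_nhds hs'.1 hs'.2] with t htb ht hint
    set z := (frame (γ s) L).symm (γ t) with hz
    have hzγ : frame (γ s) L z = γ t := Homeomorph.apply_symm_apply _ _
    have hfz : f z.1 ≤ z.2 := by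
      by_contra h2
      have h3 := (hbox z htb).2 (not_le.1 h2)
      rw [hzγ] at h3
      exact hfrA _ (hγ.mem_frontier t (Ioo_subset_Icc_self ht)) h3
    -- points above the graph are not in the closure
    have h2 : ∀ᶠ v in 𝓝[>] z.2, frame (γ s) L (z.1, v) ∈ closure A := by
      have hc : Continuous fun v : ℝ => frame (γ s) L (z.1, v) :=
        (frame (γ s) L).continuous.comp (by fun_prop)
      have h3 := hc.tendsto z.2
      rw [Prod.mk.eta, hzγ] at h3
      exact ((h3.eventually (isOpen_interior.mem_nhds hint)).mono fun v hv =>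
        interior_subset hv).filter_mono nhdsWithin_le_nhds
    obtain ⟨v, hv, hvη⟩ := (h2.and (Ioo_mem_nhdsGT htb.2.2)).exists
    rw [mem_closure_iff_frequently] at hv
    have hup : ∀ᶠ z' in 𝓝 (z.1, v), z' ∈ {z : ℝ × ℝ | z.1 ∈ Ioo (-ε) ε ∧ z.2 ∈ Ioo (-η) η ∧
        f z.1 < z.2} := by
      have h4 : ∀ᶠ z' in 𝓝 (z.1, v), f z'.1 < z'.2 := by
        have hfc : ContinuousAt f (z.1, v).1 :=
          (G.hasDerivAt z.1 (Ioo_subset_Icc_self htb.1)).continuousAt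
        exact (hfc.tendsto.comp (continuous_fst.tendsto (z.1, v))).eventually_lt
          (continuous_snd.tendsto (z.1, v)) (hfz.trans_lt hvη.1)
      filter_upwards [h4, prod_mem_nhds (Ioo_mem_nhds htb.1.1 htb.1.2)
        (Ioo_mem_nhds (htb.2.1.trans hvη.1) hvη.2)] with z' h5 h6
      exact ⟨h6.1, h6.2, h5⟩
    have hup' := ((frame (γ s) L).symm.continuous.tendsto (frame (γ s) L (z.1, v))).eventually
      (by rwa [Homeomorph.symm_apply_apply])
    obtain ⟨q, hqA, hq2⟩ := (hv.and_eventually hup').exists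
    have h6 := (hbox _ ⟨hq2.1, hq2.2.1⟩).1 (by rwa [Homeomorph.apply_symm_apply])
    exact lt_asymm h6 hq2.2.2
  have hunit : deriv γ s 0 ^ 2 + deriv γ s 1 ^ 2 = 1 := by
    rw [← plane_norm_sq, hγ.norm_deriv s hs', one_pow]
  have hν : ‖(!₂[deriv γ s 1, -(deriv γ s 0)] : Plane)‖ = 1 := by
    rw [← sq_eq_sq₀ (norm_nonneg _) zero_le_one, plane_norm_sq]
    simp only [Matrix.cons_val_zero, Matrix.cons_val_one]
    linarith
  have horth : inner ℝ (deriv γ s) (!₂[deriv γ s 1, -(deriv γ s 0)] : Plane) = 0 := by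
    simp only [PiLp.inner_apply, Fin.sum_univ_two, Matrix.cons_val_zero, Matrix.cons_val_one,
      RCLike.inner_apply, conj_trivial]
    ring
  obtain ⟨L, hL0, hL1⟩ := exists_linearIsometryEquiv (hγ.norm_deriv s hs') hν horth
  obtain ⟨L', hL'0, hL'1⟩ := exists_linearIsometryEquiv (τ := deriv γ s)
    (e := -!₂[deriv γ s 1, -(deriv γ s 0)]) (hγ.norm_deriv s hs') (by rwa [norm_neg])
    (by rw [inner_neg_right, horth, neg_zero])
  obtain ⟨ε, η, f, f', f'', G, hf'', hfront⟩ := hγ.exists_local_graph hs L hL0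
  have hfc : ContinuousOn f (Ioo (-ε) ε) := fun u hu =>
    (G.hasDerivAt u (Ioo_subset_Icc_self hu)).continuousAt.continuousWithinAt
  have hfη : ∀ u ∈ Ioo (-ε) ε, -η < f u ∧ f u < η := fun u hu =>
    abs_lt.1 (G.abs_lt u (Ioo_subset_Icc_self hu))
  have hgraph : ∀ z ∈ Ioo (-ε) ε ×ˢ Ioo (-η) η, z.2 = f z.1 → frame (γ s) L z ∉ A :=
    fun z hz h => hfrA _ ((hfront z hz).2 h)
  -- each side of the graph is inside or outside
  have hlow := subset_or_subset_compl_of_notMem_frontier (S := A)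
    ((isPreconnected_between (convex_Ioo (-ε) ε) (continuousOn_const (c := -η)) hfc
      fun u hu => (hfη u hu).1).image (frame (γ s) L) (frame (γ s) L).continuous.continuousOn) (by
    rintro _ ⟨z, ⟨h1, h2, h3⟩, rfl⟩ h4
    exact h3.ne ((hfront z ⟨h1, h2, h3.trans (hfη _ h1).2⟩).1 h4))
  have hupp := subset_or_subset_compl_of_notMem_frontier (S := A)
    ((isPreconnected_between (convex_Ioo (-ε) ε) hfc (continuousOn_const (c := η))
      fun u hu => (hfη u hu).2).image (frame (γ s) L) (frame (γ s) L).continuous.continuousOn) (by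
    rintro _ ⟨z, ⟨h1, h2, h3⟩, rfl⟩ h4
    exact h2.ne' ((hfront z ⟨h1, (hfη _ h1).1.trans h2, h3⟩).1 h4))
  have hlow_mem : ∀ z ∈ Ioo (-ε) ε ×ˢ Ioo (-η) η, z.2 < f z.1 →
      frame (γ s) L z ∈ frame (γ s) L '' {z : ℝ × ℝ | z.1 ∈ Ioo (-ε) ε ∧ -η < z.2 ∧ z.2 < f z.1} :=
    fun z hz h => ⟨z, ⟨hz.1, hz.2.1, h⟩, rfl⟩
  have hupp_mem : ∀ z ∈ Ioo (-ε) ε ×ˢ Ioo (-η) η, f z.1 < z.2 →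
      frame (γ s) L z ∈ frame (γ s) L '' {z : ℝ × ℝ | z.1 ∈ Ioo (-ε) ε ∧ f z.1 < z.2 ∧ z.2 < η} :=
    fun z hz h => ⟨z, ⟨hz.1, h, hz.2.2⟩, rfl⟩
  have hinner : inner ℝ (γ s) (deriv γ s) = γ s 0 * deriv γ s 0 + γ s 1 * deriv γ s 1 := by
    simp only [PiLp.inner_apply, Fin.sum_univ_two, RCLike.inner_apply, conj_trivial]
    ring
  have hJ : inner ℝ (!₂[deriv γ s 1, -(deriv γ s 0)] : Plane) !₂[-(γ s 1), γ s 0] =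
      -inner ℝ (γ s) (deriv γ s) := by
    rw [hinner]
    simp only [PiLp.inner_apply, Fin.sum_univ_two, Matrix.cons_val_zero, Matrix.cons_val_one,
      RCLike.inner_apply, conj_trivial]
    ring
  have hγν : inner ℝ (γ s) (!₂[deriv γ s 1, -(deriv γ s 0)] : Plane) =
      γ s 0 * deriv γ s 1 - γ s 1 * deriv γ s 0 := by
    simp only [PiLp.inner_apply, Fin.sum_univ_two, Matrix.cons_val_zero, Matrix.cons_val_one,
      RCLike.inner_apply, conj_trivial]
    ring
  have hf''' : f'' 0 =
      -(deriv γ s 0 * deriv (deriv γ) s 1 - deriv γ s 1 * deriv (deriv γ) s 0) := by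
    rw [hf'', hL1]
    simp only [PiLp.inner_apply, Fin.sum_univ_two, Matrix.cons_val_zero, Matrix.cons_val_one,
      RCLike.inner_apply, conj_trivial]
    ring
  rcases hlow with hlow | hlow <;> rcases hupp with hupp | hupp
  · -- both sides inside
    left
    constructor
    · rw [mem_interior_iff_mem_nhds]
      filter_upwards [G.eventually_mem] with q hq
      have h1 : q = frame (γ s) L ((frame (γ s) L).symm q) := (Homeomorph.apply_symm_apply _ q).symm
      rcases lt_trichotomy ((frame (γ s) L).symm q).2 (f ((frame (γ s) L).symm q).1) with h | h | h
      · rw [h1]; exact subset_closure (hlow (hlow_mem _ hq h))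
      · rw [h1]; exact frontier_subset_closure ((hfront _ hq).2 h)
      · rw [h1]; exact subset_closure (hupp (hupp_mem _ hq h))
    · have hzero : ∀ᶠ θ in 𝓝[>] (0 : ℝ), ((frame (γ s) L).symm (rotatePoint (γ s) θ)).2 -
          f ((frame (γ s) L).symm (rotatePoint (γ s) θ)).1 = 0 := by
        filter_upwards [(tendsto_rotatePoint (γ s)).eventually G.eventually_mem,
          eventually_rotatePoint_notMem hn hsymm hq (hfrA _ hfr)] with θ h1 h2
        rcases lt_trichotomy ((frame (γ s) L).symm (rotatePoint (γ s) θ)).2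
          (f ((frame (γ s) L).symm (rotatePoint (γ s) θ)).1) with h | h | h
        · have := hlow (hlow_mem _ h1 h)
          rw [Homeomorph.apply_symm_apply] at this
          exact absurd this h2
        · rw [h, sub_self]
        · have := hupp (hupp_mem _ h1 h)
          rw [Homeomorph.apply_symm_apply] at this
          exact absurd this h2
      have h0 : ((frame (γ s) L).symm (rotatePoint (γ s) 0)).2 -
          f ((frame (γ s) L).symm (rotatePoint (γ s) 0)).1 = 0 := by
        rw [rotatePoint_zero, frame_symm_self, G.map_zero, sub_zero]
      have h1 := deriv_nonneg_of_eventually G.hasDerivAt_height h0 (hzero.mono fun θ h => h.ge)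
      have h2 := deriv_nonneg_of_eventually G.hasDerivAt_height.neg
        (by rw [Pi.neg_apply, h0, neg_zero])
        (hzero.mono fun θ h => by rw [Pi.neg_apply, h, neg_zero])
      rw [hL1, hJ] at h1 h2
      linarith
  · right
    obtain ⟨h1, h2, h3, h4⟩ := one_sided L ε η f f' f'' G fun z hz =>
      ⟨fun h => by
        by_contra h5
        rcases (not_lt.1 h5).eq_or_lt with h6 | h6
        · exact hgraph z hz h6.symm h
        · exact hupp (hupp_mem z hz h6) h, fun h => hlow (hlow_mem z hz h)⟩
    rw [hL1, hJ] at h4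
    refine ⟨h1, h2, Or.inl ⟨?_, by linarith⟩⟩
    rw [hL1, hγν, hf'''] at h3
    rw [← h3, generalizedCurvature]
    simp only [Matrix.cons_val_one, Matrix.cons_val_fin_one]
    ring
  · right
    obtain ⟨hframe, G'⟩ := G.neg (hL'0.trans hL0.symm) (by rw [hL'1, hL1])
    have hbox : ∀ z ∈ Ioo (-ε) ε ×ˢ Ioo (-η) η, (z.1, -z.2) ∈ Ioo (-ε) ε ×ˢ Ioo (-η) η :=
      fun z hz => ⟨hz.1, by linarith [hz.2.2], by linarith [hz.2.1]⟩
    obtain ⟨h1, h2, h3, h4⟩ := one_sided L' ε η _ _ _ G' fun z hz => by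
      have hz' := hbox z hz
      rw [show z = (z.1, z.2) from rfl, hframe]
      refine ⟨fun h => ?_, fun h => hupp (hupp_mem (z.1, -z.2) hz' (by dsimp at h ⊢; linarith))⟩
      by_contra h5
      dsimp at h5
      rcases (not_lt.1 h5).eq_or_lt with h6 | h6
      · exact hgraph (z.1, -z.2) hz' (by dsimp; linarith) h
      · exact hlow (hlow_mem (z.1, -z.2) hz' (by dsimp; linarith)) h
    rw [hL'1, inner_neg_left, hJ] at h4
    refine ⟨h1, h2, Or.inr ⟨?_, by linarith⟩⟩
    rw [hL'1, inner_neg_right, hγν, hf'''] at h3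
    rw [← h3, generalizedCurvature]
    simp only [PiLp.neg_apply, Matrix.cons_val_one, Matrix.cons_val_fin_one]
    ring
  · -- both sides outside
    exfalso
    have h1 := frontier_subset_closure hfr
    rw [mem_closure_iff_frequently] at h1
    obtain ⟨q, hqA, hq⟩ := (h1.and_eventually G.eventually_mem).exists
    have h2 : q = frame (γ s) L ((frame (γ s) L).symm q) := (Homeomorph.apply_symm_apply _ q).symm
    rw [h2] at hqA
    rcases lt_trichotomy ((frame (γ s) L).symm q).2 (f ((frame (γ s) L).symm q).1) with h | h | h
    · exact hlow (hlow_mem _ hq h) hqA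
    · exact hgraph _ hq h hqA
    · exact hupp (hupp_mem _ hq h) hqA

end Dichotomy

/-! ### The ordinary differential equation of the generating curve -/

section CurveEquation

/-- A function that is positive near `0` is positive up to its first zero. -/
theorem pos_or_exists_first_zero {f : ℝ → ℝ} {b : ℝ} (hf : ContinuousOn f (Ioo 0 b))
    (h0 : ∀ᶠ s in 𝓝[>] (0 : ℝ), 0 < f s) :
    (∀ s ∈ Ioo 0 b, 0 < f s) ∨ ∃ t ∈ Ioo 0 b, f t = 0 ∧ ∀ s ∈ Ioo 0 t, 0 < f s := by
  by_cases h : ∀ s ∈ Ioo 0 b, 0 < f s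
  · exact Or.inl h
  right
  push Not at h
  obtain ⟨s₁, hs₁, hfs₁⟩ := h
  obtain ⟨e, he, hes⟩ := mem_nhdsGT_iff_exists_Ioo_subset.1 h0
  have he' : (0 : ℝ) < e := he
  have hes₁ : e ≤ s₁ := by
    by_contra hlt
    exact absurd (hes ⟨hs₁.1, not_le.1 hlt⟩) (not_lt.2 hfs₁)
  have hsub : Icc e s₁ ⊆ Ioo 0 b := fun s hs => ⟨he'.trans_le hs.1, hs.2.trans_lt hs₁.2⟩
  have hcl : IsClosed (Icc e s₁ ∩ f ⁻¹' Iic 0) :=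
    (hf.mono hsub).preimage_isClosed_of_isClosed isClosed_Icc isClosed_Iic
  have hcomp : IsCompact (Icc e s₁ ∩ f ⁻¹' Iic 0) :=
    isCompact_Icc.of_isClosed_subset hcl inter_subset_left
  obtain ⟨t, ht, htle⟩ := hcomp.exists_isLeast ⟨s₁, ⟨hes₁, le_rfl⟩, hfs₁⟩
  have hpos : ∀ s ∈ Ioo 0 t, 0 < f s := by
    intro s hs
    by_cases hse : s < e
    · exact hes ⟨hs.1, hse⟩
    · by_contra hfs
      have := htle ⟨⟨not_lt.1 hse, hs.2.le.trans ht.1.2⟩, not_lt.1 hfs⟩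
      exact absurd hs.2 (not_lt.2 this)
  have htb := hsub ht.1
  refine ⟨t, htb, le_antisymm ht.2 ?_, hpos⟩
  have hct : Tendsto f (𝓝[<] t) (𝓝 (f t)) :=
    (hf.continuousAt (Ioo_mem_nhds htb.1 htb.2)).tendsto.mono_left nhdsWithin_le_nhds
  refine ge_of_tendsto hct ?_
  filter_upwards [Ioo_mem_nhdsLT htb.1] with s hs using (hpos s hs).le

/-- Scalar data of a unit speed curve `(x, y)` with velocity `(c, σ)` and curvature `κ` in the upper
half of the unit disc, over the interval `(0, β)`, which turns towards the origin and whose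
generalized mean curvature is the constant `W`. -/
structure IsProfileSolution (m : ℕ) (p W β : ℝ) (x y c σ κ : ℝ → ℝ) : Prop where
  hasDerivAt_fst : ∀ s ∈ Ioo 0 β, HasDerivAt x (c s) s
  hasDerivAt_snd : ∀ s ∈ Ioo 0 β, HasDerivAt y (σ s) s
  hasDerivAt_cos : ∀ s ∈ Ioo 0 β, HasDerivAt c (-(σ s * κ s)) s
  hasDerivAt_sin : ∀ s ∈ Ioo 0 β, HasDerivAt σ (c s * κ s) s
  unit_speed : ∀ s ∈ Ioo 0 β, c s ^ 2 + σ s ^ 2 = 1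
  pos : ∀ s ∈ Ioo 0 β, 0 < y s
  norm_le : ∀ s ∈ Ioo 0 β, x s ^ 2 + y s ^ 2 ≤ 1
  inward : ∀ s ∈ Ioo 0 β, x s * c s + y s * σ s ≤ 0
  curvature : ∀ s ∈ Ioo 0 β, κ s - m * c s / y s +
    p * (x s * σ s - y s * c s) / (x s ^ 2 + y s ^ 2) = W

variable {m : ℕ} {p W β : ℝ} {x y c σ κ : ℝ → ℝ}

/-- The difference between the curvature of the canonical circle and the curvature of the curve,
with a weight that makes it monotone. -/
def curvatureGap (m : ℕ) (p W : ℝ) (x y c σ : ℝ → ℝ) (s : ℝ) : ℝ :=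
  (x s ^ 2 + y s ^ 2) ^ (p / 2) * (y s ^ m * (-((m + 1) * c s) +
    p * (x s * σ s - y s * c s) / (x s ^ 2 + y s ^ 2) * y s - W * y s))

namespace IsProfileSolution

theorem normSq_pos (h : IsProfileSolution m p W β x y c σ κ) {s : ℝ} (hs : s ∈ Ioo 0 β) :
    0 < x s ^ 2 + y s ^ 2 := by
  have := h.pos s hs
  positivity

/-- The gap is a positive multiple of `-c - y κ`, which governs the motion of the center of the
canonical circle; see `hasDerivAt_center`. -/
theorem curvatureGap_eq (h : IsProfileSolution m p W β x y c σ κ) {s : ℝ} (hs : s ∈ Ioo 0 β) :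
    curvatureGap m p W x y c σ s =
      (x s ^ 2 + y s ^ 2) ^ (p / 2) * (y s ^ m * (-(c s) - y s * κ s)) := by
  have hy := (h.pos s hs).ne'
  have hR := (h.normSq_pos hs).ne'
  rw [curvatureGap, ← h.curvature s hs]
  congr 2
  field_simp
  ring

/-- The constancy of the generalized mean curvature makes every term with `W` or `κ` cancel from the
derivative of the gap. -/
theorem hasDerivAt_curvatureGap (hm : 1 ≤ m) (h : IsProfileSolution m p W β x y c σ κ) {s : ℝ}
    (hs : s ∈ Ioo 0 β) : HasDerivAt (curvatureGap m p W x y c σ)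
      (p * (x s ^ 2 + y s ^ 2) ^ (p / 2) * y s ^ m * (x s * c s + y s * σ s) *
        (c s * (x s ^ 2 + y s ^ 2) - 2 * x s * (x s * c s + y s * σ s)) /
          (x s ^ 2 + y s ^ 2) ^ 2) s := by
  have hy := (h.pos s hs).ne'
  have hR := h.normSq_pos hs
  have dx := h.hasDerivAt_fst s hs
  have dy := h.hasDerivAt_snd s hs
  have dc := h.hasDerivAt_cos s hs
  have dσ := h.hasDerivAt_sin s hs
  have dR : HasDerivAt (fun s => x s ^ 2 + y s ^ 2) (2 * (x s * c s + y s * σ s)) s := by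
    refine ((dx.pow 2).add (dy.pow 2)).congr_deriv ?_
    simp
    ring
  have dRp : HasDerivAt (fun s => (x s ^ 2 + y s ^ 2) ^ (p / 2))
      (p * (x s * c s + y s * σ s) * (x s ^ 2 + y s ^ 2) ^ (p / 2) / (x s ^ 2 + y s ^ 2)) s := by
    refine (dR.rpow_const (p := p / 2) (Or.inl hR.ne')).congr_deriv ?_
    rw [Real.rpow_sub_one hR.ne']
    ring
  have dH : HasDerivAt (fun s => x s * σ s - y s * c s) ((x s * c s + y s * σ s) * κ s) s := by
    refine ((dx.mul dσ).sub (dy.mul dc)).congr_deriv ?_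
    ring
  have dD : HasDerivAt (fun s => -((m + 1) * c s) +
      p * (x s * σ s - y s * c s) / (x s ^ 2 + y s ^ 2) * y s - W * y s)
      ((m + 1) * (σ s * κ s) + (p * ((x s * c s + y s * σ s) * κ s) * (x s ^ 2 + y s ^ 2) -
        p * (x s * σ s - y s * c s) * (2 * (x s * c s + y s * σ s))) / (x s ^ 2 + y s ^ 2) ^ 2 *
        y s + p * (x s * σ s - y s * c s) / (x s ^ 2 + y s ^ 2) * σ s - W * σ s) s := by
    refine ((((dc.const_mul ((m : ℝ) + 1)).neg).add (((dH.const_mul p).div dR hR.ne').mul dy)).sub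
      (dy.const_mul W)).congr_deriv ?_
    simp only [Pi.div_apply]
    ring
  obtain ⟨k, rfl⟩ : ∃ k, m = k + 1 := ⟨m - 1, by omega⟩
  refine (dRp.mul ((dy.pow (k + 1)).mul dD)).congr_deriv ?_
  rw [← h.curvature s hs]
  simp only [Pi.mul_apply, Pi.pow_apply, Nat.add_sub_cancel]
  push_cast
  generalize (x s ^ 2 + y s ^ 2) ^ (p / 2) = ρ
  have hR' := hR.ne'
  field_simp
  ring

theorem abs_curvatureGap_le (hm : 1 ≤ m) (hp : 0 < p) (h : IsProfileSolution m p W β x y c σ κ)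
    {s : ℝ} (hs : s ∈ Ioo 0 β) : |curvatureGap m p W x y c σ s| ≤ (m + 1 + p + |W|) * y s := by
  have hy := h.pos s hs
  have hR := h.normSq_pos hs
  have hR1 := h.norm_le s hs
  have hu := h.unit_speed s hs
  have hy1 : y s ≤ 1 := by nlinarith [sq_nonneg (x s)]
  have hc1 : |c s| ≤ 1 := abs_le_one_iff_mul_self_le_one.2 (by nlinarith [sq_nonneg (σ s)])
  have hρ0 : 0 ≤ (x s ^ 2 + y s ^ 2) ^ (p / 2) := by positivity
  have hρ1 : (x s ^ 2 + y s ^ 2) ^ (p / 2) ≤ 1 := Real.rpow_le_one hR.le hR1 (by positivity)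
  have hym : y s ^ m ≤ y s := pow_le_of_le_one hy.le hy1 (by omega)
  have hH : |(x s * σ s - y s * c s) / (x s ^ 2 + y s ^ 2) * y s| ≤ 1 := by
    rw [div_mul_eq_mul_div, abs_div, abs_of_pos hR, div_le_one hR]
    refine abs_le_of_sq_le_sq ?_ hR.le
    have h1 : (x s * σ s - y s * c s) ^ 2 ≤ x s ^ 2 + y s ^ 2 := by
      nlinarith [sq_nonneg (x s * c s + y s * σ s)]
    rw [mul_pow]
    calc (x s * σ s - y s * c s) ^ 2 * y s ^ 2 ≤ (x s ^ 2 + y s ^ 2) * (x s ^ 2 + y s ^ 2) :=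
          mul_le_mul h1 (by nlinarith [sq_nonneg (x s)]) (sq_nonneg _) hR.le
      _ = (x s ^ 2 + y s ^ 2) ^ 2 := by ring
  have hD : |-((m + 1) * c s) + p * (x s * σ s - y s * c s) / (x s ^ 2 + y s ^ 2) * y s - W * y s| ≤
      m + 1 + p + |W| := by
    have e1 : |((m : ℝ) + 1) * c s| ≤ m + 1 := by
      rw [abs_mul, abs_of_pos (by positivity : (0 : ℝ) < m + 1)]
      exact mul_le_of_le_one_right (by positivity) hc1
    have e2 : |p * (x s * σ s - y s * c s) / (x s ^ 2 + y s ^ 2) * y s| ≤ p := by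
      rw [mul_div_assoc, mul_assoc, abs_mul, abs_of_pos hp]
      exact mul_le_of_le_one_right hp.le hH
    have e3 : |W * y s| ≤ |W| := by
      rw [abs_mul, abs_of_pos hy]
      exact mul_le_of_le_one_right (abs_nonneg _) hy1
    rw [abs_le] at e1 e2 e3 ⊢
    constructor <;> linarith
  rw [curvatureGap, abs_mul, abs_mul, abs_of_nonneg hρ0, abs_of_pos (by positivity : 0 < y s ^ m)]
  calc _ ≤ 1 * (y s * (m + 1 + p + |W|)) := by gcongr
    _ = _ := by ring

theorem tendsto_curvatureGap (hm : 1 ≤ m) (hp : 0 < p) (h : IsProfileSolution m p W β x y c σ κ)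
    {l : Filter ℝ} (hl : ∀ᶠ s in l, s ∈ Ioo 0 β) (hy : Tendsto y l (𝓝 0)) :
    Tendsto (curvatureGap m p W x y c σ) l (𝓝 0) := by
  refine squeeze_zero_norm' (a := fun s => (m + 1 + p + |W|) * y s) ?_ ?_
  · filter_upwards [hl] with s hs using h.abs_curvatureGap_le hm hp hs
  · simpa using hy.const_mul (m + 1 + p + |W|)

/-- The abscissa of the center of the canonical circle at parameter `s`. -/
def center (x y c σ : ℝ → ℝ) (s : ℝ) : ℝ := (x s * c s + y s * σ s) / c s

/-- The difference of the squared radius of the canonical circle and the squared distance of its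
center from the origin. -/
def power (x y c σ : ℝ → ℝ) (s : ℝ) : ℝ := x s ^ 2 + y s ^ 2 - 2 * x s * center x y c σ s

theorem hasDerivAt_center (h : IsProfileSolution m p W β x y c σ κ) {s : ℝ} (hs : s ∈ Ioo 0 β)
    (hc : c s ≠ 0) : HasDerivAt (center x y c σ) ((c s + y s * κ s) / c s ^ 2) s := by
  have dx := h.hasDerivAt_fst s hs
  have dy := h.hasDerivAt_snd s hs
  have dc := h.hasDerivAt_cos s hs
  have dσ := h.hasDerivAt_sin s hs
  refine (((dx.mul dc).add (dy.mul dσ)).div dc hc).congr_deriv ?_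
  simp only [Pi.mul_apply, Pi.add_apply]
  congr 1
  linear_combination (c s + y s * κ s) * h.unit_speed s hs

theorem hasDerivAt_power (h : IsProfileSolution m p W β x y c σ κ) {s : ℝ} (hs : s ∈ Ioo 0 β)
    (hc : c s ≠ 0) : HasDerivAt (power x y c σ)
      (-(2 * x s * ((c s + y s * κ s) / c s ^ 2))) s := by
  have dx := h.hasDerivAt_fst s hs
  have dy := h.hasDerivAt_snd s hs
  refine (((dx.pow 2).add (dy.pow 2)).sub ((dx.const_mul 2).mul
    (h.hasDerivAt_center hs hc))).congr_deriv ?_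
  simp only [center, Nat.cast_ofNat, Nat.add_one_sub_one, pow_one]
  field_simp
  ring

/-- While the curve moves to the left and the origin is inside the canonical circles, the
curvature gap increases from zero. -/
theorem curvatureGap_monotone (hm : 1 ≤ m) (hp : 0 < p) (h : IsProfileSolution m p W β x y c σ κ)
    (hy : Tendsto y (𝓝[>] 0) (𝓝 0)) {T : ℝ} (hT : T ≤ β) (hc : ∀ s ∈ Ioo 0 T, c s < 0)
    (hP : ∀ s ∈ Ioo 0 T, 0 < power x y c σ s) :
    MonotoneOn (curvatureGap m p W x y c σ) (Ioo 0 T) ∧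
      ∀ s ∈ Ioo 0 T, 0 ≤ curvatureGap m p W x y c σ s := by
  have hsub : Ioo 0 T ⊆ Ioo 0 β := Ioo_subset_Ioo_right hT
  have hmono : MonotoneOn (curvatureGap m p W x y c σ) (Ioo 0 T) := by
    refine monotoneOn_of_deriv_nonneg (convex_Ioo 0 T) (fun s hs =>
      (h.hasDerivAt_curvatureGap hm (hsub hs)).continuousAt.continuousWithinAt)
      (fun s hs => ?_) fun s hs => ?_
    · rw [interior_Ioo] at hs
      exact (h.hasDerivAt_curvatureGap hm (hsub hs)).differentiableAt.differentiableWithinAt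
    · rw [interior_Ioo] at hs
      rw [(h.hasDerivAt_curvatureGap hm (hsub hs)).deriv]
      have hR := h.normSq_pos (hsub hs)
      have hy0 := h.pos s (hsub hs)
      have h1 : c s * (x s ^ 2 + y s ^ 2) - 2 * x s * (x s * c s + y s * σ s) =
          c s * power x y c σ s := by
        have := (hc s hs).ne
        rw [power, center]
        field_simp
      rw [h1]
      refine div_nonneg (mul_nonneg_of_nonpos_of_nonpos (mul_nonpos_of_nonneg_of_nonpos
        (by positivity) (h.inward s (hsub hs))) ?_) (by positivity)
      exact mul_nonpos_of_nonpos_of_nonneg (hc s hs).le (hP s hs).le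
  refine ⟨hmono, fun s hs => ?_⟩
  have hlim := h.tendsto_curvatureGap hm hp (l := 𝓝[>] 0)
    (Ioo_mem_nhdsGT (hs.1.trans (hsub hs).2)) hy
  refine le_of_tendsto hlim ?_
  filter_upwards [Ioo_mem_nhdsGT hs.1] with t ht
  exact hmono ⟨ht.1, ht.2.trans hs.2⟩ hs ht.2.le

/-- Where the gap is nonnegative, the center of the canonical circle moves to the left. -/
theorem center_deriv_nonpos (h : IsProfileSolution m p W β x y c σ κ) {s : ℝ} (hs : s ∈ Ioo 0 β)
    (hN : 0 ≤ curvatureGap m p W x y c σ s) : (c s + y s * κ s) / c s ^ 2 ≤ 0 := by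
  rw [h.curvatureGap_eq hs] at hN
  have hy := h.pos s hs
  have hR := h.normSq_pos hs
  have h1 := nonneg_of_mul_nonneg_right hN (by positivity)
  have h2 := nonneg_of_mul_nonneg_right h1 (by positivity)
  exact div_nonpos_of_nonpos_of_nonneg (by linarith) (sq_nonneg _)

/-- As long as the curve moves to the left, the origin stays inside the canonical circles. -/
theorem power_pos (hm : 1 ≤ m) (hp : 0 < p) (h : IsProfileSolution m p W β x y c σ κ)
    (hy : Tendsto y (𝓝[>] 0) (𝓝 0)) (hP0 : ∀ᶠ s in 𝓝[>] 0, 0 < power x y c σ s) {T : ℝ}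
    (hT : T ≤ β) (hc : ∀ s ∈ Ioo 0 T, c s < 0) : ∀ s ∈ Ioo 0 T, 0 < power x y c σ s := by
  have hsub : Ioo 0 T ⊆ Ioo 0 β := Ioo_subset_Ioo_right hT
  have hcont : ContinuousOn (power x y c σ) (Ioo 0 T) := fun s hs =>
    (h.hasDerivAt_power (hsub hs) (hc s hs).ne).continuousAt.continuousWithinAt
  rcases pos_or_exists_first_zero hcont hP0 with h1 | ⟨t, ht, hPt, hpos⟩
  · exact h1
  exfalso
  have htsub : Ioc 0 t ⊆ Ioo 0 T := fun s hs => ⟨hs.1, hs.2.trans_lt ht.2⟩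
  have hN := (h.curvatureGap_monotone hm hp hy (ht.2.le.trans hT)
    (fun s hs => hc s (htsub (Ioo_subset_Ioc_self hs))) hpos).2
  -- the curve is still in the right half-plane at the first zero of the power
  have hxt : 0 < x t := by
    by_contra hx
    have hF : 0 ≤ center x y c σ t :=
      div_nonneg_of_nonpos (h.inward t (hsub ht)) (hc t ht).le
    have hR := h.normSq_pos (hsub ht)
    rw [power] at hPt
    nlinarith [mul_nonneg hF (neg_nonneg.2 (not_lt.1 hx))]
  have hxanti : AntitoneOn x (Ioc 0 t) := by
    refine antitoneOn_of_deriv_nonpos (convex_Ioc 0 t) (fun s hs =>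
      (h.hasDerivAt_fst s (hsub (htsub hs))).continuousAt.continuousWithinAt)
      (fun s hs => ?_) fun s hs => ?_
    all_goals
      rw [interior_Ioc] at hs
      have hs' := htsub (Ioo_subset_Ioc_self hs)
    · exact (h.hasDerivAt_fst s (hsub hs')).differentiableAt.differentiableWithinAt
    · rw [(h.hasDerivAt_fst s (hsub hs')).deriv]
      exact (hc s hs').le
  have hmono : MonotoneOn (power x y c σ) (Ioc 0 t) := by
    refine monotoneOn_of_deriv_nonneg (convex_Ioc 0 t) (hcont.mono htsub)
      (fun s hs => ?_) fun s hs => ?_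
    all_goals
      rw [interior_Ioc] at hs
      have hs' := htsub (Ioo_subset_Ioc_self hs)
    · exact (h.hasDerivAt_power (hsub hs') (hc s hs').ne).differentiableAt.differentiableWithinAt
    · rw [(h.hasDerivAt_power (hsub hs') (hc s hs').ne).deriv]
      have h1 := h.center_deriv_nonpos (hsub hs') (hN s hs)
      have h2 : 0 < x s := hxt.trans_le
        (hxanti (Ioo_subset_Ioc_self hs) (right_mem_Ioc.2 ht.1) hs.2.le)
      nlinarith
  have h1 : t / 2 ∈ Ioo 0 t := ⟨by linarith [ht.1], by linarith [ht.1]⟩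
  have h2 := hmono (Ioo_subset_Ioc_self h1) (right_mem_Ioc.2 ht.1) h1.2.le
  rw [hPt] at h2
  exact absurd (hpos _ h1) (not_lt.2 h2)

/-- The canonical circles move to the left, so their centers stay bounded and the tangent cannot
become vertical. -/
theorem cos_neg (hm : 1 ≤ m) (hp : 0 < p) (h : IsProfileSolution m p W β x y c σ κ)
    (hy : Tendsto y (𝓝[>] 0) (𝓝 0)) (hP0 : ∀ᶠ s in 𝓝[>] 0, 0 < power x y c σ s)
    (hc0 : ∀ᶠ s in 𝓝[>] 0, c s < 0) : ∀ s ∈ Ioo 0 β, c s < 0 := by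
  have hcont : ContinuousOn (fun s => -(c s)) (Ioo 0 β) := fun s hs =>
    (h.hasDerivAt_cos s hs).continuousAt.neg.continuousWithinAt
  rcases pos_or_exists_first_zero hcont (hc0.mono fun s hs => neg_pos.2 hs) with
    h1 | ⟨T, hT, hcT, hpos⟩
  · exact fun s hs => neg_pos.1 (h1 s hs)
  exfalso
  have hc : ∀ s ∈ Ioo 0 T, c s < 0 := fun s hs => neg_pos.1 (hpos s hs)
  have hcT' : c T = 0 := neg_eq_zero.1 hcT
  have hsub : Ioo 0 T ⊆ Ioo 0 β := Ioo_subset_Ioo_right hT.2.le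
  have hN := (h.curvatureGap_monotone hm hp hy hT.2.le hc
    (h.power_pos hm hp hy hP0 hT.2.le hc)).2
  have hanti : AntitoneOn (center x y c σ) (Ioo 0 T) := by
    refine antitoneOn_of_deriv_nonpos (convex_Ioo 0 T) (fun s hs =>
      (h.hasDerivAt_center (hsub hs) (hc s hs).ne).continuousAt.continuousWithinAt)
      (fun s hs => ?_) fun s hs => ?_
    all_goals rw [interior_Ioo] at hs
    · exact (h.hasDerivAt_center (hsub hs) (hc s hs).ne).differentiableAt.differentiableWithinAt
    · rw [(h.hasDerivAt_center (hsub hs) (hc s hs).ne).deriv]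
      exact h.center_deriv_nonpos (hsub hs) (hN s hs)
  have hT2 : T / 2 ∈ Ioo 0 T := ⟨by linarith [hT.1], by linarith [hT.1]⟩
  have hcc : ContinuousAt c T := (h.hasDerivAt_cos T hT).continuousAt
  have hIc : ContinuousAt (fun s => x s * c s + y s * σ s) T :=
    ((h.hasDerivAt_fst T hT).continuousAt.mul hcc).add
      ((h.hasDerivAt_snd T hT).continuousAt.mul (h.hasDerivAt_sin T hT).continuousAt)
  have hle : center x y c σ (T / 2) * c T ≤ x T * c T + y T * σ T := by
    refine le_of_tendsto_of_tendsto (b := 𝓝[<] T)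
      ((hcc.tendsto.const_mul _).mono_left nhdsWithin_le_nhds)
      (hIc.tendsto.mono_left nhdsWithin_le_nhds) ?_
    filter_upwards [Ioo_mem_nhdsLT hT2.2] with s hs
    have hs' : s ∈ Ioo 0 T := ⟨hT2.1.trans hs.1, hs.2⟩
    have h1 := hanti hT2 hs' hs.1.le
    have h2 := hc s hs'
    have h3 : x s * c s + y s * σ s = center x y c σ s * c s := by
      rw [center, div_mul_cancel₀ _ h2.ne]
    rw [h3]
    nlinarith
  have h1 := h.inward T hT
  rw [hcT'] at hle h1
  have h2 : y T * σ T = 0 := by linarith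
  have h3 := h.unit_speed T hT
  rcases mul_eq_zero.1 h2 with h4 | h4
  · exact (h.pos T hT).ne' h4
  · rw [hcT', h4] at h3
    norm_num at h3

/-- The curvature gap vanishes at both ends of the curve, hence identically: the curve is a
circle. -/
theorem strictAntiOn_sin (hm : 1 ≤ m) (hp : 0 < p) (h : IsProfileSolution m p W β x y c σ κ)
    (hy : Tendsto y (𝓝[>] 0) (𝓝 0)) (hyβ : Tendsto y (𝓝[<] β) (𝓝 0))
    (hP0 : ∀ᶠ s in 𝓝[>] 0, 0 < power x y c σ s) (hc0 : ∀ᶠ s in 𝓝[>] 0, c s < 0) :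
    StrictAntiOn σ (Ioo 0 β) := by
  have hc := h.cos_neg hm hp hy hP0 hc0
  obtain ⟨hmono, hN⟩ := h.curvatureGap_monotone hm hp hy le_rfl hc
    (h.power_pos hm hp hy hP0 le_rfl hc)
  refine strictAntiOn_of_deriv_neg (convex_Ioo 0 β) (fun s hs =>
    (h.hasDerivAt_sin s hs).continuousAt.continuousWithinAt) fun s hs => ?_
  rw [interior_Ioo] at hs
  have hlim := h.tendsto_curvatureGap hm hp (l := 𝓝[<] β) (Ioo_mem_nhdsLT (hs.1.trans hs.2)) hyβ
  have h0 : curvatureGap m p W x y c σ s ≤ 0 := by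
    refine ge_of_tendsto hlim ?_
    filter_upwards [Ioo_mem_nhdsLT hs.2] with t ht
    exact hmono hs ⟨hs.1.trans ht.1, ht.2⟩ ht.1.le
  have h1 := le_antisymm h0 (hN s hs)
  rw [h.curvatureGap_eq hs] at h1
  have hy := h.pos s hs
  have hR := h.normSq_pos hs
  have h2 : -(c s) - y s * κ s = 0 := by
    rcases mul_eq_zero.1 h1 with h3 | h3
    · exact absurd h3 (by positivity)
    · rcases mul_eq_zero.1 h3 with h4 | h4
      · exact absurd h4 (by positivity)
      · exact h4
  have h3 : 0 < κ s := by
    have : 0 < y s * κ s := by linarith [hc s hs]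
    exact pos_of_mul_pos_right this hy.le
  rw [(h.hasDerivAt_sin s hs).deriv]
  exact mul_neg_of_neg_of_pos (hc s hs) h3

end IsProfileSolution

end CurveEquation

/-! ### The equation along the generating curve -/

section GeneratingCurve

variable {A : Set Plane} {β : ℝ} {γ : ℝ → Plane}

namespace IsGeneratingCurve

theorem hasDerivAt (hγ : IsGeneratingCurve A β γ) {s : ℝ} (hs : s ∈ Ioo (-β) β) :
    HasDerivAt γ (deriv γ s) s :=
  ((hγ.contDiffAt hs).differentiableAt (by simp)).hasDerivAt

theorem contDiffAt_two (hγ : IsGeneratingCurve A β γ) {s : ℝ} (hs : s ∈ Ioo (-β) β) :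
    ContDiffAt ℝ 2 γ s :=
  (hγ.contDiffAt hs).of_le (by norm_cast)

theorem hasDerivAt_deriv (hγ : IsGeneratingCurve A β γ) {s : ℝ} (hs : s ∈ Ioo (-β) β) :
    HasDerivAt (deriv γ) (deriv (deriv γ) s) s :=
  (((hγ.contDiffAt_two hs).derivWithin (m := 1) one_add_one_eq_two.le).differentiableAt
    (by simp)).hasDerivAt

theorem hasDerivAt_apply (hγ : IsGeneratingCurve A β γ) {s : ℝ} (hs : s ∈ Ioo (-β) β) (i : Fin 2) :
    HasDerivAt (fun s => γ s i) (deriv γ s i) s :=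
  (EuclideanSpace.proj (𝕜 := ℝ) i).hasFDerivAt.comp_hasDerivAt s (hγ.hasDerivAt hs)

theorem hasDerivAt_deriv_apply (hγ : IsGeneratingCurve A β γ) {s : ℝ} (hs : s ∈ Ioo (-β) β)
    (i : Fin 2) : HasDerivAt (fun s => deriv γ s i) (deriv (deriv γ) s i) s :=
  (EuclideanSpace.proj (𝕜 := ℝ) i).hasFDerivAt.comp_hasDerivAt s (hγ.hasDerivAt_deriv hs)

theorem inner_deriv (γ : ℝ → Plane) (s : ℝ) :
    inner ℝ (γ s) (deriv γ s) = γ s 0 * deriv γ s 0 + γ s 1 * deriv γ s 1 := by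
  simp only [PiLp.inner_apply, Fin.sum_univ_two, RCLike.inner_apply, conj_trivial]
  ring

theorem hasDerivAt_normSq (hγ : IsGeneratingCurve A β γ) {s : ℝ} (hs : s ∈ Ioo (-β) β) :
    HasDerivAt (fun s => ‖γ s‖ ^ 2) (2 * inner ℝ (γ s) (deriv γ s)) s :=
  (hγ.hasDerivAt hs).norm_sq

theorem mem_Ioo_neg (hγ : IsGeneratingCurve A β γ) {s : ℝ} (hs : s ∈ Ico 0 β) : s ∈ Ioo (-β) β :=
  ⟨by linarith [hs.1, hγ.pos], hs.2⟩

theorem unit_speed (hγ : IsGeneratingCurve A β γ) {s : ℝ} (hs : s ∈ Ioo (-β) β) :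
    deriv γ s 0 ^ 2 + deriv γ s 1 ^ 2 = 1 := by
  rw [← plane_norm_sq, hγ.norm_deriv s hs, one_pow]

theorem zero_mem (hγ : IsGeneratingCurve A β γ) : (0 : ℝ) ∈ Ioo (-β) β :=
  ⟨by linarith [hγ.pos], hγ.pos⟩

theorem tendsto_zero (hγ : IsGeneratingCurve A β γ) : Tendsto γ (𝓝[>] 0) (𝓝 !₂[1, 0]) := by
  rw [← hγ.start]
  exact ((hγ.contDiffAt hγ.zero_mem).continuousAt.tendsto).mono_left nhdsWithin_le_nhds

theorem deriv_zero (hγ : IsGeneratingCurve A β γ) : deriv γ 0 0 = 0 ∧ deriv γ 0 1 = 1 := by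
  have h0 := hγ.zero_mem
  have hx := hγ.hasDerivAt_apply h0 0
  have hc : deriv γ 0 0 = 0 := by
    have h1 : HasDerivAt (fun s => γ (-s) 0) (-(deriv γ 0 0)) 0 := by
      have h2 : HasDerivAt (fun s => γ s 0) (deriv γ 0 0) (-0) := by rwa [neg_zero]
      exact (h2.comp (0 : ℝ) (hasDerivAt_neg (0 : ℝ))).congr_deriv (by ring)
    have h3 : (fun s => γ (-s) 0) =ᶠ[𝓝 0] fun s => γ s 0 := by
      filter_upwards [Icc_mem_nhds h0.1 h0.2] with s hs using hγ.symm_fst s hs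
    have := h1.unique (hx.congr_of_eventuallyEq h3)
    linarith
  have hy0 : γ 0 1 = 0 := by rw [hγ.start]; simp
  have hs : 0 ≤ deriv γ 0 1 := by
    refine deriv_nonneg_of_eventually (h := fun s => γ s 1) (hγ.hasDerivAt_apply h0 1) hy0 ?_
    filter_upwards [Ioo_mem_nhdsGT hγ.pos] with s hs using (hγ.above_axis s hs).le
  refine ⟨hc, ?_⟩
  have := hγ.unit_speed h0
  rw [hc] at this
  nlinarith

end IsGeneratingCurve

variable {n : ℕ} {p : ℝ}

theorem IsGeneratingCurve.continuousOn_generalizedCurvature (hγ : IsGeneratingCurve A β γ) :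
    ContinuousOn (generalizedCurvature n p γ) (Ioo 0 β) := by
  intro s hs
  have hs' := hγ.mem_Ioo_neg (Ioo_subset_Ico_self hs)
  have c0 : ∀ i, ContinuousAt (fun s => γ s i) s := fun i =>
    (hγ.hasDerivAt_apply hs' i).continuousAt
  have c1 : ∀ i, ContinuousAt (fun s => deriv γ s i) s := fun i =>
    (hγ.hasDerivAt_deriv_apply hs' i).continuousAt
  have c2 : ∀ i, ContinuousAt (fun s => deriv (deriv γ) s i) s := fun i => by
    have h2 : ContinuousAt (deriv (deriv γ)) s :=
      (((hγ.contDiffAt_two hs').derivWithin (m := 1) one_add_one_eq_two.le).derivWithin (m := 0)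
        (by simp)).continuousAt
    exact (by fun_prop : Continuous fun q : Plane => q i).continuousAt.comp h2
  have cn : ContinuousAt (fun s => ‖γ s‖) s := (hγ.hasDerivAt hs').continuousAt.norm
  have hy := hγ.above_axis s hs
  have hr : ‖γ s‖ ≠ 0 := norm_ne_zero_iff.2 fun h => by simp [h] at hy
  refine ContinuousAt.continuousWithinAt ?_
  exact ((((c1 0).mul (c2 1)).sub ((c1 1).mul (c2 0))).sub
    ((continuousAt_const.mul (c1 0)).div (c0 1) hy.ne')).add
    ((continuousAt_const.mul (((c0 0).mul (c1 1)).sub ((c0 1).mul (c1 0)))).div (cn.pow 2)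
      (pow_ne_zero 2 hr))

/-- The coordinates of the generating curve satisfy the system of `IsProfileSolution` as soon as the
generalized mean curvature is constant. The exponent `m = n - 2` is the dimension of the spheres of
revolution. -/
theorem IsGeneratingCurve.isProfileSolution (hγ : IsGeneratingCurve A β γ) {W : ℝ} (hn : 2 ≤ n)
    (hnorm : ∀ s ∈ Ioo 0 β, ‖γ s‖ ≤ 1) (hin : ∀ s ∈ Ioo 0 β, inner ℝ (γ s) (deriv γ s) ≤ 0)
    (hW : ∀ s ∈ Ioo 0 β, generalizedCurvature n p γ s = W) :
    IsProfileSolution (n - 2) p W β (fun s => γ s 0) (fun s => γ s 1) (fun s => deriv γ s 0)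
      (fun s => deriv γ s 1)
      fun s => deriv γ s 0 * deriv (deriv γ) s 1 - deriv γ s 1 * deriv (deriv γ) s 0 := by
  have hI : ∀ s ∈ Ioo 0 β, s ∈ Ioo (-β) β := fun s hs => hγ.mem_Ioo_neg (Ioo_subset_Ico_self hs)
  have horth : ∀ s ∈ Ioo 0 β,
      deriv γ s 0 * deriv (deriv γ) s 0 + deriv γ s 1 * deriv (deriv γ) s 1 = 0 := by
    intro s hs
    have h1 := ((hγ.hasDerivAt_deriv_apply (hI s hs) 0).pow 2).add
      ((hγ.hasDerivAt_deriv_apply (hI s hs) 1).pow 2)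
    have h2 : (fun s => deriv γ s 0) ^ 2 + (fun s => deriv γ s 1) ^ 2 =ᶠ[𝓝 s] fun _ => (1 : ℝ) := by
      filter_upwards [Ioo_mem_nhds hs.1 hs.2] with t ht using hγ.unit_speed (hI t ht)
    have h3 := h1.unique ((hasDerivAt_const s (1 : ℝ)).congr_of_eventuallyEq h2)
    simp only [Nat.cast_ofNat, Nat.add_one_sub_one, pow_one] at h3
    linarith
  refine ⟨fun s hs => hγ.hasDerivAt_apply (hI s hs) 0, fun s hs => hγ.hasDerivAt_apply (hI s hs) 1,
    fun s hs => (hγ.hasDerivAt_deriv_apply (hI s hs) 0).congr_deriv ?_,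
    fun s hs => (hγ.hasDerivAt_deriv_apply (hI s hs) 1).congr_deriv ?_,
    fun s hs => hγ.unit_speed (hI s hs), hγ.above_axis, fun s hs => ?_, fun s hs => ?_,
    fun s hs => ?_⟩
  · linear_combination (-(deriv (deriv γ) s 0)) * hγ.unit_speed (hI s hs) +
      deriv γ s 0 * horth s hs
  · linear_combination (-(deriv (deriv γ) s 1)) * hγ.unit_speed (hI s hs) +
      deriv γ s 1 * horth s hs
  · rw [← plane_norm_sq]
    exact pow_le_one₀ (norm_nonneg _) (hnorm s hs)
  · rw [← IsGeneratingCurve.inner_deriv]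
    exact hin s hs
  · rw [← hW s hs, generalizedCurvature, plane_norm_sq, Nat.cast_sub hn]
    push_cast
    ring

variable [NeZero n] {E : Set (EuclideanSpace ℝ (Fin n))}

/-- The generating curve turns towards the origin and its generalized mean curvature is constant.
Indeed the generating set lies on both sides of the curve either nowhere or everywhere; in the
latter case the curve would be an arc of the unit circle, which bounds the generating set. -/
theorem IsGeneratingCurve.curvature_eq_const (hn : 2 ≤ n) (hp : 0 < p) (hE : IsIsoperimetric p E)
    (hEo : IsOpen E) (hne : E.Nonempty) (hsymm : IsSphericallySymmetric E)
    (hγ : IsGeneratingCurve (generatingSet E) β γ) :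
    (∀ s ∈ Ioo 0 β, ‖γ s‖ ≤ 1) ∧ (∀ s ∈ Ioo 0 β, inner ℝ (γ s) (deriv γ s) ≤ 0) ∧
      ∃ W : ℝ, ∀ s ∈ Ioo 0 β, generalizedCurvature n p γ s = W := by
  have hball := generatingSet_subset_closedBall hn hp hsymm hE.volume_ne_top hγ.rightmost
  have hcl : closure (generatingSet E) ⊆ Metric.closedBall 0 1 :=
    closure_minimal hball Metric.isClosed_closedBall
  have hint : interior (closure (generatingSet E)) ⊆ Metric.ball 0 1 := by
    rw [← interior_closedBall (0 : Plane) one_ne_zero]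
    exact interior_mono hcl
  have hI : ∀ s ∈ Ioo 0 β, s ∈ Ioo (-β) β := fun s hs => hγ.mem_Ioo_neg (Ioo_subset_Ico_self hs)
  have hnorm : ∀ s ∈ Ioo 0 β, ‖γ s‖ ≤ 1 := fun s hs => mem_closedBall_zero_iff.1
    (hcl (frontier_subset_closure (hγ.mem_frontier s (Ioo_subset_Icc_self (hI s hs)))))
  refine ⟨hnorm, ?_⟩
  obtain ⟨Λ, hΛ⟩ := IsGeneratingCurve.dichotomy hn hp hE hEo hne hsymm
  have hdich := hΛ β γ hγ
  have hdiff : ∀ s ∈ Ioo 0 β, HasDerivAt (fun s => ‖γ s‖ ^ 2) (2 * inner ℝ (γ s) (deriv γ s)) s :=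
    fun s hs => hγ.hasDerivAt_normSq (hI s hs)
  have hlim : Tendsto (fun s => ‖γ s‖ ^ 2) (𝓝[>] 0) (𝓝 1) := by
    have := (hγ.tendsto_zero.norm).pow 2
    rwa [plane_norm_sq, show (!₂[(1 : ℝ), 0] : Plane) 0 ^ 2 + (!₂[(1 : ℝ), 0] : Plane) 1 ^ 2 = 1 by
      simp] at this
  -- a curve that does not turn towards the origin stays on the unit circle
  have hcirc : (∀ s ∈ Ioo 0 β, 0 ≤ inner ℝ (γ s) (deriv γ s)) → ∀ s ∈ Ioo 0 β, ‖γ s‖ ^ 2 = 1 := by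
    intro h s hs
    have hmono : MonotoneOn (fun s => ‖γ s‖ ^ 2) (Ioo 0 β) := by
      refine monotoneOn_of_deriv_nonneg (convex_Ioo 0 β) (fun s hs =>
        (hdiff s hs).continuousAt.continuousWithinAt) (fun s hs => ?_) fun s hs => ?_
      all_goals rw [interior_Ioo] at hs
      · exact (hdiff s hs).differentiableAt.differentiableWithinAt
      · rw [(hdiff s hs).deriv]
        linarith [h s hs]
    refine le_antisymm (pow_le_one₀ (norm_nonneg _) (hnorm s hs)) (le_of_tendsto hlim ?_)
    filter_upwards [Ioo_mem_nhdsGT hs.1] with t ht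
    exact hmono ⟨ht.1, ht.2.trans hs.2⟩ hs ht.2.le
  set S := {s | γ s ∈ interior (closure (generatingSet E))} with hS
  have hside := subset_or_subset_compl_of_notMem_frontier (S := S)
    (isPreconnected_Ioo (a := (0 : ℝ)) (b := β)) (by
    intro s hs hfr
    rw [frontier_eq_closure_inter_closure, mem_inter_iff, mem_closure_iff_frequently,
      mem_closure_iff_frequently] at hfr
    by_cases h : s ∈ S
    · exact hfr.2 (((hγ.hasDerivAt (hI s hs)).continuousAt.eventually
        (isOpen_interior.mem_nhds h)).mono fun t ht => not_not.2 ht)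
    · exact hfr.1 ((hdich s hs).resolve_left fun h' => h h'.1).1)
  have hout : ∀ s ∈ Ioo 0 β, s ∉ S := by
    rcases hside with h | h
    · exfalso
      have h2 : β / 2 ∈ Ioo 0 β := ⟨by linarith [hγ.pos], by linarith [hγ.pos]⟩
      have h3 := hcirc (fun s hs => ((hdich s hs).resolve_right fun h' =>
        h'.1.self_of_nhds (h hs)).2.ge) _ h2
      have h4 := mem_ball_zero_iff.1 (hint (h h2))
      nlinarith [norm_nonneg (γ (β / 2))]
    · exact fun s hs => h hs
  have hdich' := fun s hs => ((hdich s hs).resolve_left fun h' => hout s hs h'.1).2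
  have h2 : β / 2 ∈ Ioo 0 β := ⟨by linarith [hγ.pos], by linarith [hγ.pos]⟩
  have hΛ0 : 0 < Λ := (hdich' _ h2).1
  rcases (isPreconnected_Ioo (a := (0 : ℝ)) (b := β)).eq_or_eq_neg_of_sq_eq
    (hγ.continuousOn_generalizedCurvature (n := n) (p := p)) (continuousOn_const (c := Λ))
    (fun s hs => by
      rcases (hdich' s hs).2 with h | h
      · simp [h.1]
      · simp [h.1]) (fun _ => hΛ0.ne') with h | h
  · refine ⟨fun s hs => ?_, Λ, h⟩
    rcases (hdich' s hs).2 with h' | h'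
    · exact h'.2
    · have := h hs
      rw [h'.1] at this
      linarith
  · refine ⟨fun s hs => ?_, -Λ, h⟩
    have hconst := hcirc fun s hs => by
      rcases (hdich' s hs).2 with h' | h'
      · have := h hs
        rw [h'.1] at this
        simp only [Pi.neg_apply] at this
        linarith
      · exact h'.2
    have h3 : (fun s => ‖γ s‖ ^ 2) =ᶠ[𝓝 s] fun _ => (1 : ℝ) := by
      filter_upwards [Ioo_mem_nhds hs.1 hs.2] with t ht using hconst t ht
    have h4 := (hdiff s hs).unique ((hasDerivAt_const s (1 : ℝ)).congr_of_eventuallyEq h3)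
    linarith

end GeneratingCurve

end RadialDensity

end

theorem mainTheorem6 (n : ℕ) [NeZero n] (hn : 3 ≤ n) (p : ℝ) (hp : 0 < p)
    (E : Set (EuclideanSpace ℝ (Fin n))) (hE_open : IsOpen E)
    (hE_iso : RadialDensity.IsIsoperimetric p E)
    (hE_symm : RadialDensity.IsSphericallySymmetric E)
    (β : ℝ) (γ : ℝ → RadialDensity.Plane)
    (hγ : RadialDensity.IsGeneratingCurve (RadialDensity.generatingSet E) β γ)
    (F₀ : ℝ) (hF : RadialDensity.HasInitialAbscissa γ F₀) (hleft : F₀ < 1 / 2) :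
    ∃ δ : ℝ, IsLUB (RadialDensity.upperCurve β γ) δ ∧ δ ∈ Ico 0 β ∧
      ∀ s ∈ Ico 0 β, deriv γ s = !₂[-1, 0] ↔ s = δ := by
  have hn2 : 2 ≤ n := by omega
  have hne : E.Nonempty := by
    by_contra h
    rw [not_nonempty_iff_eq_empty] at h
    have := hγ.mem_frontier 0 (Ioo_subset_Icc_self hγ.zero_mem)
    simp [RadialDensity.generatingSet, h] at this
  obtain ⟨hnorm, hin, W, hW⟩ :=
    RadialDensity.IsGeneratingCurve.curvature_eq_const hn2 hp hE_iso hE_open hne hE_symm hγ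
  have h := hγ.isProfileSolution (n := n) (p := p) hn2 hnorm hin hW
  have hI : ∀ s ∈ Ioo 0 β, s ∈ Ioo (-β) β := fun s hs => hγ.mem_Ioo_neg (Ioo_subset_Ico_self hs)
  have hlim : ∀ i, Tendsto (fun s => γ s i) (𝓝[>] 0) (𝓝 ((!₂[1, 0] : RadialDensity.Plane) i)) :=
    fun i => ((by fun_prop : Continuous fun q : RadialDensity.Plane => q i).tendsto _).comp
      hγ.tendsto_zero
  have hx : Tendsto (fun s => γ s 0) (𝓝[>] 0) (𝓝 1) := by simpa using hlim 0
  have hy : Tendsto (fun s => γ s 1) (𝓝[>] 0) (𝓝 0) := by simpa using hlim 1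
  have hyβ : Tendsto (fun s => γ s 1) (𝓝[<] β) (𝓝 0) := by
    have h1 : ContinuousWithinAt γ (Icc (-β) β) β :=
      hγ.continuousOn β ⟨by linarith [hγ.pos], le_rfl⟩
    have h2 : Tendsto γ (𝓝[<] β) (𝓝 (γ β)) := by
      refine h1.tendsto.mono_left ?_
      rw [← nhdsWithin_Ico_eq_nhdsLT (by linarith [hγ.pos] : -β < β)]
      exact nhdsWithin_mono _ Ico_subset_Icc_self
    have h3 := ((by fun_prop : Continuous fun q : RadialDensity.Plane => q 1).tendsto _).comp h2
    rwa [hγ.end_on_axis] at h3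
  have hσ : Tendsto (fun s => deriv γ s 1) (𝓝[>] 0) (𝓝 1) := by
    have := (hγ.hasDerivAt_deriv_apply hγ.zero_mem 1).continuousAt.tendsto
    rw [hγ.deriv_zero.2] at this
    exact this.mono_left nhdsWithin_le_nhds
  -- the curve starts to the left, since it turns towards the origin
  have hc0 : ∀ᶠ s in 𝓝[>] (0 : ℝ), deriv γ s 0 < 0 := by
    filter_upwards [hx.eventually_const_lt one_half_lt_one, hσ.eventually_const_lt one_half_lt_one,
      Ioo_mem_nhdsGT hγ.pos] with s h1 h2 hs
    have h3 := h.inward s hs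
    have h4 := h.pos s hs
    simp only at h3 h4
    by_contra h5
    have h6 : 0 < γ s 1 * deriv γ s 1 := mul_pos h4 (by linarith)
    have h7 : 0 ≤ γ s 0 * deriv γ s 0 := mul_nonneg (by linarith) (not_lt.1 h5)
    linarith
  -- the left case: the origin lies inside the canonical circles near the start
  have hP0 : ∀ᶠ s in 𝓝[>] (0 : ℝ), 0 < RadialDensity.IsProfileSolution.power (fun s => γ s 0)
      (fun s => γ s 1) (fun s => deriv γ s 0) (fun s => deriv γ s 1) s := by
    have hF' : Tendsto (RadialDensity.IsProfileSolution.center (fun s => γ s 0)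
        (fun s => γ s 1) (fun s => deriv γ s 0) (fun s => deriv γ s 1)) (𝓝[>] 0) (𝓝 F₀) := by
      refine (hF.mono_left (nhdsWithin_mono 0 fun x (hx : 0 < x) => hx.ne')).congr fun s => ?_
      rw [RadialDensity.canonicalAbscissa, RadialDensity.IsGeneratingCurve.inner_deriv]
      rfl
    have h1 := ((hx.pow 2).add (hy.pow 2)).sub ((hx.const_mul 2).mul hF')
    exact h1.eventually_const_lt (by linarith)
  have hm : 1 ≤ n - 2 := by omega
  have hc := h.cos_neg hm hp hy hP0 hc0
  have hanti := h.strictAntiOn_sin hm hp hy hyβ hP0 hc0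
  obtain ⟨δ, hδ, hσδ⟩ := exists_hasDerivAt_eq_zero' hγ.pos hy hyβ h.hasDerivAt_snd
  simp only at hc hσδ
  refine ⟨δ, ?_, Ioo_subset_Ico_self hδ, fun s hs => ⟨fun hd => ?_, ?_⟩⟩
  · have hK : RadialDensity.upperCurve β γ = Ioc 0 δ := by
      ext s
      constructor
      · rintro ⟨hs, hst⟩
        refine ⟨hs.1, not_lt.1 fun hlt => ?_⟩
        have := (hst δ ⟨hδ.1, hlt⟩).2
        rw [hσδ] at this
        exact lt_irrefl _ this
      · intro hs
        refine ⟨⟨hs.1, hs.2.trans_lt hδ.2⟩, fun t ht => ?_⟩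
        have ht' : t ∈ Ioo 0 β := ⟨ht.1, ht.2.trans_le (hs.2.trans hδ.2.le)⟩
        have := hanti ht' hδ (ht.2.trans_le hs.2)
        simp only [hσδ] at this
        exact ⟨hc t ht', this⟩
    rw [hK]
    exact isLUB_Ioc hδ.1
  · have hσs : deriv γ s 1 = 0 := by rw [hd]; simp
    rcases hs.1.eq_or_lt with h0 | h0
    · rw [← h0, hγ.deriv_zero.2] at hσs
      norm_num at hσs
    · exact hanti.injOn ⟨h0, hs.2⟩ hδ (by simp only [hσs, hσδ])
  · rintro rfl
    have hu := hγ.unit_speed (hI s hδ)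
    have hcs := hc s hδ
    rw [hσδ] at hu
    ext i
    fin_cases i
    · simp only [Fin.zero_eta, Matrix.cons_val_zero]
      nlinarith
    · simpa using hσδ
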